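/- Let $K_{2n}$ be the complete graph on $2n$ labelled vertices $0,\dots,2n-1$, with an edge-colouring (not necessarily proper) by natural numbers. A perfect matching is \emph{rainbow} if its edges have distinct colours. A \emph{flaw} is an unordered pair $f=\{v_1v_2,\,v_3v_4\}$ of vertex-disjoint edges of the same colour; it is present in a perfect matching $M$ if both edges belong to $M$. For a flaw $f$ present in $M$, let $A(f,M)$ be the set of perfect matchings obtained as follows: choose a vertex $u_1\notin\{v_1,v_2,v_3,v_4\}$, let $u_1u_2\in M$, choose a vertex $u_3\notin\{v_1,v_2,v_3,v_4,u_1,u_2\}$, let $u_3u_4\in M$, and replace the edges $v_1v_2,\,u_1u_2,\,v_3v_4,\,u_3u_4$ of $M$ by $v_1u_1,\,v_2u_2,\,v_3u_3,\,v_4u_4$. Programs run on a randomised word RAM with word size $w$: finitely many registers and a random access memory of $w$-bit words. Loading a constant, addition, truncated subtraction and multiplication (results modulo $2^w$), reading and writing a memory word at an address held in a register, drawing a uniformly random integer from $\{0,\dots,r\}$ where $r$ is the content of a register, and comparing two registers to control a branch or a loop take one unit of time each. The input consists of $n$ and the $2n\times 2n$ matrix of colours (with zeros on the diagonal); the output is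 the list of the partners of the vertices in the matching. \textbf{Theorem.} There are a single program $\mathcal P$ of the form ``\emph{init}; while \emph{test} do \emph{body}'' and a constant $B$ such that for every real $C>2\mathrm e$ there is a constant $K=K(C)$ with the following property. Let $n\ge1$, let $w$ be any word size with $2^w\ge Bn^2$, and let an edge-colouring of $K_{2n}$ be given in which all colours are less than $2^w$ and each colour appears on at most $n/C$ edges. Then: (i) $\mathcal P$ performs the uniform random walk on perfect matchings that always addresses the greatest flaw present. That is, for some fixed linear ordering of the flaws: \emph{init} terminates; each time the loop test is reached, the memory holds a perfect matching $M$; if $M$ is rainbow, the loop is left and $M$ is output; and if $M$ is not rainbow and $f$ is the greatest flaw present in $M$, then $A(f,M)\neq\emptyset$ and \emph{body} is executed, terminates, and replaces $M$ by a uniformly random element of $A(f,M)$ (conditionally on the whole current state of the machine). (ii) $\mathcal P$ finds a rainbow perfect matching in $O(n^4\log n)$ time: for every integer $s\ge1$, with probability at least $1-2^{-sn}$, $\mathcal P$ halts within $K\,s\,n^4\log n$ steps and outputs a rainbow perfect matching. (In particular, the running time is $O(n^4\log n)$ with high probability and in expectation.) -/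

import Mathlib

open scoped ENNReal

namespace RainbowMatching

/-! ## A randomised word RAM

A state has registers, named directly by programs, and a random access memory, addressed
through registers.  With word size `w` all results are reduced modulo `2 ^ w`. -/

structure State where
  reg : ℕ → ℕ
  mem : ℕ → ℕ

/-- Store a word in register `d`. -/
def State.setReg (w : ℕ) (s : State) (d k : ℕ) : State :=
  { s with reg := Function.update s.reg d (k % 2 ^ w) }

/-- Elementary instructions; the arguments are register names, except for the constant `k`. -/
inductive Instr where
  | const (d k : ℕ)
  | add (d a b : ℕ)
  | sub (d a b : ℕ)
  | mul (d a b : ℕ)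
  | load (d a : ℕ)
  | store (a b : ℕ)
  | rand (d a : ℕ)

/-- Effect of an elementary instruction.  `load d a` reads the memory word whose address is in
register `a`; `store a b` writes register `b` to the address in register `a`; `sub` is truncated
at zero; `rand d a` puts into register `d` a fresh uniformly random element of
`{0, 1, …, reg a}`. -/
noncomputable def Instr.exec (w : ℕ) (s : State) : Instr → PMF State
  | .const d k => PMF.pure (s.setReg w d k)
  | .add d a b => PMF.pure (s.setReg w d (s.reg a + s.reg b))
  | .sub d a b => PMF.pure (s.setReg w d (s.reg a - s.reg b))
  | .mul d a b => PMF.pure (s.setReg w d (s.reg a * s.reg b))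
  | .load d a => PMF.pure (s.setReg w d (s.mem (s.reg a)))
  | .store a b => PMF.pure { s with mem := Function.update s.mem (s.reg a) (s.reg b) }
  | .rand d a => (PMF.uniformOfFintype (Fin (s.reg a + 1))).map fun i => s.setReg w d i

/-- Structured programs.  The tests in `ite a b p q` and `loop a b p` are `reg a < reg b`. -/
inductive Prog where
  | op (i : Instr)
  | seq (p q : Prog)
  | ite (a b : ℕ) (p q : Prog)
  | loop (a b : ℕ) (p : Prog)

/-- A configuration: the stack of programs still to be executed, and the state.  The machine has
halted when the stack is empty. -/
structure Config where
  control : List Prog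
  state : State

/-- One step of the machine, which costs one unit of time. -/
noncomputable def step (w : ℕ) : Config → PMF Config
  | ⟨[], s⟩ => PMF.pure ⟨[], s⟩
  | ⟨.op i :: k, s⟩ => (i.exec w s).map fun s' => ⟨k, s'⟩
  | ⟨.seq p q :: k, s⟩ => PMF.pure ⟨p :: q :: k, s⟩
  | ⟨.ite a b p q :: k, s⟩ =>
      PMF.pure (if s.reg a < s.reg b then ⟨p :: k, s⟩ else ⟨q :: k, s⟩)
  | ⟨.loop a b p :: k, s⟩ =>
      PMF.pure (if s.reg a < s.reg b then ⟨p :: .loop a b p :: k, s⟩ else ⟨k, s⟩)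

/-- Distribution of the configuration after `t` steps. -/
noncomputable def run (w : ℕ) : ℕ → Config → PMF Config
  | 0, c => PMF.pure c
  | t + 1, c => (step w c).bind (run w t)

/-! ## Perfect matchings of the complete graph on `2n` vertices, flaws and switches -/

/-- The complete graph on `2n` vertices. -/
abbrev K2 (n : ℕ) : SimpleGraph (Fin (2 * n)) := ⊤

/-- Edge-colourings; they need not be proper. -/
abbrev Coloring (n : ℕ) := SimpleGraph.TopEdgeLabeling (Fin (2 * n)) ℕ

/-- The perfect matchings of the complete graph on `2n` vertices. -/
abbrev PM (n : ℕ) := {M : (K2 n).Subgraph // M.IsPerfectMatching}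

/-- The edges of the matching have distinct colours. -/
def Rainbow {n : ℕ} (col : Coloring n) (M : PM n) : Prop :=
  Set.InjOn col {e : (K2 n).edgeSet | (e : Sym2 (Fin (2 * n))) ∈ M.1.edgeSet}

/-- An unordered pair of vertex-disjoint edges `{v₁, v₂}`, `{v₃, v₄}` of the same colour, in the
normal form `v₂ < v₁`, `v₄ < v₃ < v₁`. -/
structure Flaw {n : ℕ} (col : Coloring n) where
  v₁ : Fin (2 * n)
  v₂ : Fin (2 * n)
  v₃ : Fin (2 * n)
  v₄ : Fin (2 * n)
  lt₂₁ : v₂ < v₁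
  lt₄₃ : v₄ < v₃
  lt₃₁ : v₃ < v₁
  ne₂₃ : v₂ ≠ v₃
  ne₂₄ : v₂ ≠ v₄
  same : col.get v₁ v₂ lt₂₁.ne' = col.get v₃ v₄ lt₄₃.ne'

/-- The flaw is present in `M`: both of its edges belong to `M`. -/
def Flaw.Present {n : ℕ} {col : Coloring n} (f : Flaw col) (M : PM n) : Prop :=
  M.1.Adj f.v₁ f.v₂ ∧ M.1.Adj f.v₃ f.v₄

/-- The possible results of addressing the flaw `f` in `M`: choose a vertex `u₁` off `f`, with
partner `u₂`, then a vertex `u₃` off `f` and `{u₁, u₂}`, with partner `u₄`, and replace the edges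
`v₁v₂, u₁u₂, v₃v₄, u₃u₄` by `v₁u₁, v₂u₂, v₃u₃, v₄u₄`. -/
def Flaw.actions {n : ℕ} {col : Coloring n} (f : Flaw col) (M : PM n) : Set (PM n) :=
  {M' | ∃ u₁ u₂ u₃ u₄ : Fin (2 * n),
    u₁ ∉ ({f.v₁, f.v₂, f.v₃, f.v₄} : Set (Fin (2 * n))) ∧ M.1.Adj u₁ u₂ ∧
    u₃ ∉ ({f.v₁, f.v₂, f.v₃, f.v₄, u₁, u₂} : Set (Fin (2 * n))) ∧ M.1.Adj u₃ u₄ ∧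
    M'.1.edgeSet =
      (M.1.edgeSet \ {s(f.v₁, f.v₂), s(u₁, u₂), s(f.v₃, f.v₄), s(u₃, u₄)}) ∪
        {s(f.v₁, u₁), s(f.v₂, u₂), s(f.v₃, u₃), s(f.v₄, u₄)}}

/-! ## Input, output, and what it means for a program to perform the walk -/

/-- Input of a program: `n` is in register `0`, and the matrix of the colouring is in memory,
the colour of `{u, v}` at address `u * (2 * n) + v` (and `0` on the diagonal).  All other words
are `0`. -/
def input (n : ℕ) (col : Coloring n) : State where
  reg := fun i => if i = 0 then n else 0
  mem := fun a =>
    if h : a / (2 * n) < 2 * n ∧ a % (2 * n) < 2 * n ∧ a / (2 * n) ≠ a % (2 * n) then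
      col.get ⟨a / (2 * n), h.1⟩ ⟨a % (2 * n), h.2.1⟩ (by simpa using h.2.2)
    else 0

/-- The `2n` memory words from address `(2n)²` on list the partners of the vertices in `M`. -/
def Holds {n : ℕ} (s : State) (M : PM n) : Prop :=
  ∀ u v : Fin (2 * n), M.1.Adj u v ↔ s.mem ((2 * n) ^ 2 + u) = v

/-- The program has halted, and its output is a rainbow perfect matching. -/
def Success {n : ℕ} (col : Coloring n) (c : Config) : Prop :=
  c.control = [] ∧ ∃ M : PM n, Rainbow col M ∧ Holds c.state M

/-- On the colouring `col`, the program `init; while reg a < reg b do body` performs the uniform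
random walk on perfect matchings that always addresses the greatest flaw present: `init`
terminates; whenever control is at the head of the loop, memory holds a perfect matching `M`; if
`M` is rainbow the loop is left; otherwise, for the greatest flaw `f` of `M` in some fixed ordering,
`body` is executed, it terminates, and it replaces `M` by a uniformly random element of the set of
actions for `f` in `M`. -/
def PerformsSwitchWalk (w : ℕ) {n : ℕ} (col : Coloring n)
    (init : Prog) (a b : ℕ) (body : Prog) : Prop :=
  ∃ rank : Flaw col → ℕ, Function.Injective rank ∧
    (∃ t, ∀ c ∈ (run w t ⟨[init], input n col⟩).support, c.control = []) ∧
    ∀ t, ∀ c ∈ (run w t ⟨[.seq init (.loop a b body)], input n col⟩).support,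
      c.control = [.loop a b body] →
      ∃ M : PM n, Holds c.state M ∧
        (Rainbow col M → ¬ c.state.reg a < c.state.reg b) ∧
        ∀ f : Flaw col, f.Present M → (∀ g : Flaw col, g.Present M → rank g ≤ rank f) →
          c.state.reg a < c.state.reg b ∧ (f.actions M).Nonempty ∧
          ∃ t', ∀ M' ∈ f.actions M,
            (run w t' ⟨[body], c.state⟩).toOuterMeasure
              {c' | c'.control = [] ∧ Holds c'.state M'} = ((f.actions M).ncard : ℝ≥0∞)⁻¹

end RainbowMatching

open scoped ENNReal

namespace RainbowMatching

/-! The length of the walk. Put A = (2n-4)(2n-6). A round replaces M by one of A equally likely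
results of addressing its greatest flaw f. Two facts make the walk short. A switch is reversible: f
and M' determine M, because the partners in M' of the vertices of f are the chosen u₁, …, u₄
(`Flaw.actions_atomic`). A switch is local: every new edge contains a vertex of f, so every new flaw
is among the at most 4(2n-1)(n/C-1) flaws of `Flaw.nbrs f` (`Flaw.mem_nbrs_of_new`,
`Flaw.card_nbrs_le`).

Split the event that the walk from M lasts m rounds according to the set E of those flaws of M that
get addressed before they disappear otherwise; this yields `survivalOn`. Since the greatest flaw is
always the one addressed, E alone determines the next flaw f: it is the greatest element of E. Sum
over all matchings M. By reversibility each M' then occurs at most once, and the new flaws to be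
addressed form a subset of Γ f, which accounts for a factor (1+μ)^|Γ f|. If α(1+μ)^|Γ f| ≤ λμ for
all f, induction on m bounds the sum by λ^m |Ω| μ^|E| (`sum_survivalOn_le`), and summing over E
bounds the survival probability (`survival_le`).

Here α = 1/A and μ = C/(2A). Then μ|Γ f| ≤ 1, so (1+μ)^|Γ f| ≤ e and λ = 2e/C < 1 is admissible
(`weight_condition`). The factors |Ω| ≤ (2n)^(2n) and (1+μ)^(4n²) are outweighed by λ^m once m is of
order s n log n (`exp_bound`).

The program. It scans the pairs x > y lexicographically and keeps the last pair of larger endpoints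
of equally coloured edges of M; this is the greatest flaw. A random vertex is found by drawing its
number among the vertices not yet removed. Pairs of draws correspond bijectively to actions
(`round_spec`), so the result is uniform. A round takes O(n²) steps, so the whole run takes O(n³ log
n), a factor n below what is claimed.

Machine and walk are linked by `Runs`, a compositional specification of running time and final
distribution; `one_le_survival_add` turns the survival estimate into a bound for the machine. -/

/-! ## Executions of programs -/

/-- A set of configurations that the machine cannot leave. -/
def Absorbing (w : ℕ) (X : Set Config) : Prop :=
  ∀ c ∈ X, ∀ c' ∈ (step w c).support, c' ∈ X

theorem PMF.toOuterMeasure_bind_mono {α β : Type*} (p : PMF α) {f g : α → PMF β} {X Y : Set β}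
    (h : ∀ a ∈ p.support, (f a).toOuterMeasure X ≤ (g a).toOuterMeasure Y) :
    (p.bind f).toOuterMeasure X ≤ (p.bind g).toOuterMeasure Y := by
  rw [PMF.toOuterMeasure_bind_apply, PMF.toOuterMeasure_bind_apply]
  refine ENNReal.tsum_le_tsum fun a => ?_
  by_cases ha : a ∈ p.support
  · exact mul_le_mul_right (h a ha) _
  · rw [(p.apply_eq_zero_iff a).2 ha]; simp

/-- The extra step can be moved to the end of the run: unfolding `run` from the front reduces the
claim to time 0, where it is the absorption property. -/
theorem Absorbing.run_le_succ {w : ℕ} {X : Set Config} (hX : Absorbing w X) (t : ℕ) (c : Config) :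
    (run w t c).toOuterMeasure X ≤ (run w (t + 1) c).toOuterMeasure X := by
  induction t generalizing c with
  | zero =>
    by_cases hc : c ∈ X
    · have : (run w 1 c).toOuterMeasure X = 1 := by
        rw [PMF.toOuterMeasure_apply_eq_one_iff]
        intro c' h
        simp only [run, PMF.mem_support_bind_iff, PMF.support_pure, Set.mem_singleton_iff] at h
        obtain ⟨a, ha, rfl⟩ := h
        exact hX c hc _ ha
      rw [zero_add, this, run, PMF.toOuterMeasure_pure_apply, if_pos hc]
    · rw [run, PMF.toOuterMeasure_pure_apply, if_neg hc]; exact zero_le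
  | succ t ih => exact PMF.toOuterMeasure_bind_mono _ fun c' _ => ih c'

theorem Absorbing.run_mono {w : ℕ} {X : Set Config} (hX : Absorbing w X) {t t' : ℕ} (h : t ≤ t')
    (c : Config) : (run w t c).toOuterMeasure X ≤ (run w t' c).toOuterMeasure X :=
  monotone_nat_of_le_succ (fun t => hX.run_le_succ t c) h

/-- Started in state `s`, the program `p` terminates within `T` steps, and its final state has the
distribution `ν`. -/
structure Runs (w T : ℕ) (p : Prog) (s : State) (ν : PMF State) : Prop where
  -- Different branches finish at different times. For absorbing events early finishing does no
  -- harm, so a common bound T suffices; the arbitrary continuation `k` makes the specification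
  -- composable.
  lower : ∀ (k : List Prog) (X : Set Config), Absorbing w X → ∀ t,
    (ν.bind fun s' => run w t ⟨k, s'⟩).toOuterMeasure X ≤
      (run w (T + t) ⟨p :: k, s⟩).toOuterMeasure X
  -- A statement about every reachable configuration, needed for the invariant at the loop head:
  -- either `p` is still being executed on top of `k`, or it has ended in a possible final state.
  safe : ∀ (k : List Prog) t, ∀ c ∈ (run w t ⟨p :: k, s⟩).support,
    (∃ l, l ≠ [] ∧ c.control = l ++ k) ∨
      ∃ t' < t, ∃ s' ∈ ν.support, c ∈ (run w t' ⟨k, s'⟩).support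

theorem Runs.mono {w T T' : ℕ} {p : Prog} {s : State} {ν : PMF State} (h : Runs w T p s ν)
    (hT : T ≤ T') : Runs w T' p s ν :=
  ⟨fun k X hX t => (h.lower k X hX t).trans (hX.run_mono (by omega) _), h.safe⟩

theorem Runs.op (w : ℕ) (i : Instr) (s : State) : Runs w 1 (.op i) s (i.exec w s) where
  lower k X _ t := by
    rw [add_comm, run, step, PMF.bind_map]; rfl
  safe k t c hc := by
    cases t with
    | zero =>
      left
      simp only [run, PMF.support_pure, Set.mem_singleton_iff] at hc
      exact ⟨[.op i], by simp, by simp [hc]⟩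
    | succ t =>
      right
      rw [run, step, PMF.bind_map, PMF.mem_support_bind_iff] at hc
      obtain ⟨s', h1, h2⟩ := hc
      exact ⟨t, by omega, s', h1, h2⟩

/-- Common form of sequencing and of entering a loop: one deterministic step puts `p` and then `q`
on the stack. That step is the `+ 1` in the time. -/
theorem Runs.comp {w T T₂ : ℕ} {p q r : Prog} {s s₀ : State} {ν : PMF State}
    {ν₂ : State → PMF State}
    (h₀ : ∀ k, step w ⟨r :: k, s₀⟩ = PMF.pure ⟨p :: q :: k, s⟩)
    (h : Runs w T p s ν) (h₂ : ∀ s' ∈ ν.support, Runs w T₂ q s' (ν₂ s')) :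
    Runs w (T + T₂ + 1) r s₀ (ν.bind ν₂) where
  lower k X hX t := by
    rw [show T + T₂ + 1 + t = (T + (T₂ + t)) + 1 by ring, run, h₀, PMF.pure_bind, PMF.bind_bind]
    refine le_trans ?_ (h.lower (q :: k) X hX (T₂ + t))
    exact PMF.toOuterMeasure_bind_mono _ fun s' hs' => (h₂ s' hs').lower k X hX t
  safe k t c hc := by
    cases t with
    | zero =>
      left
      simp only [run, PMF.support_pure, Set.mem_singleton_iff] at hc
      exact ⟨[r], by simp, by simp [hc]⟩
    | succ t =>
      rw [run, h₀, PMF.pure_bind] at hc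
      rcases h.safe _ _ _ hc with ⟨l, hl, hc⟩ | ⟨t', ht', s', hs', hc⟩
      · exact Or.inl ⟨l ++ [q], by simp, by simp [hc]⟩
      · rcases (h₂ s' hs').safe _ _ _ hc with h3 | ⟨t'', ht'', s'', hs'', hc⟩
        · exact Or.inl h3
        · refine Or.inr ⟨t'', by omega, s'', ?_, hc⟩
          rw [PMF.mem_support_bind_iff]
          exact ⟨s', hs', hs''⟩

theorem Runs.seq {w T T₂ : ℕ} {p q : Prog} {s : State} {ν : PMF State} {ν₂ : State → PMF State}
    (h : Runs w T p s ν) (h₂ : ∀ s' ∈ ν.support, Runs w T₂ q s' (ν₂ s')) :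
    Runs w (T + T₂ + 1) (.seq p q) s (ν.bind ν₂) :=
  Runs.comp (fun _ => rfl) h h₂

theorem Runs.loop_iter {w T T₂ a b : ℕ} {p : Prog} {s : State} {ν : PMF State}
    {ν₂ : State → PMF State} (hab : s.reg a < s.reg b)
    (h : Runs w T p s ν) (h₂ : ∀ s' ∈ ν.support, Runs w T₂ (.loop a b p) s' (ν₂ s')) :
    Runs w (T + T₂ + 1) (.loop a b p) s (ν.bind ν₂) :=
  Runs.comp (fun k => by rw [step, if_pos hab]) h h₂

theorem Runs.ite_aux {w T : ℕ} {p r : Prog} {s : State} {ν : PMF State}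
    (h₀ : ∀ k, step w ⟨r :: k, s⟩ = PMF.pure ⟨p :: k, s⟩) (h : Runs w T p s ν) :
    Runs w (T + 1) r s ν where
  lower k X hX t := by
    rw [show T + 1 + t = (T + t) + 1 by ring, run, h₀, PMF.pure_bind]
    exact h.lower k X hX t
  safe k t c hc := by
    cases t with
    | zero =>
      left
      simp only [run, PMF.support_pure, Set.mem_singleton_iff] at hc
      exact ⟨[r], by simp, by simp [hc]⟩
    | succ t =>
      rw [run, h₀, PMF.pure_bind] at hc
      rcases h.safe _ _ _ hc with h3 | ⟨t', ht', h3⟩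
      · exact Or.inl h3
      · exact Or.inr ⟨t', by omega, h3⟩

theorem Runs.ite {w T a b : ℕ} {p q : Prog} {s : State} {ν : PMF State}
    (h : Runs w T (if s.reg a < s.reg b then p else q) s ν) :
    Runs w (T + 1) (.ite a b p q) s ν :=
  Runs.ite_aux (fun k => by rw [step]; split_ifs <;> rfl) h

theorem Runs.loop_exit {w a b : ℕ} {p : Prog} {s : State} (hab : ¬ s.reg a < s.reg b) :
    Runs w 1 (.loop a b p) s (PMF.pure s) where
  lower k X hX t := by
    rw [add_comm 1 t, run, step, if_neg hab, PMF.pure_bind, PMF.pure_bind]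
  safe k t c hc := by
    cases t with
    | zero =>
      left
      simp only [run, PMF.support_pure, Set.mem_singleton_iff] at hc
      exact ⟨[.loop a b p], by simp, by simp [hc]⟩
    | succ t =>
      rw [run, step, if_neg hab, PMF.pure_bind] at hc
      exact Or.inr ⟨t, by omega, s, by simp, hc⟩

theorem Runs.seq_pure {w T T₂ : ℕ} {p q : Prog} {s s' : State} {ν : PMF State}
    (h : Runs w T p s (PMF.pure s')) (h₂ : Runs w T₂ q s' ν) :
    Runs w (T + T₂ + 1) (.seq p q) s ν := by
  have := Runs.seq (ν₂ := fun _ => ν) h (T₂ := T₂) (q := q) (by simpa using h₂)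
  rwa [PMF.pure_bind] at this

/-- A loop whose number of iterations is known. -/
theorem Runs.loop_count {w T a b : ℕ} {p : Prog} {N : ℕ} (I : ℕ → State → Prop)
    (hstep : ∀ i < N, ∀ s, I i s →
      s.reg a < s.reg b ∧ ∃ s', I (i + 1) s' ∧ Runs w T p s (PMF.pure s'))
    (hexit : ∀ s, I N s → ¬ s.reg a < s.reg b) {s : State} (hs : I 0 s) :
    ∃ s', I N s' ∧ Runs w (N * (T + 1) + 1) (.loop a b p) s (PMF.pure s') := by
  suffices H : ∀ m i, i + m = N → ∀ s, I i s →
      ∃ s', I N s' ∧ Runs w (m * (T + 1) + 1) (.loop a b p) s (PMF.pure s') from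
    H N 0 (by omega) s hs
  intro m
  induction m with
  | zero =>
    intro i hi s hs
    obtain rfl : i = N := by omega
    exact ⟨s, hs, (Runs.loop_exit (hexit s hs)).mono (by omega)⟩
  | succ m ih =>
    intro i hi s hs
    obtain ⟨hab, s₁, hs₁, h₁⟩ := hstep i (by omega) s hs
    obtain ⟨s₂, hs₂, h₂⟩ := ih (i + 1) (by omega) s₁ hs₁
    refine ⟨s₂, hs₂, ?_⟩
    have := Runs.loop_iter (ν₂ := fun _ => PMF.pure s₂) hab h₁ (by simpa using h₂)
    rw [PMF.pure_bind] at this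
    exact this.mono (le_of_eq (by ring))

/-- In the definition of `Instr.exec` the coercion to `ℕ` is applied to the distribution, as a
monadic bind, and not to the number drawn. This form has the coercion inside the map. -/
theorem Instr.exec_rand (w : ℕ) (s : State) (d a : ℕ) :
    Instr.exec w s (.rand d a) =
      (PMF.uniformOfFintype (Fin (s.reg a + 1))).map fun i : Fin _ => s.setReg w d (i : ℕ) := by
  change PMF.map _ ((PMF.uniformOfFintype (Fin (s.reg a + 1))).bind fun i => PMF.pure (i : ℕ)) = _
  rw [PMF.map_bind]
  simp only [PMF.pure_map]
  rfl

/-- Drawing a random number in front of a program. -/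
theorem Runs.rand_seq {w T d a r : ℕ} {q : Prog} {s : State} (hr : s.reg a = r)
    -- The final distribution is indexed by the number drawn instead of the intermediate state, so
    -- later choices are functions of the draw.
    {ν : Fin (r + 1) → PMF State} (h : ∀ i : Fin (r + 1), Runs w T q (s.setReg w d i) (ν i)) :
    Runs w (T + 2) (.seq (.op (.rand d a)) q) s
      ((PMF.uniformOfFintype (Fin (r + 1))).bind ν) where
  lower k X hX t := by
    subst hr
    rw [show T + 2 + t = (T + t) + 1 + 1 by ring, run, step, PMF.pure_bind, run, step, Instr.exec_rand,
      PMF.map_comp, PMF.bind_map, PMF.bind_bind]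
    exact PMF.toOuterMeasure_bind_mono _ fun i _ => (h i).lower k X hX t
  safe k t c hc := by
    subst hr
    match t with
    | 0 =>
      left
      simp only [run, PMF.support_pure, Set.mem_singleton_iff] at hc
      exact ⟨[_], by simp, by simp [hc]; rfl⟩
    | 1 =>
      left
      simp only [run, step, PMF.pure_bind, PMF.support_pure, Set.mem_singleton_iff] at hc
      exact ⟨[_, _], by simp, by simp [hc]; exact ⟨rfl, rfl⟩⟩
    | t + 2 =>
      rw [run, step, PMF.pure_bind, run, step, Instr.exec_rand, PMF.map_comp, PMF.bind_map,
        PMF.mem_support_bind_iff] at hc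
      obtain ⟨i, hi, hc⟩ := hc
      rcases (h i).safe _ _ _ hc with h3 | ⟨t', ht', s', hs', hc⟩
      · exact Or.inl h3
      · refine Or.inr ⟨t', by omega, s', ?_, hc⟩
        rw [PMF.mem_support_bind_iff]
        exact ⟨i, hi, hs'⟩

/-! ## Deterministic programs without loops -/

/-- Effect of an instruction other than `rand`. -/
def Instr.eval (w : ℕ) (s : State) : Instr → State
  | .const d k => s.setReg w d k
  | .add d a b => s.setReg w d (s.reg a + s.reg b)
  | .sub d a b => s.setReg w d (s.reg a - s.reg b)
  | .mul d a b => s.setReg w d (s.reg a * s.reg b)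
  | .load d a => s.setReg w d (s.mem (s.reg a))
  | .store a b => { s with mem := Function.update s.mem (s.reg a) (s.reg b) }
  | .rand _ _ => s

/-- The program has neither loops nor random choices. -/
def Prog.Simple : Prog → Prop
  | .op (.rand _ _) => False
  | .op _ => True
  | .seq p q => p.Simple ∧ q.Simple
  | .ite _ _ p q => p.Simple ∧ q.Simple
  | .loop _ _ _ => False

/-- Effect of a simple program. -/
def Prog.eval (w : ℕ) : Prog → State → State
  | .op i, s => i.eval w s
  | .seq p q, s => q.eval w (p.eval w s)
  | .ite a b p q, s => if s.reg a < s.reg b then p.eval w s else q.eval w s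
  | .loop _ _ _, s => s

/-- A bound for the running time of a simple program. -/
def Prog.cost : Prog → ℕ
  | .op _ => 1
  | .seq p q => p.cost + q.cost + 1
  | .ite _ _ p q => p.cost + q.cost + 1
  | .loop _ _ _ => 1

/-- Loop-free deterministic code is thereby verified by letting `simp` compute `Prog.eval`. -/
theorem Prog.Simple.runs {w : ℕ} {p : Prog} (hp : p.Simple) (s : State) :
    Runs w p.cost p s (PMF.pure (p.eval w s)) := by
  induction p generalizing s with
  | op i =>
    cases i <;> first | exact hp.elim | exact Runs.op w _ s
  | seq p q ihp ihq => exact (ihp hp.1 s).seq_pure (ihq hp.2 _)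
  | ite a b p q ihp ihq =>
    refine (Runs.ite (T := p.cost + q.cost) ?_)
    rw [Prog.eval]
    split_ifs
    · exact (ihp hp.1 s).mono (by omega)
    · exact (ihq hp.2 s).mono (by omega)
  | loop a b p _ => exact hp.elim

/-! ## Random local search that addresses the greatest flaw -/

theorem sum_powerset_pow {Φ : Type*} (μ : ℝ≥0∞) (s : Finset Φ) :
    ∑ S ∈ s.powerset, μ ^ S.card = (1 + μ) ^ s.card := by
  have := Finset.sum_pow_mul_eq_add_pow μ 1 s
  simpa [add_comm] using this

section LocalSearch

variable {Ω Φ : Type*} [DecidableEq Φ] (U : Ω → Finset Φ) (act : Φ → Ω → Finset Ω)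
  (Γ : Φ → Finset Φ) (top : Ω → Φ) (α : ℝ≥0∞)

/-- Probability that the walk from `M` is still going on after `m` rounds, when `α` is the
probability of each of the possible results of a round. -/
noncomputable def survival : ℕ → Ω → ℝ≥0∞
  | 0, _ => 1
  | m + 1, M => if (U M).Nonempty then α * ∑ M' ∈ act (top M) M, survival m M' else 0

/-- The part of `survival` in which the flaws of `M` that are addressed before they disappear for
another reason are those of `E`. -/
noncomputable def survivalOn : ℕ → Ω → Finset Φ → ℝ≥0∞
  | 0, _, E => if E = ∅ then 1 else 0
  | m + 1, M, E => if top M ∈ E ∧ E ⊆ U M then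
      α * ∑ M' ∈ act (top M) M, ∑ S ∈ (Γ (top M) \ E.erase (top M)).powerset,
        survivalOn m M' (E.erase (top M) ∪ S) else 0

variable {U act Γ top α}

/-- Every possible future of M has some set E of flaws to be addressed. A set E' chosen for M'
splits into flaws that M already had, other than f, and further ones; by locality the latter lie in
Γ f. -/
theorem survival_le_sum_survivalOn (htop : ∀ M, (U M).Nonempty → top M ∈ U M)
    (hΓ : ∀ M, ∀ f ∈ U M, ∀ M' ∈ act f M, U M' ⊆ (U M).erase f ∪ Γ f) (m : ℕ) (M : Ω) :
    survival U act top α m M ≤ ∑ E ∈ (U M).powerset, survivalOn U act Γ top α m M E := by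
  induction m generalizing M with
  | zero =>
    simp only [survival, survivalOn]
    rw [Finset.sum_ite_eq' (U M).powerset ∅ (fun _ => (1 : ℝ≥0∞))]
    simp
  | succ m ih =>
    rw [survival]
    split_ifs with hM
    swap
    · exact zero_le
    have hf := htop M hM
    set f := top M with hfdef
    have key : ∀ M' ∈ act f M, survival U act top α m M' ≤
        ∑ x ∈ ((U M).powerset.filter (f ∈ ·)).sigma
          (fun E => (Γ f \ E.erase f).powerset),
          survivalOn U act Γ top α m M' (x.1.erase f ∪ x.2) := by
      intro M' hM'
      refine (ih M').trans ?_
      -- Recovers E and S from E' = E.erase f ∪ S. The map has a left inverse, so no term is used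
      -- twice; it need not be onto, as only an inequality is claimed.
      let φ : Finset Φ → (Σ _ : Finset Φ, Finset Φ) := fun E' =>
        ⟨insert f (E' ∩ (U M).erase f), E' \ (U M).erase f⟩
      have hφ : ∀ E', (φ E').1.erase f ∪ (φ E').2 = E' := by
        intro E'
        ext g
        simp only [φ, Finset.mem_union, Finset.mem_erase, Finset.mem_insert, Finset.mem_inter,
          Finset.mem_sdiff]
        tauto
      have hinj : Function.Injective φ := fun a b h => by rw [← hφ a, ← hφ b, h]
      calc ∑ E' ∈ (U M').powerset, survivalOn U act Γ top α m M' E'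
          = ∑ x ∈ (U M').powerset.image φ,
              survivalOn U act Γ top α m M' (x.1.erase f ∪ x.2) := by
            rw [Finset.sum_image hinj.injOn]
            exact Finset.sum_congr rfl fun E' _ => by rw [hφ]
        _ ≤ _ := by
            refine Finset.sum_le_sum_of_subset ?_
            intro x hx
            obtain ⟨E', hE', rfl⟩ := Finset.mem_image.1 hx
            have h1 := hΓ M f hf M' hM'
            rw [Finset.mem_powerset] at hE'
            simp only [φ, Finset.mem_sigma, Finset.mem_filter, Finset.mem_powerset]
            refine ⟨⟨?_, Finset.mem_insert_self _ _⟩, ?_⟩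
            · intro g hg
              rcases Finset.mem_insert.1 hg with rfl | hg
              · exact hf
              · exact Finset.mem_of_mem_erase (Finset.mem_inter.1 hg).2
            · intro g hg
              have h2 := h1 (hE' (Finset.mem_sdiff.1 hg).1)
              have h3 := (Finset.mem_sdiff.1 hg).2
              simp only [Finset.mem_union, Finset.mem_sdiff, Finset.mem_erase, Finset.mem_insert,
                Finset.mem_inter] at h2 h3 ⊢
              tauto
    calc α * ∑ M' ∈ act f M, survival U act top α m M'
        ≤ α * ∑ M' ∈ act f M, ∑ E ∈ (U M).powerset.filter (f ∈ ·),
            ∑ S ∈ (Γ f \ E.erase f).powerset,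
              survivalOn U act Γ top α m M' (E.erase f ∪ S) := by
          gcongr with M' hM'
          exact (key M' hM').trans (le_of_eq (Finset.sum_sigma _ _ _))
      _ = ∑ E ∈ (U M).powerset.filter (f ∈ ·), survivalOn U act Γ top α (m + 1) M E := by
          rw [Finset.sum_comm, Finset.mul_sum]
          refine Finset.sum_congr rfl fun E hE => ?_
          rw [Finset.mem_filter, Finset.mem_powerset] at hE
          rw [survivalOn, if_pos ⟨hE.2, hE.1⟩]
      _ ≤ _ := Finset.sum_le_sum_of_subset (Finset.filter_subset _ _)

variable [Fintype Ω]

/-- The sum over all starting points is what makes reversibility usable: for a fixed E it becomes a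
sum over the results M' of the first round. -/
theorem sum_survivalOn_le {rank : Φ → ℕ} (hrank : Function.Injective rank)
    (hmax : ∀ M, ∀ g ∈ U M, rank g ≤ rank (top M))
    (hatom : ∀ f M₁ M₂ M', f ∈ U M₁ → f ∈ U M₂ → M' ∈ act f M₁ → M' ∈ act f M₂ → M₁ = M₂)
    {μ lam : ℝ≥0∞} (hμ : ∀ f, α * (1 + μ) ^ (Γ f).card ≤ lam * μ) (m : ℕ) (E : Finset Φ) :
    ∑ M, survivalOn U act Γ top α m M E ≤ lam ^ m * Fintype.card Ω * μ ^ E.card := by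
  classical
  induction m generalizing E with
  | zero =>
    by_cases hE : E = ∅ <;> simp [survivalOn, hE]
  | succ m ih =>
    by_cases hex : ∃ M₀, top M₀ ∈ E ∧ E ⊆ U M₀
    swap
    · push Not at hex
      have : ∀ M, survivalOn U act Γ top α (m + 1) M E = 0 := fun M => by
        rw [survivalOn, if_neg (fun h => hex M h.1 h.2)]
      simp [this]
    obtain ⟨M₀, h₀E, h₀U⟩ := hex
    set f := top M₀ with hfdef
    -- Each of the two top flaws lies in E, hence is present in the other state, so their ranks
    -- agree.
    have htop : ∀ M, top M ∈ E ∧ E ⊆ U M → top M = f := fun M h => hrank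
      (le_antisymm (hmax M₀ _ (h₀U h.1)) (hmax M _ (h.2 h₀E)))
    set R := (Γ f \ E.erase f).powerset with hR
    have step1 : ∀ M, survivalOn U act Γ top α (m + 1) M E ≤
        ∑ M', if f ∈ U M ∧ M' ∈ act f M then
          α * ∑ S ∈ R, survivalOn U act Γ top α m M' (E.erase f ∪ S) else 0 := by
      intro M
      rw [survivalOn]
      split_ifs with h
      · have hf : f ∈ U M := h.2 h₀E
        simp only [htop M h, hf, true_and]
        rw [Finset.mul_sum, ← Finset.sum_filter]
        refine le_of_eq (Finset.sum_congr ?_ fun _ _ => rfl)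
        ext; simp
      · exact zero_le
    -- Reversibility: at most one M leads to M' by addressing f.
    have step2 : ∀ M' (x : ℝ≥0∞), (∑ M, if f ∈ U M ∧ M' ∈ act f M then x else 0) ≤ x := by
      intro M' x
      by_cases hM : ∃ M, f ∈ U M ∧ M' ∈ act f M
      · obtain ⟨M, hM⟩ := hM
        rw [Finset.sum_eq_single M]
        · rw [if_pos hM]
        · intro M₂ _ hne
          rw [if_neg]
          exact fun h => hne (hatom f _ _ _ h.1 hM.1 h.2 hM.2)
        · simp
      · push Not at hM
        rw [Finset.sum_eq_zero]
        · exact zero_le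
        · intro M _
          rw [if_neg (fun h => hM M h.1 h.2)]
    have hcard : (E.erase f).card + 1 = E.card := Finset.card_erase_add_one h₀E
    calc ∑ M, survivalOn U act Γ top α (m + 1) M E
        ≤ ∑ M, ∑ M', if f ∈ U M ∧ M' ∈ act f M then
          α * ∑ S ∈ R, survivalOn U act Γ top α m M' (E.erase f ∪ S) else 0 :=
          Finset.sum_le_sum fun M _ => step1 M
      _ ≤ ∑ M', α * ∑ S ∈ R, survivalOn U act Γ top α m M' (E.erase f ∪ S) := by
          rw [Finset.sum_comm]
          exact Finset.sum_le_sum fun M' _ => step2 M' _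
      _ = α * ∑ S ∈ R, ∑ M', survivalOn U act Γ top α m M' (E.erase f ∪ S) := by
          rw [← Finset.mul_sum, Finset.sum_comm]
      _ ≤ α * ∑ S ∈ R, lam ^ m * Fintype.card Ω * (μ ^ (E.erase f).card * μ ^ S.card) := by
          gcongr with S hS
          rw [← pow_add, ← Finset.card_union_of_disjoint]
          · exact ih _
          · rw [hR, Finset.mem_powerset] at hS
            exact (Finset.disjoint_of_subset_left hS Finset.sdiff_disjoint).symm
      _ = lam ^ m * Fintype.card Ω * μ ^ (E.erase f).card *
            (α * (1 + μ) ^ (Γ f \ E.erase f).card) := by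
          rw [← Finset.mul_sum, ← Finset.mul_sum, sum_powerset_pow]; ring
      _ ≤ lam ^ m * Fintype.card Ω * μ ^ (E.erase f).card * (lam * μ) := by
          -- The factor μ of the erased flaw f is regained from the weight condition, so the power
          -- of μ is again |E|.
          refine mul_le_mul_right (le_trans ?_ (hμ f)) _
          gcongr
          · exact le_self_add
          · exact Finset.sdiff_subset
      _ = _ := by rw [← hcard]; ring

/-- The walk that addresses the greatest flaw is short, if every possible result of addressing a
flaw determines where the walk came from. -/
theorem survival_le {rank : Φ → ℕ} (hrank : Function.Injective rank)
    (htop : ∀ M, (U M).Nonempty → top M ∈ U M)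
    (hmax : ∀ M, ∀ g ∈ U M, rank g ≤ rank (top M))
    (hΓ : ∀ M, ∀ f ∈ U M, ∀ M' ∈ act f M, U M' ⊆ (U M).erase f ∪ Γ f)
    (hatom : ∀ f M₁ M₂ M', f ∈ U M₁ → f ∈ U M₂ → M' ∈ act f M₁ → M' ∈ act f M₂ → M₁ = M₂)
    {μ lam : ℝ≥0∞} (hμ : ∀ f, α * (1 + μ) ^ (Γ f).card ≤ lam * μ) (m : ℕ) (M : Ω) :
    survival U act top α m M ≤ lam ^ m * Fintype.card Ω * (1 + μ) ^ (U M).card := by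
  calc survival U act top α m M
      ≤ ∑ E ∈ (U M).powerset, survivalOn U act Γ top α m M E :=
        survival_le_sum_survivalOn htop hΓ m M
    -- The start is arbitrary, so its term is bounded by the sum over all starts; the price is the
    -- factor |Ω|.
    _ ≤ ∑ E ∈ (U M).powerset, ∑ M', survivalOn U act Γ top α m M' E :=
        Finset.sum_le_sum fun E _ => Finset.single_le_sum
          (f := fun M' => survivalOn U act Γ top α m M' E) (fun _ _ => zero_le)
          (Finset.mem_univ M)
    _ ≤ ∑ E ∈ (U M).powerset, lam ^ m * Fintype.card Ω * μ ^ E.card :=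
        Finset.sum_le_sum fun E _ => sum_survivalOn_le hrank hmax hatom hμ m E
    _ = _ := by rw [← Finset.mul_sum, sum_powerset_pow]

end LocalSearch

/-! ## Perfect matchings as involutions -/

/-- The partners after a switch. -/
def switchFun {α : Type*} [DecidableEq α] (p : α → α) (v₁ v₂ v₃ v₄ u₁ u₂ u₃ u₄ x : α) : α :=
  if x = v₁ then u₁ else if x = u₁ then v₁ else if x = v₂ then u₂ else if x = u₂ then v₂ else
  if x = v₃ then u₃ else if x = u₃ then v₃ else if x = v₄ then u₄ else if x = u₄ then v₄ else p x

section Switch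

variable {α : Type*} [DecidableEq α] {p : α → α} {v₁ v₂ v₃ v₄ u₁ u₂ u₃ u₄ : α}

/-- Case distinction for all later facts on `switchFun`. In the last case the partner is untouched
as well, because the eight vertices are closed under `p`. -/
theorem switchFun_cases (hp : ∀ x, p (p x) = x)
    (h₁ : p v₁ = v₂) (h₃ : p v₃ = v₄) (k₁ : p u₁ = u₂) (k₃ : p u₃ = u₄) (x : α) (P : α → α → Prop) (a1 : P v₁ u₁) (a2 : P u₁ v₁) (a3 : P v₂ u₂)
    (a4 : P u₂ v₂) (a5 : P v₃ u₃) (a6 : P u₃ v₃) (a7 : P v₄ u₄) (a8 : P u₄ v₄)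
    (a : x ∉ [v₁, v₂, v₃, v₄, u₁, u₂, u₃, u₄] → p x ∉ [v₁, v₂, v₃, v₄, u₁, u₂, u₃, u₄] → P x (p x)) :
    P x (switchFun p v₁ v₂ v₃ v₄ u₁ u₂ u₃ u₄ x) := by
  unfold switchFun
  split_ifs with b1 b2 b3 b4 b5 b6 b7 b8 <;> first | (subst_vars; assumption) | skip
  refine a (by simp_all) fun hmem => ?_
  have hx := hp x
  have h₂ : p v₂ = v₁ := by rw [← h₁, hp]
  have h₄ : p v₄ = v₃ := by rw [← h₃, hp]
  have k₂ : p u₂ = u₁ := by rw [← k₁, hp]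
  have k₄ : p u₄ = u₃ := by rw [← k₃, hp]
  simp only [List.mem_cons, List.not_mem_nil, or_false] at hmem
  rcases hmem with h | h | h | h | h | h | h | h <;> rw [h] at hx <;> simp_all

theorem switchFun_switchFun (hd : [v₁, v₂, v₃, v₄, u₁, u₂, u₃, u₄].Nodup)
    (hp : ∀ x, p (p x) = x)
    (h₁ : p v₁ = v₂) (h₃ : p v₃ = v₄) (k₁ : p u₁ = u₂) (k₃ : p u₃ = u₄) (x : α) :
    switchFun p v₁ v₂ v₃ v₄ u₁ u₂ u₃ u₄ (switchFun p v₁ v₂ v₃ v₄ u₁ u₂ u₃ u₄ x) = x := by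
  refine switchFun_cases hp h₁ h₃ k₁ k₃ x
    (fun x y => switchFun p v₁ v₂ v₃ v₄ u₁ u₂ u₃ u₄ y = x) ?_ ?_ ?_ ?_ ?_ ?_ ?_ ?_ ?_
  all_goals (simp only [List.nodup_cons, List.mem_cons, List.not_mem_nil] at hd; grind [switchFun])

theorem switchFun_ne (hd : [v₁, v₂, v₃, v₄, u₁, u₂, u₃, u₄].Nodup)
    (hp : ∀ x, p (p x) = x) (hne : ∀ x, p x ≠ x)
    (h₁ : p v₁ = v₂) (h₃ : p v₃ = v₄) (k₁ : p u₁ = u₂) (k₃ : p u₃ = u₄) (x : α) :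
    switchFun p v₁ v₂ v₃ v₄ u₁ u₂ u₃ u₄ x ≠ x := by
  refine switchFun_cases hp h₁ h₃ k₁ k₃ x (fun x y => y ≠ x) ?_ ?_ ?_ ?_ ?_ ?_ ?_ ?_ ?_
  all_goals (simp only [List.nodup_cons, List.mem_cons, List.not_mem_nil] at hd; grind)

/-- Translates the partner function after a switch into the description by deleted and added edges
in `Flaw.actions`. -/
theorem switchFun_eq_iff (hd : [v₁, v₂, v₃, v₄, u₁, u₂, u₃, u₄].Nodup)
    (hp : ∀ x, p (p x) = x)
    (h₁ : p v₁ = v₂) (h₃ : p v₃ = v₄) (k₁ : p u₁ = u₂) (k₃ : p u₃ = u₄) (x y : α) :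
    switchFun p v₁ v₂ v₃ v₄ u₁ u₂ u₃ u₄ x = y ↔
      (p x = y ∧ s(x, y) ∉ ({s(v₁, v₂), s(u₁, u₂), s(v₃, v₄), s(u₃, u₄)} : Set (Sym2 α))) ∨
        s(x, y) ∈ ({s(v₁, u₁), s(v₂, u₂), s(v₃, u₃), s(v₄, u₄)} : Set (Sym2 α)) := by
  have h₂ : p v₂ = v₁ := by rw [← h₁, hp]
  have h₄ : p v₄ = v₃ := by rw [← h₃, hp]
  have k₂ : p u₂ = u₁ := by rw [← k₁, hp]
  have k₄ : p u₄ = u₃ := by rw [← k₃, hp]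
  simp only [List.nodup_cons, List.mem_cons, List.not_mem_nil, not_or, or_false] at hd
  simp only [Set.mem_insert_iff, Set.mem_singleton_iff, Sym2.eq_iff]
  refine switchFun_cases hp h₁ h₃ k₁ k₃ x (fun x z => z = y ↔
      (p x = y ∧ ¬((x = v₁ ∧ y = v₂ ∨ x = v₂ ∧ y = v₁) ∨ (x = u₁ ∧ y = u₂ ∨ x = u₂ ∧ y = u₁) ∨
        (x = v₃ ∧ y = v₄ ∨ x = v₄ ∧ y = v₃) ∨ (x = u₃ ∧ y = u₄ ∨ x = u₄ ∧ y = u₃))) ∨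
      ((x = v₁ ∧ y = u₁ ∨ x = u₁ ∧ y = v₁) ∨ (x = v₂ ∧ y = u₂ ∨ x = u₂ ∧ y = v₂) ∨
        (x = v₃ ∧ y = u₃ ∨ x = u₃ ∧ y = v₃) ∨ (x = v₄ ∧ y = u₄ ∨ x = u₄ ∧ y = v₄))) ?_ ?_ ?_ ?_ ?_ ?_ ?_ ?_ ?_
  any_goals (simp only [h₁, h₂, h₃, h₄, k₁, k₂, k₃, k₄]; grind (splits := 20))
  intro h _
  simp only [List.mem_cons, List.not_mem_nil, not_or] at h
  grind

end Switch

section Matchings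

variable {n : ℕ}

theorem existsUnique_adj (M : PM n) (v : Fin (2 * n)) : ∃! w, M.1.Adj v w :=
  SimpleGraph.Subgraph.isPerfectMatching_iff.1 M.2 v

/-- The partner of a vertex in a perfect matching. -/
noncomputable def partner (M : PM n) (v : Fin (2 * n)) : Fin (2 * n) :=
  (existsUnique_adj M v).choose

theorem adj_partner (M : PM n) (v : Fin (2 * n)) : M.1.Adj v (partner M v) :=
  (existsUnique_adj M v).choose_spec.1

theorem adj_iff (M : PM n) (u v : Fin (2 * n)) : M.1.Adj u v ↔ partner M u = v :=
  ⟨fun h => ((existsUnique_adj M u).choose_spec.2 v h).symm, fun h => h ▸ adj_partner M u⟩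

theorem partner_partner (M : PM n) (v : Fin (2 * n)) : partner M (partner M v) = v :=
  (adj_iff M _ _).1 (adj_partner M v).symm

theorem partner_ne (M : PM n) (v : Fin (2 * n)) : partner M v ≠ v :=
  (adj_partner M v).ne.symm

theorem PM.ext_edgeSet {M M' : PM n} (h : M.1.edgeSet = M'.1.edgeSet) : M = M' :=
  Subtype.ext (SimpleGraph.Subgraph.IsMatching.injOn_edgeSet M.2.1 M'.2.1 h)

theorem mem_edgeSet_iff (M : PM n) (u v : Fin (2 * n)) :
    s(u, v) ∈ M.1.edgeSet ↔ partner M u = v := by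
  rw [SimpleGraph.Subgraph.mem_edgeSet, adj_iff]

theorem partner_injective : Function.Injective (partner : PM n → Fin (2 * n) → Fin (2 * n)) := by
  intro M M' h
  refine PM.ext_edgeSet ?_
  ext e
  induction e using Sym2.inductionOn with
  | _ u v => rw [mem_edgeSet_iff, mem_edgeSet_iff, h]

/-- The perfect matching given by an involution without fixed points. -/
def ofInvolution (p : Fin (2 * n) → Fin (2 * n)) (hp : ∀ x, p (p x) = x) (hne : ∀ x, p x ≠ x) :
    PM n :=
  ⟨{ verts := Set.univ
     Adj := fun u v => p u = v
     adj_sub := by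
      rintro u v rfl
      exact (hne u).symm
     edge_vert := fun _ => Set.mem_univ _
     symm := ⟨by
      rintro u v rfl
      exact hp u⟩ },
    SimpleGraph.Subgraph.isPerfectMatching_iff.2 fun v => ⟨p v, rfl, fun _ h => Eq.symm h⟩⟩

theorem partner_ofInvolution (p : Fin (2 * n) → Fin (2 * n)) (hp hne) (x : Fin (2 * n)) :
    partner (ofInvolution p hp hne) x = p x :=
  (adj_iff (ofInvolution p hp hne) x (p x)).1 rfl

noncomputable instance : Fintype (PM n) := Fintype.ofInjective _ partner_injective

theorem card_PM_le : Fintype.card (PM n) ≤ (2 * n) ^ (2 * n) := by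
  refine (Fintype.card_le_of_injective _ partner_injective).trans ?_
  simp

/-! ## Colours and flaws -/

/-- The colour of a pair of vertices, `0` on the diagonal. -/
def clr (col : Coloring n) (x y : Fin (2 * n)) : ℕ :=
  if h : x ≠ y then col.get x y h else 0

theorem clr_eq (col : Coloring n) {x y : Fin (2 * n)} (h : x ≠ y) : clr col x y = col.get x y h :=
  dif_pos h

theorem clr_comm (col : Coloring n) (x y : Fin (2 * n)) : clr col x y = clr col y x := by
  unfold clr
  by_cases h : x = y
  · simp [h]
  · rw [dif_pos h, dif_pos (Ne.symm h)]
    exact SimpleGraph.EdgeLabeling.get_comm _ _ _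

variable {col : Coloring n}

theorem Flaw.clr_same (f : Flaw col) : clr col f.v₁ f.v₂ = clr col f.v₃ f.v₄ := by
  rw [clr_eq _ f.lt₂₁.ne', clr_eq _ f.lt₄₃.ne', f.same]

theorem Flaw.ext {f g : Flaw col} (h₁ : f.v₁ = g.v₁) (h₂ : f.v₂ = g.v₂) (h₃ : f.v₃ = g.v₃)
    (h₄ : f.v₄ = g.v₄) : f = g := by
  cases f; cases g
  simp_all

noncomputable instance : Fintype (Flaw col) :=
  Fintype.ofInjective (fun f => (f.v₁, f.v₂, f.v₃, f.v₄)) fun f g h => by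
    simp only [Prod.mk.injEq] at h
    exact Flaw.ext h.1 h.2.1 h.2.2.1 h.2.2.2

noncomputable instance : DecidableEq (Flaw col) := Classical.decEq _

theorem Flaw.present_iff (f : Flaw col) (M : PM n) :
    f.Present M ↔ partner M f.v₁ = f.v₂ ∧ partner M f.v₃ = f.v₄ := by
  rw [Flaw.Present, adj_iff, adj_iff]

theorem Flaw.Present.partner_eq {f : Flaw col} {M : PM n} (h : f.Present M) :
    partner M f.v₁ = f.v₂ ∧ partner M f.v₂ = f.v₁ ∧ partner M f.v₃ = f.v₄ ∧
      partner M f.v₄ = f.v₃ := by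
  rw [Flaw.present_iff] at h
  exact ⟨h.1, by rw [← h.1, partner_partner], h.2, by rw [← h.2, partner_partner]⟩

/-- In the normal form a flaw of M is given by the larger endpoints of its two edges; this is how
the program finds it. -/
theorem exists_flaw_of {M : PM n} {a b : Fin (2 * n)} (ha : partner M a < a)
    (hb : partner M b < b) (hba : b < a)
    (hc : clr col a (partner M a) = clr col b (partner M b)) :
    ∃ f : Flaw col, f.Present M ∧ f.v₁ = a ∧ f.v₃ = b := by
  refine ⟨⟨a, partner M a, b, partner M b, ha, hb, hba, ?_, ?_, ?_⟩,
    (Flaw.present_iff _ _).2 ⟨rfl, rfl⟩, rfl, rfl⟩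
  · intro h1
    rw [← h1, partner_partner] at hb
    exact absurd hb (not_lt_of_gt ha)
  · intro h1
    have := congrArg (partner M) h1
    rw [partner_partner, partner_partner] at this
    exact hba.ne' this
  · rw [← clr_eq, ← clr_eq, hc]

theorem rainbow_iff (M : PM n) : Rainbow col M ↔ ∀ f : Flaw col, ¬ f.Present M := by
  constructor
  · intro h f hf
    have hf' := (f.present_iff M).1 hf
    have : s(f.v₁, f.v₂) = s(f.v₃, f.v₄) := congrArg Subtype.val
      (@h ⟨s(f.v₁, f.v₂), f.lt₂₁.ne'⟩ ((mem_edgeSet_iff _ _ _).2 hf'.1)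
        ⟨s(f.v₃, f.v₄), f.lt₄₃.ne'⟩ ((mem_edgeSet_iff _ _ _).2 hf'.2) f.same)
    rw [Sym2.eq_iff] at this
    have h1 := f.lt₃₁
    have h2 := f.lt₄₃
    rcases this with h | h
    · exact h1.ne' h.1
    · exact (h2.trans h1).ne' h.1
  · intro h
    have key : ∀ a b, partner M a < a → partner M b < b → b < a →
        clr col a (partner M a) ≠ clr col b (partner M b) := by
      intro a b ha hb hba hc
      obtain ⟨f, hf, -⟩ := exists_flaw_of ha hb hba hc
      exact h f hf
    -- Every edge is named by its larger endpoint; comparing two such endpoints gives the normal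
    -- form of a flaw.
    have norm : ∀ e ∈ M.1.edgeSet, ∃ a, partner M a < a ∧ e = s(a, partner M a) := by
      intro e he
      induction e using Sym2.inductionOn with
      | _ u v =>
        rw [mem_edgeSet_iff] at he
        rcases lt_or_gt_of_ne (partner_ne M u) with h1 | h1
        · exact ⟨u, h1, by rw [he]⟩
        · refine ⟨partner M u, by rwa [partner_partner], ?_⟩
          rw [partner_partner, he, Sym2.eq_swap]
    rintro ⟨e, he⟩ heM ⟨e', he'⟩ heM' hc
    obtain ⟨a, ha, rfl⟩ := norm e heM
    obtain ⟨b, hb, rfl⟩ := norm e' heM'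
    have hc' : clr col a (partner M a) = clr col b (partner M b) := by
      rw [clr_eq _ ha.ne', clr_eq _ hb.ne']; exact hc
    rcases lt_trichotomy a b with h1 | rfl | h1
    · exact absurd hc'.symm (key _ _ hb ha h1)
    · rfl
    · exact absurd hc' (key _ _ ha hb h1)

/-- A linear ordering of the flaws in which `(v₁, v₃)` is most significant. -/
def Flaw.rank (f : Flaw col) : ℕ :=
  (f.v₁ * (2 * n) + f.v₃) * (2 * n * (2 * n)) + (f.v₂ * (2 * n) + f.v₄)

theorem add_mul_eq_iff {N a b c d : ℕ} (hb : b < N) (hd : d < N) :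
    a * N + b = c * N + d ↔ a = c ∧ b = d := by
  constructor
  · intro h
    have hN : 0 < N := by omega
    have h1 := congrArg (· / N) h
    simp only [mul_comm _ N, Nat.mul_add_div hN, Nat.div_eq_of_lt hb, Nat.div_eq_of_lt hd] at h1
    have : a = c := by simpa using h1
    subst this
    exact ⟨rfl, by omega⟩
  · rintro ⟨rfl, rfl⟩; rfl

theorem Flaw.low_lt (f : Flaw col) : (f.v₂ : ℕ) * (2 * n) + f.v₄ < 2 * n * (2 * n) := by
  have h2 := f.v₂.2
  have h4 := f.v₄.2
  nlinarith

theorem Flaw.rank_injective : Function.Injective (Flaw.rank : Flaw col → ℕ) := by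
  intro f g h
  rw [Flaw.rank, Flaw.rank, add_mul_eq_iff f.low_lt g.low_lt, add_mul_eq_iff f.v₃.2 g.v₃.2,
    add_mul_eq_iff f.v₄.2 g.v₄.2] at h
  exact Flaw.ext (Fin.ext h.1.1) (Fin.ext h.2.1) (Fin.ext h.1.2) (Fin.ext h.2.2)

/-- The program compares only (v₁, v₃). This is enough, as in a given matching these two vertices
determine v₂ and v₄. -/
theorem Flaw.key_le_of_rank_le {f g : Flaw col} (h : g.rank ≤ f.rank) :
    (g.v₁ : ℕ) * (2 * n) + g.v₃ ≤ f.v₁ * (2 * n) + f.v₃ := by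
  by_contra hlt
  push Not at hlt
  have := f.low_lt
  unfold Flaw.rank at h
  nlinarith

/-! ## Switches -/

/-- The vertex is not one of the four vertices of the flaw. -/
def Flaw.Off (f : Flaw col) (x : Fin (2 * n)) : Prop :=
  x ≠ f.v₁ ∧ x ≠ f.v₂ ∧ x ≠ f.v₃ ∧ x ≠ f.v₄

theorem Flaw.mem_actions_iff {f : Flaw col} {M M' : PM n} :
    M' ∈ f.actions M ↔ ∃ u₁ u₃, f.Off u₁ ∧ f.Off u₃ ∧ u₃ ≠ u₁ ∧ u₃ ≠ partner M u₁ ∧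
      M'.1.edgeSet = (M.1.edgeSet \ {s(f.v₁, f.v₂), s(u₁, partner M u₁), s(f.v₃, f.v₄),
        s(u₃, partner M u₃)}) ∪
        {s(f.v₁, u₁), s(f.v₂, partner M u₁), s(f.v₃, u₃), s(f.v₄, partner M u₃)} := by
  simp only [Flaw.actions, Set.mem_ofPred_eq, adj_iff, Flaw.Off, Set.mem_insert_iff,
    Set.mem_singleton_iff, not_or]
  constructor
  · rintro ⟨u₁, u₂, u₃, u₄, ⟨h1, h2, h3, h4⟩, rfl, ⟨k1, k2, k3, k4, k5, k6⟩, rfl, h⟩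
    exact ⟨u₁, u₃, ⟨h1, h2, h3, h4⟩, ⟨k1, k2, k3, k4⟩, k5, k6, h⟩
  · rintro ⟨u₁, u₃, ⟨h1, h2, h3, h4⟩, ⟨k1, k2, k3, k4⟩, k5, k6, h⟩
    exact ⟨u₁, _, u₃, _, ⟨h1, h2, h3, h4⟩, rfl, ⟨k1, k2, k3, k4, k5, k6⟩, rfl, h⟩

theorem Flaw.nodup {f : Flaw col} {M : PM n} (hf : f.Present M) {u₁ u₃ : Fin (2 * n)}
    (h₁ : f.Off u₁) (h₃ : f.Off u₃) (h₃₁ : u₃ ≠ u₁) (h₃₂ : u₃ ≠ partner M u₁) :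
    [f.v₁, f.v₂, f.v₃, f.v₄, u₁, partner M u₁, u₃, partner M u₃].Nodup := by
  obtain ⟨p1, p2, p3, p4⟩ := hf.partner_eq
  have q1 := f.lt₂₁.ne
  have q2 := f.lt₄₃.ne
  have q3 := f.lt₃₁.ne
  have q4 := f.ne₂₃
  have q5 := f.ne₂₄
  have q6 := (f.lt₄₃.trans f.lt₃₁).ne
  obtain ⟨a1, a2, a3, a4⟩ := h₁
  obtain ⟨b1, b2, b3, b4⟩ := h₃
  have c1 := partner_partner M u₁
  have c3 := partner_partner M u₃
  have d1 := partner_ne M u₁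
  have d3 := partner_ne M u₃
  simp only [List.nodup_cons, List.mem_cons, List.not_mem_nil, not_or, or_false]
  grind

theorem Flaw.exists_switch {f : Flaw col} {M : PM n} (hf : f.Present M) {u₁ u₃ : Fin (2 * n)}
    (h₁ : f.Off u₁) (h₃ : f.Off u₃) (h₃₁ : u₃ ≠ u₁) (h₃₂ : u₃ ≠ partner M u₁) :
    ∃ M' ∈ f.actions M, partner M' = switchFun (partner M) f.v₁ f.v₂ f.v₃ f.v₄
      u₁ (partner M u₁) u₃ (partner M u₃) := by
  have hd := Flaw.nodup hf h₁ h₃ h₃₁ h₃₂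
  have hp := partner_partner M
  have p1 := hf.partner_eq.1
  have p3 := hf.partner_eq.2.2.1
  refine ⟨ofInvolution _ (switchFun_switchFun hd hp p1 p3 rfl rfl)
    (switchFun_ne hd hp (partner_ne M) p1 p3 rfl rfl), ?_,
    funext fun x => partner_ofInvolution _ _ _ _⟩
  rw [Flaw.mem_actions_iff]
  refine ⟨u₁, u₃, h₁, h₃, h₃₁, h₃₂, ?_⟩
  ext e
  induction e using Sym2.inductionOn with
  | _ x y =>
    rw [mem_edgeSet_iff, partner_ofInvolution, switchFun_eq_iff hd hp p1 p3 rfl rfl, Set.mem_union,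
      Set.mem_sdiff, mem_edgeSet_iff]

end Matchings

/-! ### Reversing a switch, and counting flaws that share a vertex -/

section Matchings

variable {n : ℕ} {col : Coloring n}

/-- `M'` arises from `M` by addressing `f` with the choices `u₁`, `u₃`. -/
def Flaw.SwitchesTo (f : Flaw col) (M : PM n) (u₁ u₃ : Fin (2 * n)) (M' : PM n) : Prop :=
  M'.1.edgeSet = (M.1.edgeSet \ {s(f.v₁, f.v₂), s(u₁, partner M u₁), s(f.v₃, f.v₄),
      s(u₃, partner M u₃)}) ∪
    {s(f.v₁, u₁), s(f.v₂, partner M u₁), s(f.v₃, u₃), s(f.v₄, partner M u₃)}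

/-- The new edges are the four edges at the vertices of f, so M' reveals the choices. Both
reversibility and the exact number of actions rest on this. -/
theorem Flaw.SwitchesTo.partner_eq {f : Flaw col} {M M' : PM n} {u₁ u₃ : Fin (2 * n)}
    (h : f.SwitchesTo M u₁ u₃ M') : partner M' f.v₁ = u₁ ∧ partner M' f.v₂ = partner M u₁ ∧
      partner M' f.v₃ = u₃ ∧ partner M' f.v₄ = partner M u₃ := by
  unfold Flaw.SwitchesTo at h
  simp only [← mem_edgeSet_iff, h]
  simp

theorem Flaw.SwitchesTo.unique {f : Flaw col} {M M' M'' : PM n} {u₁ u₃ : Fin (2 * n)}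
    (h : f.SwitchesTo M u₁ u₃ M') (h' : f.SwitchesTo M u₁ u₃ M'') : M' = M'' :=
  PM.ext_edgeSet (h.trans h'.symm)

/-- The inverse switch. It exists because all deleted edges were in M and no added edge was: the
partners of the vertices of f in M lie in f, the chosen vertices do not. -/
theorem Flaw.SwitchesTo.edgeSet_eq {f : Flaw col} {M M' : PM n} (hf : f.Present M)
    {u₁ u₃ : Fin (2 * n)} (h₁ : f.Off u₁) (h₃ : f.Off u₃) (h : f.SwitchesTo M u₁ u₃ M') :
    M.1.edgeSet = (M'.1.edgeSet \
        {s(f.v₁, u₁), s(f.v₂, partner M u₁), s(f.v₃, u₃), s(f.v₄, partner M u₃)}) ∪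
      {s(f.v₁, f.v₂), s(u₁, partner M u₁), s(f.v₃, f.v₄), s(u₃, partner M u₃)} := by
  have key : ∀ A B O N : Set (Sym2 (Fin (2 * n))), B = (A \ O) ∪ N → O ⊆ A →
      (∀ e ∈ N, e ∉ A) → A = (B \ N) ∪ O := by
    rintro A B O N rfl hO hN
    ext e
    have h1 := @hO e
    have h2 := hN e
    simp only [Set.mem_union, Set.mem_sdiff]
    tauto
  obtain ⟨p1, p2, p3, p4⟩ := hf.partner_eq
  obtain ⟨a1, a2, a3, a4⟩ := h₁
  obtain ⟨b1, b2, b3, b4⟩ := h₃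
  have inj : Function.Injective (partner M) :=
    (show Function.Involutive (partner M) from partner_partner M).injective
  refine key _ _ _ _ h ?_ ?_
  · intro e he
    simp only [Set.mem_insert_iff, Set.mem_singleton_iff] at he
    rcases he with rfl | rfl | rfl | rfl <;> simp only [mem_edgeSet_iff] <;> assumption
  · intro e he
    simp only [Set.mem_insert_iff, Set.mem_singleton_iff] at he
    rcases he with rfl | rfl | rfl | rfl <;> simp only [mem_edgeSet_iff]
    · rw [p1]; exact a2.symm
    · intro h; exact a2 (inj h).symm
    · rw [p3]; exact b4.symm
    · intro h; exact b4 (inj h).symm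

theorem Flaw.mem_actions_iff' {f : Flaw col} {M M' : PM n} :
    M' ∈ f.actions M ↔ ∃ u₁ u₃, f.Off u₁ ∧ f.Off u₃ ∧ u₃ ≠ u₁ ∧ u₃ ≠ partner M u₁ ∧
      f.SwitchesTo M u₁ u₃ M' :=
  Flaw.mem_actions_iff

/-- The result of addressing a flaw determines the previous matching. -/
theorem Flaw.actions_atomic {f : Flaw col} {M₁ M₂ M' : PM n} (h₁ : f.Present M₁)
    (h₂ : f.Present M₂) (hM₁ : M' ∈ f.actions M₁) (hM₂ : M' ∈ f.actions M₂) : M₁ = M₂ := by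
  obtain ⟨u₁, u₃, a1, a3, -, -, ha⟩ := Flaw.mem_actions_iff'.1 hM₁
  obtain ⟨t₁, t₃, b1, b3, -, -, hb⟩ := Flaw.mem_actions_iff'.1 hM₂
  obtain ⟨c1, c2, c3, c4⟩ := ha.partner_eq
  obtain ⟨d1, d2, d3, d4⟩ := hb.partner_eq
  obtain rfl : u₁ = t₁ := c1.symm.trans d1
  obtain rfl : u₃ = t₃ := c3.symm.trans d3
  refine PM.ext_edgeSet ?_
  rw [ha.edgeSet_eq h₁ a1 a3, hb.edgeSet_eq h₂ b1 b3, ← c2, ← d2, ← c4, ← d4]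

/-- The vertex belongs to the flaw. -/
def Flaw.Touches (g : Flaw col) (v : Fin (2 * n)) : Prop :=
  v = g.v₁ ∨ v = g.v₂ ∨ v = g.v₃ ∨ v = g.v₄

open Classical in
/-- The flaws that contain a given vertex. -/
noncomputable def flawsAt (col : Coloring n) (v : Fin (2 * n)) : Finset (Flaw col) :=
  Finset.univ.filter fun g => g.Touches v

/-- The flaws that have a vertex in common with `f`. -/
noncomputable def Flaw.nbrs (f : Flaw col) : Finset (Flaw col) :=
  flawsAt col f.v₁ ∪ flawsAt col f.v₂ ∪ flawsAt col f.v₃ ∪ flawsAt col f.v₄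

theorem Flaw.mem_nbrs {f g : Flaw col} :
    g ∈ f.nbrs ↔ g.Touches f.v₁ ∨ g.Touches f.v₂ ∨ g.Touches f.v₃ ∨ g.Touches f.v₄ := by
  simp [Flaw.nbrs, flawsAt]

theorem Flaw.mem_nbrs_self (f : Flaw col) : f ∈ f.nbrs :=
  Flaw.mem_nbrs.2 (Or.inl (Or.inl rfl))

/-- One of the two edges of g is new, and every new edge contains a vertex of f. -/
theorem Flaw.mem_nbrs_of_new {f g : Flaw col} {M M' : PM n} (h : M' ∈ f.actions M)
    (hg' : g.Present M') (hg : ¬ g.Present M) : g ∈ f.nbrs := by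
  obtain ⟨u₁, u₃, -, -, -, -, ha⟩ := Flaw.mem_actions_iff'.1 h
  have key : ∀ x y, partner M' x = y → partner M x ≠ y →
      (f.v₁ = x ∨ f.v₁ = y) ∨ (f.v₂ = x ∨ f.v₂ = y) ∨ (f.v₃ = x ∨ f.v₃ = y) ∨
        (f.v₄ = x ∨ f.v₄ = y) := by
    intro x y h' hn
    rw [← mem_edgeSet_iff, ha] at h'
    rw [Ne, ← mem_edgeSet_iff] at hn
    rcases h' with h' | h'
    · exact absurd h'.1 hn
    · simp only [Set.mem_insert_iff, Set.mem_singleton_iff, Sym2.eq_iff] at h'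
      grind
  rw [Flaw.mem_nbrs]
  rw [Flaw.present_iff] at hg hg'
  unfold Flaw.Touches
  by_cases h1 : partner M g.v₁ = g.v₂
  · have := key _ _ hg'.2 (fun h3 => hg ⟨h1, h3⟩)
    tauto
  · have := key _ _ hg'.1 h1
    tauto

/-- The other vertex of the edge of `g` at `v`, and the other edge. -/
def Flaw.code (g : Flaw col) (v : Fin (2 * n)) : Fin (2 * n) × (K2 n).edgeSet :=
  if v = g.v₁ then (g.v₂, ⟨s(g.v₃, g.v₄), g.lt₄₃.ne'⟩)
  else if v = g.v₂ then (g.v₁, ⟨s(g.v₃, g.v₄), g.lt₄₃.ne'⟩)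
  else if v = g.v₃ then (g.v₄, ⟨s(g.v₁, g.v₂), g.lt₂₁.ne'⟩)
  else (g.v₃, ⟨s(g.v₁, g.v₂), g.lt₂₁.ne'⟩)

theorem Flaw.Touches.code_cases {g : Flaw col} {v : Fin (2 * n)} (h : g.Touches v) :
    (v = g.v₁ ∧ (g.code v).1 = g.v₂ ∧ (g.code v).2 = ⟨s(g.v₃, g.v₄), g.lt₄₃.ne'⟩) ∨
    (v = g.v₂ ∧ (g.code v).1 = g.v₁ ∧ (g.code v).2 = ⟨s(g.v₃, g.v₄), g.lt₄₃.ne'⟩) ∨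
    (v = g.v₃ ∧ (g.code v).1 = g.v₄ ∧ (g.code v).2 = ⟨s(g.v₁, g.v₂), g.lt₂₁.ne'⟩) ∨
    (v = g.v₄ ∧ (g.code v).1 = g.v₃ ∧ (g.code v).2 = ⟨s(g.v₁, g.v₂), g.lt₂₁.ne'⟩) := by
  unfold Flaw.code
  unfold Flaw.Touches at h
  split_ifs with h1 h2 h3
  · exact Or.inl ⟨h1, rfl, rfl⟩
  · exact Or.inr (Or.inl ⟨h2, rfl, rfl⟩)
  · exact Or.inr (Or.inr (Or.inl ⟨h3, rfl, rfl⟩))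
  · exact Or.inr (Or.inr (Or.inr ⟨by tauto, rfl, rfl⟩))

/-- The code gives both edges of the flaw as unordered pairs; the order conditions of the normal
form then fix which vertex is which. -/
theorem Flaw.code_injOn (v : Fin (2 * n)) :
    Set.InjOn (fun g : Flaw col => g.code v) {g | g.Touches v} := by
  intro g hg h hh hc
  have g1 := g.lt₂₁
  have g2 := g.lt₄₃
  have g3 := g.lt₃₁
  have h1 := h.lt₂₁
  have h2 := h.lt₄₃
  have h3 := h.lt₃₁
  have c1 : (g.code v).1 = (h.code v).1 := congrArg Prod.fst hc
  have c2 : (g.code v).2.1 = (h.code v).2.1 := congrArg (fun x => x.2.1) hc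
  suffices H : g.v₁ = h.v₁ ∧ g.v₂ = h.v₂ ∧ g.v₃ = h.v₃ ∧ g.v₄ = h.v₄ from
    Flaw.ext H.1 H.2.1 H.2.2.1 H.2.2.2
  simp only [Fin.ext_iff, Fin.lt_def] at *
  rcases hg.code_cases with ⟨k1, k2, k3⟩ | ⟨k1, k2, k3⟩ | ⟨k1, k2, k3⟩ | ⟨k1, k2, k3⟩ <;>
    rcases hh.code_cases with ⟨l1, l2, l3⟩ | ⟨l1, l2, l3⟩ | ⟨l1, l2, l3⟩ | ⟨l1, l2, l3⟩ <;>
    rw [k2, l2] at c1 <;> rw [k3, l3] at c2 <;>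
    simp only [Sym2.eq_iff, Fin.ext_iff] at c2 k1 l1 <;> omega

-- There are 2n-1 choices x for the other end of the edge at v. The second edge has the colour of vx
-- and differs from vx, which leaves at most R-1 choices.
open Classical in
theorem card_flawsAt_le {R : ℝ} (hR : ∀ k : ℕ, ({e | col e = k}.ncard : ℝ) ≤ R)
    (v : Fin (2 * n)) : ((flawsAt col v).card : ℝ) ≤ (2 * n - 1) * (R - 1) := by
  let T : Finset (Σ _ : Fin (2 * n), (K2 n).edgeSet) := (Finset.univ.erase v).sigma fun x =>
    Finset.univ.filter fun e => col e = clr col v x ∧ e.1 ≠ s(v, x)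
  have h1 : (flawsAt col v).card ≤ T.card := by
    refine Finset.card_le_card_of_injOn (fun g => ⟨(g.code v).1, (g.code v).2⟩) ?_ ?_
    · intro g hg
      have hg : g.Touches v := by simpa [flawsAt] using hg
      have s1 := g.same
      simp only [T, Finset.coe_sigma, Set.mem_sigma_iff, Finset.mem_coe, Finset.mem_erase,
        Finset.mem_univ, and_true, Finset.mem_filter, true_and]
      have g1 := g.lt₂₁
      have g2 := g.lt₄₃
      have g3 := g.lt₃₁
      have g4 := g.ne₂₃
      have g5 := g.ne₂₄
      have e1 := g1.ne'
      have e2 := g2.ne'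
      have e3 := g3.ne'
      have e4 := (g2.trans g3).ne'
      have hs := g.clr_same
      have hs12 : col ⟨s(g.v₁, g.v₂), g.lt₂₁.ne'⟩ = clr col g.v₁ g.v₂ := (clr_eq col e1).symm
      have hs34 : col ⟨s(g.v₃, g.v₄), g.lt₄₃.ne'⟩ = clr col g.v₃ g.v₄ := (clr_eq col e2).symm
      rcases hg.code_cases with ⟨k1, k2, k3⟩ | ⟨k1, k2, k3⟩ | ⟨k1, k2, k3⟩ | ⟨k1, k2, k3⟩ <;>
        rw [k2, k3, k1] <;>
        first
        | (refine ⟨g1.ne, hs34.trans hs.symm, ?_⟩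
           simp only [ne_eq, Sym2.eq_iff]; grind)
        | (refine ⟨g1.ne', hs34.trans (hs.symm.trans (clr_comm col _ _)), ?_⟩
           simp only [ne_eq, Sym2.eq_iff]; grind)
        | (refine ⟨g2.ne, hs12.trans hs, ?_⟩
           simp only [ne_eq, Sym2.eq_iff]; grind)
        | (refine ⟨g2.ne', hs12.trans (hs.trans (clr_comm col _ _)), ?_⟩
           simp only [ne_eq, Sym2.eq_iff]; grind)
    · intro g hg h hh hc
      have hg : g.Touches v := by simpa [flawsAt] using hg
      have hh : h.Touches v := by simpa [flawsAt] using hh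
      simp only [Sigma.mk.injEq, heq_eq_eq] at hc
      exact Flaw.code_injOn v hg hh (Prod.ext hc.1 hc.2)
  have h2 : (T.card : ℝ) ≤ (2 * n - 1) * (R - 1) := by
    rw [Finset.card_sigma, Nat.cast_sum]
    calc ∑ x ∈ Finset.univ.erase v, ((Finset.univ.filter fun e : (K2 n).edgeSet =>
            col e = clr col v x ∧ e.1 ≠ s(v, x)).card : ℝ)
        ≤ ∑ x ∈ Finset.univ.erase v, (R - 1) := by
          refine Finset.sum_le_sum fun x hx => ?_
          have hx : v ≠ x := (Finset.ne_of_mem_erase hx).symm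
          have hR' := hR (clr col v x)
          rw [Set.ncard_eq_toFinset_card'] at hR'
          have hmem : (⟨s(v, x), hx⟩ : (K2 n).edgeSet) ∈
              ({e | col e = clr col v x} : Set _).toFinset := by
            rw [Set.mem_toFinset]
            exact (clr_eq col hx).symm
          have heq : (Finset.univ.filter fun e : (K2 n).edgeSet =>
              col e = clr col v x ∧ e.1 ≠ s(v, x)) =
              (({e | col e = clr col v x} : Set _).toFinset).erase ⟨s(v, x), hx⟩ := by
            ext e
            simp only [Finset.mem_filter, Finset.mem_univ, true_and, Finset.mem_erase,
              Set.mem_toFinset, Set.mem_ofPred_eq, ne_eq, Subtype.ext_iff]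
            tauto
          have hcard := Finset.card_erase_add_one hmem
          rw [heq]
          have : (((({e | col e = clr col v x} : Set _).toFinset).erase
            (⟨s(v, x), hx⟩ : (K2 n).edgeSet)).card : ℝ) + 1 ≤ R := by
            refine le_trans (le_of_eq ?_) hR'
            exact_mod_cast hcard
          linarith
      _ = (2 * n - 1) * (R - 1) := by
          rw [Finset.sum_const, Finset.card_erase_of_mem (Finset.mem_univ _), Finset.card_univ,
            Fintype.card_fin, nsmul_eq_mul, Nat.cast_sub (by have := v.2; omega)]
          push_cast
          ring
  exact le_trans (by exact_mod_cast h1) h2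

theorem Flaw.card_nbrs_le {R : ℝ} (hR : ∀ k : ℕ, ({e | col e = k}.ncard : ℝ) ≤ R)
    (f : Flaw col) : (f.nbrs.card : ℝ) ≤ 4 * ((2 * n - 1) * (R - 1)) := by
  have h1 := card_flawsAt_le hR f.v₁
  have h2 := card_flawsAt_le hR f.v₂
  have h3 := card_flawsAt_le hR f.v₃
  have h4 := card_flawsAt_le hR f.v₄
  have h : f.nbrs.card ≤ (flawsAt col f.v₁).card + (flawsAt col f.v₂).card +
      (flawsAt col f.v₃).card + (flawsAt col f.v₄).card := by
    unfold Flaw.nbrs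
    refine (Finset.card_union_le _ _).trans (Nat.add_le_add_right ?_ _)
    refine (Finset.card_union_le _ _).trans (Nat.add_le_add_right ?_ _)
    exact Finset.card_union_le _ _
  have h' : (f.nbrs.card : ℝ) ≤ (flawsAt col f.v₁).card + (flawsAt col f.v₂).card +
      (flawsAt col f.v₃).card + (flawsAt col f.v₄).card := by exact_mod_cast h
  linarith

open Classical in
/-- The flaws present in a matching. -/
noncomputable def flawsIn (col : Coloring n) (M : PM n) : Finset (Flaw col) :=
  Finset.univ.filter fun f => f.Present M

theorem mem_flawsIn {f : Flaw col} {M : PM n} : f ∈ flawsIn col M ↔ f.Present M := by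
  simp [flawsIn]

/-- The pair (v₁, v₃) determines a flaw of M. -/
theorem card_flawsIn_le (M : PM n) : (flawsIn col M).card ≤ (2 * n) ^ 2 := by
  have : (flawsIn col M).card ≤ (Finset.univ : Finset (Fin (2 * n) × Fin (2 * n))).card := by
    refine Finset.card_le_card_of_injOn (fun f => (f.v₁, f.v₃))
      (fun _ _ => Finset.mem_coe.2 (Finset.mem_univ _)) ?_
    intro f hf g hg h
    rw [Finset.mem_coe, mem_flawsIn, Flaw.present_iff] at hf hg
    simp only [Prod.mk.injEq] at h
    exact Flaw.ext h.1 (by rw [← hf.1, ← hg.1, h.1]) h.2 (by rw [← hf.2, ← hg.2, h.2])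
  refine this.trans (le_of_eq ?_)
  simp [sq]

end Matchings

/-! ## The length of the walk -/

section Length

variable {n : ℕ} {col : Coloring n}

/-! ### Numerical estimates -/

theorem two_exp_one_gt : (5.4 : ℝ) < 2 * Real.exp 1 := by
  have := Real.exp_one_gt_d9
  linarith

/-- The colour of any edge is used at least once, so n/C ≥ 1. Small n are thereby excluded. -/
theorem le_of_ncard_le {C : ℝ} (hC : 0 < C) (hn : 1 ≤ n)
    (hcol : ∀ k : ℕ, ({e | col e = k}.ncard : ℝ) ≤ n / C) : C ≤ n := by
  have h01 : (⟨0, by omega⟩ : Fin (2 * n)) ≠ ⟨1, by omega⟩ := by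
    rw [Ne, Fin.mk.injEq]; exact zero_ne_one
  let e : (K2 n).edgeSet := ⟨s(⟨0, by omega⟩, ⟨1, by omega⟩), h01⟩
  have h1 := hcol (col e)
  have h2 : 0 < {e' | col e' = col e}.ncard := (Set.ncard_pos).2 ⟨e, rfl⟩
  have h3 : (1 : ℝ) ≤ n / C := le_trans (by exact_mod_cast h2) h1
  rwa [le_div_iff₀ hC, one_mul] at h3

theorem six_le {C : ℝ} (hC : 2 * Real.exp 1 < C) (h : C ≤ n) : 6 ≤ n := by
  have := two_exp_one_gt
  by_contra hn
  have : (n : ℝ) ≤ 5 := by exact_mod_cast (by omega : n ≤ 5)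
  linarith

/-- After clearing denominators: 2(2n-1)(n-C) ≤ (2n-4)(2n-6). The leading terms 4n² are equal, and
the linear terms need about 4C > 18; so it matters that the second edge of a flaw has n/C-1 choices
and not n/C. -/
theorem four_mul_deg_le {C : ℝ} (hC : 2 * Real.exp 1 < C) (h : C ≤ n) :
    C / (2 * ((2 * n - 4) * (2 * n - 6))) * (4 * ((2 * n - 1) * (n / C - 1))) ≤ 1 := by
  have h0 := two_exp_one_gt
  have hn : (6 : ℝ) ≤ n := by exact_mod_cast six_le hC h
  have hA : (0 : ℝ) < (2 * n - 4) * (2 * n - 6) := by nlinarith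
  have hC0 : (0 : ℝ) < C := by linarith
  rw [show C / (2 * ((2 * n - 4) * (2 * n - 6))) * (4 * ((2 * n - 1) * (n / C - 1))) =
    2 * ((2 * n - 1) * (n - C)) / ((2 * n - 4) * (2 * n - 6)) by field_simp; ring, div_le_one hA]
  nlinarith

theorem weight_condition {C : ℝ} (hC : 2 * Real.exp 1 < C) (h : C ≤ n)
    (hcol : ∀ k : ℕ, ({e | col e = k}.ncard : ℝ) ≤ n / C) (f : Flaw col) :
    ENNReal.ofReal ((2 * n - 4) * (2 * n - 6) : ℝ)⁻¹ *
        (1 + ENNReal.ofReal (C / (2 * ((2 * n - 4) * (2 * n - 6))))) ^ f.nbrs.card ≤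
      ENNReal.ofReal (2 * Real.exp 1 / C) *
        ENNReal.ofReal (C / (2 * ((2 * n - 4) * (2 * n - 6)))) := by
  have h0 := two_exp_one_gt
  have hn : (6 : ℝ) ≤ n := by exact_mod_cast six_le hC h
  have hA : (0 : ℝ) < (2 * n - 4) * (2 * n - 6) := by nlinarith
  have hC0 : (0 : ℝ) < C := by linarith
  have hdeg := four_mul_deg_le hC h
  have hcard := f.card_nbrs_le hcol
  set A : ℝ := (2 * n - 4) * (2 * n - 6) with hAdef
  set μ : ℝ := C / (2 * A) with hμ
  have hμ0 : 0 < μ := by positivity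
  rw [← ENNReal.ofReal_one, ← ENNReal.ofReal_add zero_le_one hμ0.le,
    ← ENNReal.ofReal_pow (by positivity), ← ENNReal.ofReal_mul (by positivity),
    ← ENNReal.ofReal_mul (by positivity)]
  refine ENNReal.ofReal_le_ofReal ?_
  have h1 : (1 + μ) ^ f.nbrs.card ≤ Real.exp 1 := by
    calc (1 + μ) ^ f.nbrs.card ≤ Real.exp μ ^ f.nbrs.card := by
          gcongr
          linarith [Real.add_one_le_exp μ]
      _ = Real.exp (μ * f.nbrs.card) := by rw [mul_comm, Real.exp_nat_mul]
      _ ≤ Real.exp 1 := by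
          refine Real.exp_le_exp.2 (le_trans ?_ hdeg)
          gcongr
  calc A⁻¹ * (1 + μ) ^ f.nbrs.card ≤ A⁻¹ * Real.exp 1 := by gcongr
    -- Equality here: μ is chosen such that λμ = e/A.
    _ = 2 * Real.exp 1 / C * μ := by rw [hμ]; field_simp

/-- On the logarithmic scale (2n)^(2n) costs at most 4 n log n, the power of 1+μ at most 3C/2, and
the target 2^(-sn) at most s n log n. Together these give 5 + 3C/2. -/
theorem exp_bound {C : ℝ} (hC : 2 * Real.exp 1 < C) (h : C ≤ n) {s m : ℕ} (hs : 1 ≤ s)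
    (hm : (5 + 3 / 2 * C) / Real.log (C / (2 * Real.exp 1)) * (s * (n * Real.log n)) ≤ m) :
    (2 * Real.exp 1 / C) ^ m * (2 * n : ℝ) ^ (2 * n) *
        (1 + C / (2 * ((2 * n - 4) * (2 * n - 6)))) ^ ((2 * n) ^ 2) ≤ (1 / 2 : ℝ) ^ (s * n) := by
  have h0 := two_exp_one_gt
  have hn6 := six_le hC h
  have hn : (6 : ℝ) ≤ n := by exact_mod_cast hn6
  have hn0 : (0 : ℝ) < n := by linarith
  have hA : (0 : ℝ) < (2 * n - 4) * (2 * n - 6) := by nlinarith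
  have hC0 : (0 : ℝ) < C := by linarith
  have he : (0 : ℝ) < 2 * Real.exp 1 := by linarith
  set L := Real.log (C / (2 * Real.exp 1)) with hL
  have hL0 : 0 < L := Real.log_pos (by rwa [one_lt_div he])
  have hs' : (1 : ℝ) ≤ s := by exact_mod_cast hs
  have hlog : 1 ≤ Real.log n := by
    rw [Real.le_log_iff_exp_le hn0]
    linarith [Real.exp_one_lt_d9]
  have e1 : (2 * Real.exp 1 / C) ^ m = Real.exp (-(m * L)) := by
    rw [Real.exp_neg, Real.exp_nat_mul, hL, Real.exp_log (by positivity), ← inv_pow, inv_div]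
  have e2 : (2 * n : ℝ) ^ (2 * n) = Real.exp (2 * n * Real.log (2 * n)) := by
    rw [← Real.exp_log (show (0 : ℝ) < (2 * n) ^ (2 * n) by positivity), Real.log_pow]
    push_cast
    rfl
  have e3 : (1 + C / (2 * ((2 * n - 4) * (2 * n - 6)))) ^ ((2 * n) ^ 2) ≤ Real.exp (3 / 2 * C) := by
    set μ := C / (2 * ((2 * n - 4) * (2 * n - 6))) with hμ
    have hμ0 : 0 < μ := by positivity
    calc (1 + μ) ^ ((2 * n) ^ 2) ≤ Real.exp μ ^ ((2 * n) ^ 2) := by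
          gcongr
          linarith [Real.add_one_le_exp μ]
      _ = Real.exp (((2 * n) ^ 2 : ℕ) * μ) := by rw [Real.exp_nat_mul]
      _ ≤ _ := by
          refine Real.exp_le_exp.2 ?_
          rw [hμ]
          push_cast
          rw [mul_div_assoc', div_le_iff₀ (by positivity)]
          -- Equality holds for n = 6, the least possible value.
          have : (2 * n : ℝ) ^ 2 ≤ 3 * ((2 * n - 4) * (2 * n - 6)) := by nlinarith
          nlinarith
  have e4 : (1 / 2 : ℝ) ^ (s * n) = Real.exp (-(s * n * Real.log 2)) := by
    rw [Real.exp_neg, show (s * n * Real.log 2 : ℝ) = ((s * n : ℕ) : ℝ) * Real.log 2 by push_cast; ring,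
      Real.exp_nat_mul, Real.exp_log two_pos, one_div, inv_pow]
  rw [e1, e2, e4, ← Real.exp_add]
  refine (mul_le_mul_of_nonneg_left e3 (Real.exp_pos _).le).trans ?_
  rw [← Real.exp_add]
  refine Real.exp_le_exp.2 ?_
  have hm' : (5 + 3 / 2 * C) * (s * (n * Real.log n)) ≤ m * L := by
    rwa [div_mul_eq_mul_div, div_le_iff₀ hL0] at hm
  have hl2 : Real.log (2 * n) ≤ 2 * Real.log n := by
    rw [← Real.log_rpow hn0]
    refine Real.log_le_log (by positivity) ?_
    norm_num
    nlinarith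
  have hl3 : Real.log 2 ≤ 1 := by linarith [Real.log_two_lt_d9]
  set l := Real.log n
  have hnl : (n : ℝ) ≤ n * l := by nlinarith
  have hsnl : n * l ≤ s * (n * l) := by nlinarith
  have t1 : 2 * n * Real.log (2 * n) ≤ 4 * (s * (n * l)) := by nlinarith
  have t2 : 3 / 2 * C ≤ 3 / 2 * C * (s * (n * l)) := by nlinarith
  have t3 : s * n * Real.log 2 ≤ s * (n * l) := by
    have : s * n * Real.log 2 ≤ s * n * 1 := by gcongr
    nlinarith
  linarith

/-- `f` is the greatest flaw present in `M`. -/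
def IsTop (f : Flaw col) (M : PM n) : Prop :=
  f.Present M ∧ ∀ g : Flaw col, g.Present M → g.rank ≤ f.rank

theorem exists_isTop {M : PM n} (h : ∃ f : Flaw col, f.Present M) :
    ∃ f : Flaw col, IsTop f M := by
  obtain ⟨f₀, h₀⟩ := h
  obtain ⟨f, hf, hmax⟩ := (flawsIn col M).exists_max_image Flaw.rank ⟨f₀, mem_flawsIn.2 h₀⟩
  exact ⟨f, mem_flawsIn.1 hf, fun g hg => hmax g (mem_flawsIn.2 hg)⟩

theorem IsTop.unique {f g : Flaw col} {M : PM n} (hf : IsTop f M) (hg : IsTop g M) : f = g :=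
  Flaw.rank_injective (le_antisymm (hg.2 _ hf.1) (hf.2 _ hg.1))

open Classical in
/-- The results of addressing a flaw, as a finite set. -/
noncomputable def Flaw.act (f : Flaw col) (M : PM n) : Finset (PM n) :=
  Finset.univ.filter (· ∈ f.actions M)

theorem Flaw.mem_act {f : Flaw col} {M M' : PM n} : M' ∈ f.act M ↔ M' ∈ f.actions M := by
  simp [Flaw.act]

/-- The number `h m M` bounds the probability that the walk from `M` does not end within `m`
rounds. -/
theorem exists_survival {C : ℝ} (hC : 2 * Real.exp 1 < C) (hn : 1 ≤ n)
    (hcol : ∀ k : ℕ, ({e | col e = k}.ncard : ℝ) ≤ n / C) :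
    ∃ h : ℕ → PM n → ℝ≥0∞, (∀ M, h 0 M = 1) ∧
      (∀ m M (f : Flaw col), IsTop f M → h (m + 1) M =
        ENNReal.ofReal ((2 * n - 4) * (2 * n - 6) : ℝ)⁻¹ * ∑ M' ∈ f.act M, h m M') ∧
      ∀ M (s m : ℕ), 1 ≤ s →
        (5 + 3 / 2 * C) / Real.log (C / (2 * Real.exp 1)) * (s * (n * Real.log n)) ≤ m →
        h m M ≤ 2⁻¹ ^ (s * n) := by
  have hCn := le_of_ncard_le (by linarith [two_exp_one_gt]) hn hcol
  have h6 : (6 : ℝ) ≤ n := by exact_mod_cast six_le hC hCn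
  have hC0 : 0 < C := by linarith [two_exp_one_gt]
  -- If the colouring has no flaws, `top` would have no values; then the recursion is vacuous and 0
  -- serves for all m ≥ 1.
  rcases isEmpty_or_nonempty (Flaw col) with hE | hE
  · refine ⟨fun m _ => if m = 0 then 1 else 0, fun _ => by simp, fun m M f => hE.elim f, ?_⟩
    intro M s m hs hm
    change (if m = 0 then 1 else 0 : ℝ≥0∞) ≤ _
    rw [if_neg]
    · exact zero_le
    · rintro rfl
      have h1 : 0 < Real.log (C / (2 * Real.exp 1)) :=
        Real.log_pos (by rwa [one_lt_div (by positivity)])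
      have h2 : 0 < Real.log n := Real.log_pos (by linarith)
      have h3 : (0 : ℝ) < s := by exact_mod_cast hs
      have : 0 < (5 + 3 / 2 * C) / Real.log (C / (2 * Real.exp 1)) * (s * (n * Real.log n)) := by
        positivity
      simp only [Nat.cast_zero] at hm
      linarith
  · classical
    let top : PM n → Flaw col := fun M =>
      if h : ∃ f : Flaw col, f.Present M then (exists_isTop h).choose else hE.some
    have htop : ∀ M (f : Flaw col), f.Present M → IsTop (top M) M := by
      intro M f hf
      have h : ∃ f : Flaw col, f.Present M := ⟨f, hf⟩
      simp only [top, dif_pos h]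
      exact (exists_isTop h).choose_spec
    let α : ℝ≥0∞ := ENNReal.ofReal ((2 * n - 4) * (2 * n - 6) : ℝ)⁻¹
    refine ⟨survival (flawsIn col) Flaw.act top α, fun _ => rfl, ?_, ?_⟩
    · intro m M f hf
      rw [survival, if_pos ⟨f, mem_flawsIn.2 hf.1⟩, (htop M f hf.1).unique hf]
    · intro M s m hs hm
      refine (survival_le (Γ := Flaw.nbrs) Flaw.rank_injective ?_ ?_ ?_ ?_
        (fun f => weight_condition hC hCn hcol f) m M).trans ?_
      · rintro M ⟨f, hf⟩
        exact mem_flawsIn.2 (htop M f (mem_flawsIn.1 hf)).1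
      · intro M g hg
        exact (htop M g (mem_flawsIn.1 hg)).2 g (mem_flawsIn.1 hg)
      · intro M f hf M' hM' g hg
        by_cases hg' : g ∈ f.nbrs
        · exact Finset.mem_union_right _ hg'
        · refine Finset.mem_union_left _ (Finset.mem_erase.2 ⟨?_, ?_⟩)
          · rintro rfl
            exact hg' g.mem_nbrs_self
          · by_contra hgM
            exact hg' (Flaw.mem_nbrs_of_new (Flaw.mem_act.1 hM') (mem_flawsIn.1 hg)
              fun h => hgM (mem_flawsIn.2 h))
      · intro f M₁ M₂ M' h₁ h₂ a₁ a₂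
        exact Flaw.actions_atomic (mem_flawsIn.1 h₁) (mem_flawsIn.1 h₂) (Flaw.mem_act.1 a₁)
          (Flaw.mem_act.1 a₂)
      · have hA : (0 : ℝ) < (2 * n - 4) * (2 * n - 6) := by nlinarith
        have hb := exp_bound hC hCn hs hm
        have hμ : 0 ≤ C / (2 * ((2 * n - 4) * (2 * n - 6)) : ℝ) := by positivity
        calc ENNReal.ofReal (2 * Real.exp 1 / C) ^ m * Fintype.card (PM n) *
              (1 + ENNReal.ofReal (C / (2 * ((2 * n - 4) * (2 * n - 6))))) ^ (flawsIn col M).card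
            ≤ ENNReal.ofReal (2 * Real.exp 1 / C) ^ m * ((2 * n) ^ (2 * n) : ℕ) *
              (1 + ENNReal.ofReal (C / (2 * ((2 * n - 4) * (2 * n - 6))))) ^ ((2 * n) ^ 2) := by
              gcongr
              · exact card_PM_le
              · exact le_self_add
              · exact card_flawsIn_le M
          _ = ENNReal.ofReal ((2 * Real.exp 1 / C) ^ m * (2 * n : ℝ) ^ (2 * n) *
              (1 + C / (2 * ((2 * n - 4) * (2 * n - 6)))) ^ ((2 * n) ^ 2)) := by
              rw [ENNReal.ofReal_mul (by positivity), ENNReal.ofReal_mul (by positivity),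
                ENNReal.ofReal_pow (by positivity), ENNReal.ofReal_pow (p := 1 + _) (by positivity),
                ENNReal.ofReal_add zero_le_one hμ, ENNReal.ofReal_one]
              congr 2
              rw [← ENNReal.ofReal_natCast]
              push_cast
              rfl
          _ ≤ ENNReal.ofReal ((1 / 2 : ℝ) ^ (s * n)) := ENNReal.ofReal_le_ofReal hb
          _ = 2⁻¹ ^ (s * n) := by
              rw [ENNReal.ofReal_pow (by positivity), one_div, ENNReal.ofReal_inv_of_pos two_pos]
              simp

end Length

set_option linter.unusedSimpArgs false

/-! ## The program

Registers `0, 1, 2, 3, 5` hold `n`, `1`, `2 * n`, `(2 * n) ^ 2`, `0`.  Register `4` is the flag of the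
main loop, registers `6, …, 9` hold the greatest flaw, and registers `10, …, 13` the vertices
`u₁, …, u₄`. -/

/-- A sequence of instructions. -/
def Prog.block : Instr → List Instr → Prog
  | i, [] => .op i
  | i, j :: l => .seq (.op i) (Prog.block j l)

/-- An instruction without relevance. -/
def skip : Prog := .op (.const 24 0)

/-- Look at the vertex `y` of register `15`, and store the flaw that it forms with the vertex `x` of
register `14`. -/
def scanInner : Prog :=
  .seq (Prog.block (.add 16 3 15) [.load 18 16, .mul 20 15 2, .add 20 20 18, .load 20 20])
    (.seq
      -- Registers 17, 18 hold the partners of x, y and registers 19, 20 the colours of the two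
      -- edges. Equality of colours is tested by two strict comparisons.
      (.ite 17 14
        (.ite 18 15
          (.ite 19 20 skip
            (.ite 20 19 skip
              (Prog.block (.const 4 1) [.add 6 14 5, .add 7 17 5, .add 8 15 5, .add 9 18 5])))
          skip)
        skip)
      (.op (.add 15 15 1)))

/-- Look for flaws in which register `14` is the greatest vertex. -/
def scanOuter : Prog :=
  .seq (Prog.block (.add 16 3 14)
      [.load 17 16, .mul 19 14 2, .add 19 19 17, .load 19 19, .const 15 0])
    (.seq (.loop 15 14 scanInner) (.op (.add 14 14 1)))

/-- Find the greatest flaw. -/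
def scan : Prog :=
  .seq (Prog.block (.const 4 0) [.const 14 0]) (.loop 14 2 scanOuter)

/-- Write the partner of the vertex in register `14`. -/
def fillBody : Prog :=
  Prog.block (.add 16 3 14) [.sub 17 2 1, .sub 17 17 14, .store 16 17, .add 14 14 1]

/-- Set the constants, write the first matching, and find its greatest flaw. -/
def initProg : Prog :=
  .seq (Prog.block (.const 1 1) [.const 5 0, .add 2 0 0, .mul 3 2 2, .const 14 0])
    (.seq (.loop 14 2 fillBody) scan)

/-- Count the vertex in register `14` if it has a partner, and store it in register `d` as long as
the count is less than register `21`. -/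
def pickBody (d : ℕ) : Prog :=
  .seq (Prog.block (.add 16 3 14) [.load 17 16])
    (.seq
      (.ite 17 2 (.seq (.ite 22 21 (.op (.add d 14 5)) skip) (.op (.add 22 22 1))) skip)
      (.op (.add 14 14 1)))

/-- Find the vertex that has the number given by register `21` among those with a partner. -/
def pick (d : ℕ) : Prog :=
  -- Register 21 is raised to j+1, so register `d` is overwritten for counts up to j and keeps the
  -- vertex preceded by exactly j others.
  .seq (Prog.block (.add 21 21 1) [.const 14 0, .const 22 0, .const d 0]) (.loop 14 2 (pickBody d))

/-- Remove the edges of the flaw. -/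
def cutFlaw : Prog :=
  -- The entry 2n marks a removed vertex. Register 23 becomes 2n-5, since `rand` includes its upper
  -- end: 2n-4 vertices are left.
  Prog.block (.add 16 3 6) [.store 16 2, .add 16 3 7, .store 16 2, .add 16 3 8, .store 16 2,
    .add 16 3 9, .store 16 2, .const 23 5, .sub 23 2 23]

/-- Remove the edge of the vertex in register `10`. -/
def cutEdge : Prog :=
  Prog.block (.add 16 3 10) [.load 11 16, .store 16 2, .add 16 3 11, .store 16 2, .const 23 7,
    .sub 23 2 23]

/-- Write the new edges. -/
def join : Prog :=
  -- The edges are written in reverse order, so that the last writes match the first cases of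
  -- `switchFun`.
  Prog.block (.add 16 3 12) [.load 13 16,
    .add 16 3 13, .store 16 9, .add 16 3 9, .store 16 13,
    .add 16 3 12, .store 16 8, .add 16 3 8, .store 16 12,
    .add 16 3 11, .store 16 7, .add 16 3 7, .store 16 11,
    .add 16 3 10, .store 16 6, .add 16 3 6, .store 16 10]

/-- Address the greatest flaw, and find the next one. -/
def bodyProg : Prog :=
  .seq cutFlaw (.seq (.op (.rand 21 23)) (.seq (pick 10) (.seq cutEdge
    (.seq (.op (.rand 21 23)) (.seq (pick 12) (.seq join scan))))))

/-! ## Finding the greatest flaw -/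

/-- The registers for constants have their values. -/
structure Consts (n : ℕ) (s : State) : Prop where
  r0 : s.reg 0 = n
  r1 : s.reg 1 = 1
  r2 : s.reg 2 = 2 * n
  r3 : s.reg 3 = (2 * n) ^ 2
  r5 : s.reg 5 = 0

/-- The word in front of the partner list that belongs to the vertices `x`, `y`. -/
def State.word (n : ℕ) (s : State) (x y : ℕ) : ℕ := s.mem (x * (2 * n) + y)

/-- The entry of the partner list at the vertex `x`. -/
def State.list (n : ℕ) (s : State) (x : ℕ) : ℕ := s.mem ((2 * n) ^ 2 + x)

/-- The vertices `x`, `y` are the greatest ones in the edges of a flaw. -/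
def Hit (n : ℕ) (s : State) (x y : ℕ) : Prop :=
  y < x ∧ s.list n x < x ∧ s.list n y < y ∧
    s.word n x (s.list n x) = s.word n y (s.list n y)

/-- Lexicographic order of pairs. -/
def Before (a b x y : ℕ) : Prop := a < x ∨ (a = x ∧ b < y)

/-- The result of the search among the pairs before `(x, y)`. -/
def Found (n : ℕ) (s : State) (x y : ℕ) : Prop :=
  (s.reg 4 = 0 ∧ ∀ a b, Before a b x y → ¬ Hit n s a b) ∨
    (s.reg 4 = 1 ∧ ∃ a b, Before a b x y ∧ Hit n s a b ∧ s.reg 6 = a ∧ s.reg 7 = s.list n a ∧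
      s.reg 8 = b ∧ s.reg 9 = s.list n b ∧
      ∀ a' b', Before a' b' x y → Hit n s a' b' → ¬ Before a b a' b')

theorem Hit.congr {n : ℕ} {s s' : State} (h : s'.mem = s.mem) {x y : ℕ} :
    Hit n s' x y ↔ Hit n s x y := by
  simp only [Hit, State.list, State.word, h]

theorem Found.step_hit {n : ℕ} {s s' : State} {x y : ℕ} (hmem : s'.mem = s.mem)
    (hit : Hit n s x y) (h4 : s'.reg 4 = 1) (h6 : s'.reg 6 = x) (h7 : s'.reg 7 = s.list n x)
    (h8 : s'.reg 8 = y) (h9 : s'.reg 9 = s.list n y) : Found n s' x (y + 1) := by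
  refine Or.inr ⟨h4, x, y, Or.inr ⟨rfl, by omega⟩, (Hit.congr hmem).2 hit, h6, ?_, h8, ?_, ?_⟩
  · rw [h7, State.list, State.list, hmem]
  · rw [h9, State.list, State.list, hmem]
  · intro a b h1 _ h2
    unfold Before at h1 h2
    omega

/-- The pair reached may change as long as no hit lies in between. This covers a step of y, the
passage to the next x, and instructions that do not touch the result. -/
theorem Found.step_miss {n : ℕ} {s s' : State} {x y x' y' : ℕ} (hmem : s'.mem = s.mem)
    (hF : Found n s x y)
    (hnext : ∀ a b, Hit n s a b → Before a b x' y' → Before a b x y)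
    (hle : ∀ a b, Before a b x y → Before a b x' y')
    (h4 : s'.reg 4 = s.reg 4) (h6 : s'.reg 6 = s.reg 6) (h7 : s'.reg 7 = s.reg 7)
    (h8 : s'.reg 8 = s.reg 8) (h9 : s'.reg 9 = s.reg 9) : Found n s' x' y' := by
  have hl : s'.list n = s.list n := by
    funext z
    rw [State.list, State.list, hmem]
  unfold Found
  simp only [h4, h6, h7, h8, h9, hl, Hit.congr hmem]
  rcases hF with ⟨h, hF⟩ | ⟨h, a, b, hab, hit, k6, k7, k8, k9, hF⟩
  · exact Or.inl ⟨h, fun a b hb hit => hF a b (hnext a b hit hb) hit⟩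
  · exact Or.inr ⟨h, a, b, hle _ _ hab, hit, k6, k7, k8, k9,
      fun a' b' hb' hit' => hF a' b' (hnext _ _ hit' hb') hit'⟩

/-- A hit at (x, y) overwrites the earlier result, which is right because pairs come in increasing
order. The bound `hW` keeps all addresses below the word size. -/
theorem scanInner_spec {n w x y : ℕ} (hW : (2 * n) ^ 2 + 2 * n < 2 ^ w) {s : State}
    (hc : Consts n s) (hmem : ∀ a, s.mem a < 2 ^ w) (hlist : ∀ z < 2 * n, s.list n z < 2 * n)
    (hyx : y < x) (hx : x < 2 * n)
    (h14 : s.reg 14 = x) (h15 : s.reg 15 = y) (h17 : s.reg 17 = s.list n x)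
    (h19 : s.reg 19 = s.word n x (s.list n x)) (hF : Found n s x y) :
    ∃ s', (Consts n s' ∧ s'.mem = s.mem ∧ s'.reg 14 = x ∧ s'.reg 15 = y + 1 ∧
      s'.reg 17 = s.list n x ∧ s'.reg 19 = s.word n x (s.list n x) ∧ Found n s' x (y + 1)) ∧
      Runs w 30 scanInner s (PMF.pure s') := by
  have hr : Runs w 30 scanInner s (PMF.pure (scanInner.eval w s)) :=
    (Prog.Simple.runs (by simp [scanInner, Prog.Simple, Prog.block, skip]) s).mono
      (by simp [scanInner, Prog.block, Prog.cost, skip])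
  refine ⟨_, ?_, hr⟩
  obtain ⟨r0, r1, r2, r3, r5⟩ := hc
  have hy := hlist y (by omega)
  have hxl := hlist x hx
  have b1 : (2 * n) ^ 2 + y < 2 ^ w := by omega
  have b2 : y * (2 * n) + s.mem ((2 * n) ^ 2 + y) < 2 ^ w := by
    simp only [State.list] at hy
    nlinarith
  have b3 : y * (2 * n) < 2 ^ w := by omega
  have b4 : y + 1 < 2 ^ w := by omega
  have b5 : x < 2 ^ w := by omega
  have b6 : y < 2 ^ w := by omega
  have b7 : 1 < 2 ^ w := by omega
  have b8 : 0 < 2 ^ w := by omega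
  have b9 : s.list n x < 2 ^ w := by omega
  obtain ⟨q, hq⟩ : ∃ q, q = s.list n x := ⟨_, rfl⟩
  obtain ⟨c, hcc⟩ : ∃ c, c = s.word n x (s.list n x) := ⟨_, rfl⟩
  obtain ⟨p, hp⟩ : ∃ p, s.mem ((2 * n) ^ 2 + y) = p := ⟨_, rfl⟩
  obtain ⟨d, hd⟩ : ∃ d, s.mem (y * (2 * n) + p) = d := ⟨_, rfl⟩
  have b10 : p < 2 ^ w := hp ▸ hmem _
  have b11 : d < 2 ^ w := hd ▸ hmem _
  rw [hp] at b2
  have hpl : s.list n y = p := hp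
  have hhit : Hit n s x y ↔ q < x ∧ p < y ∧ c = d := by
    unfold Hit
    rw [← hcc, ← hq, State.word, show s.list n y = p from hp, hd]
    tauto
  rw [← hq] at h17 b9 ⊢
  rw [← hcc] at h19
  rw [← hq] at hcc
  rw [← hcc]
  obtain ⟨s', hs'⟩ : ∃ s', s' = scanInner.eval w s := ⟨_, rfl⟩
  rw [← hs']
  by_cases hh : q < x ∧ p < y ∧ c = d
  · obtain ⟨c1, c2, c3⟩ := hh
    have c4 : ¬ c < d := by omega
    have c5 : ¬ d < c := by omega
    simp [scanInner, Prog.eval, Prog.block, skip, Instr.eval, State.setReg, Function.update_apply,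
      Nat.mod_eq_of_lt, r0, r1, r2, r3, r5, h14, h15, h17, h19, b1, b2, b3, b4, b5, b6, b7, b8, b9,
      b10, b11, hp, hd, c1, c2, c4, c5] at hs'
    refine ⟨⟨?_, ?_, ?_, ?_, ?_⟩, ?_, ?_, ?_, ?_, ?_, ?_⟩
    any_goals (rw [hs'] <;> simp [*]; done)
    refine Found.step_hit (s := s) ?_ (hhit.2 ⟨c1, c2, c3⟩) ?_ ?_ ?_ ?_ ?_
    any_goals (rw [hs'] <;> simp [*])
  · have hnext : ∀ a b, Hit n s a b → Before a b x (y + 1) → Before a b x y := by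
      intro a b hab h
      have : ¬ (a = x ∧ b = y) := by
        rintro ⟨rfl, rfl⟩
        exact hh (hhit.1 hab)
      unfold Before at *
      omega
    have hle : ∀ a b, Before a b x y → Before a b x (y + 1) := by
      intro a b h
      unfold Before at *
      omega
    -- All branches without a hit execute `skip`, which writes register 24; hence they end in the
    -- same state.
    have fin : s' = State.mk (Function.update (Function.update (Function.update (Function.update
        (Function.update s.reg 16 ((2 * n) ^ 2 + y)) 18 p) 20 d) 24 0) 15 (y + 1)) s.mem := by
      by_cases c1 : q < x
      · by_cases c2 : p < y
        · have : c < d ∨ d < c := by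
            have : c ≠ d := fun h => hh ⟨c1, c2, h⟩
            omega
          rcases this with c3 | c3
          · simp [scanInner, Prog.eval, Prog.block, skip, Instr.eval, State.setReg,
              Function.update_apply, Nat.mod_eq_of_lt, r0, r1, r2, r3, r5, h14, h15, h17, h19, b1,
              b2, b3, b4, b6, b10, b11, hp, hd, c1, c2, c3] at hs'
            exact hs'
          · simp [scanInner, Prog.eval, Prog.block, skip, Instr.eval, State.setReg,
              Function.update_apply, Nat.mod_eq_of_lt, r0, r1, r2, r3, r5, h14, h15, h17, h19, b1,
              b2, b3, b4, b6, b10, b11, hp, hd, c1, c2, c3, c3.not_gt] at hs'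
            exact hs'
        · simp [scanInner, Prog.eval, Prog.block, skip, Instr.eval, State.setReg,
              Function.update_apply, Nat.mod_eq_of_lt, r0, r1, r2, r3, r5, h14, h15, h17, h19, b1,
              b2, b3, b4, b6, b10, b11, hp, hd, c1, c2] at hs'
          exact hs'
      · simp [scanInner, Prog.eval, Prog.block, skip, Instr.eval, State.setReg,
              Function.update_apply, Nat.mod_eq_of_lt, r0, r1, r2, r3, r5, h14, h15, h17, h19, b1,
              b2, b3, b4, b6, b10, b11, hp, hd, c1] at hs'
        exact hs'
    clear hs'
    refine ⟨⟨?_, ?_, ?_, ?_, ?_⟩, ?_, ?_, ?_, ?_, ?_, ?_⟩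
    any_goals (rw [fin] <;> simp [*])
    refine Found.step_miss (s := s) ?_ hF hnext hle ?_ ?_ ?_ ?_ ?_
    any_goals (rw [fin] <;> simp [*])

theorem scanOuter_spec {n w x : ℕ} (hW : (2 * n) ^ 2 + 2 * n < 2 ^ w) {s : State}
    (hc : Consts n s) (hmem : ∀ a, s.mem a < 2 ^ w) (hlist : ∀ z < 2 * n, s.list n z < 2 * n)
    (hx : x < 2 * n) (h14 : s.reg 14 = x) (hF : Found n s x 0) :
    ∃ s', (Consts n s' ∧ s'.mem = s.mem ∧ s'.reg 14 = x + 1 ∧ Found n s' (x + 1) 0) ∧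
      Runs w (62 * n + 20) scanOuter s (PMF.pure s') := by
  set p₁ := Prog.block (.add 16 3 14)
      [.load 17 16, .mul 19 14 2, .add 19 19 17, .load 19 19, .const 15 0] with hp₁
  have hr₁ : Runs w 11 p₁ s (PMF.pure (p₁.eval w s)) :=
    (Prog.Simple.runs (by simp [p₁, Prog.Simple, Prog.block]) s).mono
      (by simp [p₁, Prog.block, Prog.cost])
  obtain ⟨r0, r1, r2, r3, r5⟩ := hc
  have hxl := hlist x hx
  have b1 : (2 * n) ^ 2 + x < 2 ^ w := by omega
  obtain ⟨q, hq⟩ : ∃ q, s.mem ((2 * n) ^ 2 + x) = q := ⟨_, rfl⟩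
  obtain ⟨c, hcc⟩ : ∃ c, s.mem (x * (2 * n) + q) = c := ⟨_, rfl⟩
  have hql : s.list n x = q := hq
  have hcw : s.word n x q = c := hcc
  have b2 : x * (2 * n) + q < 2 ^ w := by
    rw [hql] at hxl
    nlinarith
  have b3 : x * (2 * n) < 2 ^ w := by omega
  have b4 : q < 2 ^ w := by omega
  have b5 : c < 2 ^ w := hcc ▸ hmem _
  have b6 : x + 1 < 2 ^ w := by omega
  obtain ⟨s₁, hs₁⟩ : ∃ s₁, s₁ = p₁.eval w s := ⟨_, rfl⟩
  rw [← hs₁] at hr₁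
  simp [p₁, Prog.eval, Prog.block, Instr.eval, State.setReg, Nat.mod_eq_of_lt, r2, r3, h14, b1, b2,
    b3, b4, b5, hq, hcc] at hs₁
  have m₁ : s₁.mem = s.mem := by rw [hs₁]
  have hF₁ : Found n s₁ x 0 := by
    refine hF.step_miss m₁ (fun _ _ _ h => h) (fun _ _ h => h) ?_ ?_ ?_ ?_ ?_ <;> simp [hs₁]
  have hc₁ : Consts n s₁ := by
    refine ⟨?_, ?_, ?_, ?_, ?_⟩ <;> simp [hs₁, *]
  have hl : ∀ t : State, t.mem = s.mem → t.list n = s.list n := by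
    intro t ht; funext z; rw [State.list, State.list, ht]
  have hw : ∀ t : State, t.mem = s.mem → t.word n = s.word n := by
    intro t ht; funext y z; rw [State.word, State.word, ht]
  obtain ⟨s₂, ⟨hc₂, m₂, k14, -, -, -, hF₂⟩, hr₂⟩ := Runs.loop_count (w := w) (T := 30) (a := 15)
    (b := 14) (p := scanInner) (N := x) (s := s₁)
    (fun y t => Consts n t ∧ t.mem = s.mem ∧ t.reg 14 = x ∧ t.reg 15 = y ∧
      t.reg 17 = s.list n x ∧ t.reg 19 = s.word n x (s.list n x) ∧ Found n t x y)
    (by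
      rintro y hy t ⟨hct, mt, t14, t15, t17, t19, hFt⟩
      refine ⟨by rw [t14, t15]; exact hy, ?_⟩
      obtain ⟨t', ⟨a1, a2, a3, a4, a5, a6, a7⟩, hr⟩ := scanInner_spec hW hct
        (by rwa [mt]) (by rwa [hl t mt]) hy hx t14 t15 (by rw [t17, hl t mt])
        (by rw [t19, hw t mt, hl t mt]) hFt
      exact ⟨t', ⟨a1, a2.trans mt, a3, a4, by rw [a5, hl t mt], by rw [a6, hw t mt, hl t mt], a7⟩,
        hr⟩)
    (by
      rintro t ⟨-, -, t14, t15, -⟩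
      rw [t14, t15]
      exact lt_irrefl _)
    (by
      refine ⟨hc₁, m₁, ?_, ?_, ?_, ?_, hF₁⟩ <;> simp [hs₁, *])
  have hr₃ := Runs.op w (.add 14 14 1) s₂
  obtain ⟨s₃, hs₃⟩ : ∃ s₃, s₃ = s₂.setReg w 14 (s₂.reg 14 + s₂.reg 1) := ⟨_, rfl⟩
  rw [Instr.exec, ← hs₃] at hr₃
  simp [State.setReg, Nat.mod_eq_of_lt, k14, hc₂.r1, b6] at hs₃
  have m₃ : s₃.mem = s₂.mem := by rw [hs₃]
  refine ⟨s₃, ⟨?_, m₃.trans m₂, ?_, ?_⟩, ((hr₁.seq_pure (hr₂.seq_pure hr₃))).mono ?_⟩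
  · obtain ⟨r0, r1, r2, r3, r5⟩ := hc₂
    refine ⟨?_, ?_, ?_, ?_, ?_⟩ <;> simp [hs₃, *]
  · simp [hs₃]
  · refine hF₂.step_miss m₃ ?_ ?_ ?_ ?_ ?_ ?_ ?_
    · intro a b hab h
      have := hab.1
      unfold Before at *
      omega
    · intro a b h
      unfold Before at *
      omega
    all_goals simp [hs₃]
  · omega

/-- A bound for the time of the search for the greatest flaw. -/
def scanTime (n : ℕ) : ℕ := 2 * n * (62 * n + 20 + 1) + 10

theorem scan_spec {n w : ℕ} (hW : (2 * n) ^ 2 + 2 * n < 2 ^ w) {s : State}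
    (hc : Consts n s) (hmem : ∀ a, s.mem a < 2 ^ w) (hlist : ∀ z < 2 * n, s.list n z < 2 * n) :
    ∃ s', (Consts n s' ∧ s'.mem = s.mem ∧ Found n s' (2 * n) 0) ∧
      Runs w (scanTime n) scan s (PMF.pure s') := by
  set p₁ := Prog.block (.const 4 0) [.const 14 0] with hp₁
  have hr₁ : Runs w 3 p₁ s (PMF.pure (p₁.eval w s)) :=
    (Prog.Simple.runs (by simp [p₁, Prog.Simple, Prog.block]) s).mono
      (by simp [p₁, Prog.block, Prog.cost])
  obtain ⟨r0, r1, r2, r3, r5⟩ := hc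
  obtain ⟨s₁, hs₁⟩ : ∃ s₁, s₁ = p₁.eval w s := ⟨_, rfl⟩
  rw [← hs₁] at hr₁
  simp [p₁, Prog.eval, Prog.block, Instr.eval, State.setReg] at hs₁
  have m₁ : s₁.mem = s.mem := by rw [hs₁]
  have hc₁ : Consts n s₁ := by
    refine ⟨?_, ?_, ?_, ?_, ?_⟩ <;> simp [hs₁, *]
  have hl : ∀ t : State, t.mem = s.mem → t.list n = s.list n := by
    intro t ht; funext z; rw [State.list, State.list, ht]
  obtain ⟨s₂, ⟨hc₂, m₂, -, hF₂⟩, hr₂⟩ := Runs.loop_count (w := w) (T := 62 * n + 20) (a := 14)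
    (b := 2) (p := scanOuter) (N := 2 * n) (s := s₁)
    (fun x t => Consts n t ∧ t.mem = s.mem ∧ t.reg 14 = x ∧ Found n t x 0)
    (by
      rintro x hx t ⟨hct, mt, t14, hFt⟩
      refine ⟨by rw [t14, hct.r2]; exact hx, ?_⟩
      obtain ⟨t', ⟨a1, a2, a3, a4⟩, hr⟩ := scanOuter_spec hW hct
        (by rwa [mt]) (by rwa [hl t mt]) hx t14 hFt
      exact ⟨t', ⟨a1, a2.trans mt, a3, a4⟩, hr⟩)
    (by
      rintro t ⟨hct, -, t14, -⟩
      rw [t14, hct.r2]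
      exact lt_irrefl _)
    (by
      refine ⟨hc₁, m₁, by simp [hs₁], Or.inl ⟨by simp [hs₁], ?_⟩⟩
      intro a b h
      unfold Before at h
      omega)
  refine ⟨s₂, ⟨hc₂, m₂, hF₂⟩, (hr₁.seq_pure hr₂).mono ?_⟩
  unfold scanTime
  omega

/-! ## Choosing a vertex -/

/-- Register 22 counts the vertices below x that still have a partner. As soon as the count exceeds
j, register `d` holds the wanted vertex and is no longer changed. -/
theorem pickBody_spec {n w d x j : ℕ} (hd : 6 ≤ d ∧ d ≤ 13)
    (hW : (2 * n) ^ 2 + 2 * n < 2 ^ w) {s : State}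
    (hc : Consts n s) (hmem : ∀ a, s.mem a < 2 ^ w)
    (hx : x < 2 * n) (h14 : s.reg 14 = x)
    (h21 : s.reg 21 = j + 1)
    (h22 : s.reg 22 = Nat.count (fun z => s.list n z < 2 * n) x)
    (hsel : j < Nat.count (fun z => s.list n z < 2 * n) x → s.list n (s.reg d) < 2 * n ∧
      s.reg d < 2 * n ∧ Nat.count (fun z => s.list n z < 2 * n) (s.reg d) = j) :
    ∃ s', (Consts n s' ∧ s'.mem = s.mem ∧ (∀ r, 6 ≤ r → r ≤ 13 → r ≠ d → s'.reg r = s.reg r) ∧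
      s'.reg 14 = x + 1 ∧ s'.reg 21 = j + 1 ∧
      s'.reg 22 = Nat.count (fun z => s.list n z < 2 * n) (x + 1) ∧
      (j < Nat.count (fun z => s.list n z < 2 * n) (x + 1) → s.list n (s'.reg d) < 2 * n ∧
        s'.reg d < 2 * n ∧ Nat.count (fun z => s.list n z < 2 * n) (s'.reg d) = j)) ∧
      Runs w 20 (pickBody d) s (PMF.pure s') := by
  have hr : Runs w 20 (pickBody d) s (PMF.pure ((pickBody d).eval w s)) :=
    (Prog.Simple.runs (by simp [pickBody, Prog.Simple, Prog.block, skip]) s).mono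
      (by simp [pickBody, Prog.block, Prog.cost, skip])
  refine ⟨_, ?_, hr⟩
  obtain ⟨r0, r1, r2, r3, r5⟩ := hc
  obtain ⟨q, hq⟩ : ∃ q, s.mem ((2 * n) ^ 2 + x) = q := ⟨_, rfl⟩
  have hql : s.list n x = q := hq
  have hcount : Nat.count (fun z => s.list n z < 2 * n) (x + 1) =
      Nat.count (fun z => s.list n z < 2 * n) x + if q < 2 * n then 1 else 0 := by
    rw [Nat.count_succ]
    simp only [hql]
  have hcx : Nat.count (fun z => s.list n z < 2 * n) x ≤ x := Nat.count_le _
  rw [hcount]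
  generalize hk : Nat.count (fun z => s.list n z < 2 * n) x = k at *
  have b1 : (2 * n) ^ 2 + x < 2 ^ w := by omega
  have b2 : q < 2 ^ w := hq ▸ hmem _
  have b3 : x + 1 < 2 ^ w := by omega
  have b4 : k + 1 < 2 ^ w := by omega
  have b5 : x < 2 ^ w := by omega
  have d1 : (1 : ℕ) ≠ d := by omega
  have d2 : (22 : ℕ) ≠ d := by omega
  have d3 : (14 : ℕ) ≠ d := by omega
  have d4 : (0 : ℕ) ≠ d := by omega
  have d5 : (2 : ℕ) ≠ d := by omega
  have d6 : (3 : ℕ) ≠ d := by omega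
  have d7 : (5 : ℕ) ≠ d := by omega
  have d8 : (21 : ℕ) ≠ d := by omega
  have d9 : (16 : ℕ) ≠ d := by omega
  have d10 : (17 : ℕ) ≠ d := by omega
  have d11 : (24 : ℕ) ≠ d := by omega
  obtain ⟨s', hs'⟩ : ∃ s', s' = (pickBody d).eval w s := ⟨_, rfl⟩
  rw [← hs']
  have hfix : ∀ r, 6 ≤ r → r ≤ 13 → r ≠ 16 ∧ r ≠ 17 ∧ r ≠ 22 ∧ r ≠ 14 ∧ r ≠ 24 := by
    intro r _ _
    omega
  by_cases c1 : q < 2 * n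
  · by_cases c2 : k < j + 1
    · simp [pickBody, Prog.eval, Prog.block, skip, Instr.eval, State.setReg, Nat.mod_eq_of_lt, r1,
        r2, r3, r5, h14, h21, h22, hq, b1, b2, b3, b4, b5, c1, c2, d1, d2, d3] at hs'
      refine ⟨⟨?_, ?_, ?_, ?_, ?_⟩, ?_, ?_, ?_, ?_, ?_, ?_⟩
      · simp [hs', *]
      · simp [hs', *]
      · simp [hs', *]
      · simp [hs', *]
      · simp [hs', *]
      · simp [hs']
      · intro r h1 h2 h3
        obtain ⟨e1, e2, e3, e4, e5⟩ := hfix r h1 h2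
        simp [hs', *]
      · simp [hs']
      · simp [hs', *]
      · simp [hs', *]
      · intro h
        have hjk : k = j := by simp [c1] at h; omega
        have : s'.reg d = x := by simp [hs', d2.symm, d3.symm]
        rw [this, hql, hk]
        exact ⟨c1, hx, hjk⟩
    · simp [pickBody, Prog.eval, Prog.block, skip, Instr.eval, State.setReg, Nat.mod_eq_of_lt, r1,
        r2, r3, r5, h14, h21, h22, hq, b1, b2, b3, b4, b5, c1, c2, d1, d2, d3] at hs'
      refine ⟨⟨?_, ?_, ?_, ?_, ?_⟩, ?_, ?_, ?_, ?_, ?_, ?_⟩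
      · simp [hs', *]
      · simp [hs', *]
      · simp [hs', *]
      · simp [hs', *]
      · simp [hs', *]
      · simp [hs']
      · intro r h1 h2 h3
        obtain ⟨e1, e2, e3, e4, e5⟩ := hfix r h1 h2
        simp [hs', *]
      · simp [hs']
      · simp [hs', *]
      · simp [hs', *]
      · intro h
        have : s'.reg d = s.reg d := by
          simp [hs', d2.symm, d3.symm, d9.symm, d10.symm, d11.symm]
        rw [this]
        exact hsel (by omega)
  · simp [pickBody, Prog.eval, Prog.block, skip, Instr.eval, State.setReg, Nat.mod_eq_of_lt, r1,
        r2, r3, r5, h14, h21, h22, hq, b1, b2, b3, b4, b5, c1, d1, d2, d3] at hs'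
    refine ⟨⟨?_, ?_, ?_, ?_, ?_⟩, ?_, ?_, ?_, ?_, ?_, ?_⟩
    · simp [hs', *]
    · simp [hs', *]
    · simp [hs', *]
    · simp [hs', *]
    · simp [hs', *]
    · simp [hs']
    · intro r h1 h2 h3
      obtain ⟨e1, e2, e3, e4, e5⟩ := hfix r h1 h2
      simp [hs', *]
    · simp [hs']
    · simp [hs', *]
    · simp [hs', *]
    · intro h
      have : s'.reg d = s.reg d := by
        simp [hs', d2.symm, d3.symm, d9.symm, d10.symm, d11.symm]
      rw [this]
      rw [if_neg c1] at h
      exact hsel h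

theorem pick_spec {n w d j : ℕ} (hd : 6 ≤ d ∧ d ≤ 13)
    (hW : (2 * n) ^ 2 + 2 * n < 2 ^ w) {s : State}
    (hc : Consts n s) (hmem : ∀ a, s.mem a < 2 ^ w) (h21 : s.reg 21 = j) (hj : j < 2 * n) :
    ∃ s', (Consts n s' ∧ s'.mem = s.mem ∧ (∀ r, 6 ≤ r → r ≤ 13 → r ≠ d → s'.reg r = s.reg r) ∧
      (j < Nat.count (fun z => s.list n z < 2 * n) (2 * n) → s.list n (s'.reg d) < 2 * n ∧
        s'.reg d < 2 * n ∧ Nat.count (fun z => s.list n z < 2 * n) (s'.reg d) = j)) ∧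
      Runs w (42 * n + 10) (pick d) s (PMF.pure s') := by
  set p₁ := Prog.block (.add 21 21 1) [.const 14 0, .const 22 0, .const d 0] with hp₁
  have hr₁ : Runs w 7 p₁ s (PMF.pure (p₁.eval w s)) :=
    (Prog.Simple.runs (by simp [p₁, Prog.Simple, Prog.block]) s).mono
      (by simp [p₁, Prog.block, Prog.cost])
  obtain ⟨r0, r1, r2, r3, r5⟩ := hc
  obtain ⟨s₁, hs₁⟩ : ∃ s₁, s₁ = p₁.eval w s := ⟨_, rfl⟩
  rw [← hs₁] at hr₁
  have b1 : j + 1 < 2 ^ w := by omega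
  simp [p₁, Prog.eval, Prog.block, Instr.eval, State.setReg, r1, h21, Nat.mod_eq_of_lt, b1] at hs₁
  have m₁ : s₁.mem = s.mem := by rw [hs₁]
  have hfix : ∀ r, r ≠ 14 → r ≠ 21 → r ≠ 22 → r ≠ d → s₁.reg r = s.reg r := by
    intro r _ _ _ _
    simp [hs₁, *]
  have hc₁ : Consts n s₁ := by
    refine ⟨?_, ?_, ?_, ?_, ?_⟩ <;> rw [hfix _ (by omega) (by omega) (by omega) (by omega)] <;>
      assumption
  have hl : ∀ t : State, t.mem = s.mem → t.list n = s.list n := by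
    intro t ht; funext z; rw [State.list, State.list, ht]
  obtain ⟨s₂, ⟨hc₂, m₂, f₂, -, -, -, sel₂⟩, hr₂⟩ := Runs.loop_count (w := w) (T := 20) (a := 14)
    (b := 2) (p := pickBody d) (N := 2 * n) (s := s₁)
    (fun x t => Consts n t ∧ t.mem = s.mem ∧
      (∀ r, 6 ≤ r → r ≤ 13 → r ≠ d → t.reg r = s.reg r) ∧ t.reg 14 = x ∧ t.reg 21 = j + 1 ∧
      t.reg 22 = Nat.count (fun z => s.list n z < 2 * n) x ∧
      (j < Nat.count (fun z => s.list n z < 2 * n) x → s.list n (t.reg d) < 2 * n ∧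
        t.reg d < 2 * n ∧ Nat.count (fun z => s.list n z < 2 * n) (t.reg d) = j))
    (by
      rintro x hx t ⟨hct, mt, ft, t14, t21, t22, selt⟩
      refine ⟨by rw [t14, hct.r2]; exact hx, ?_⟩
      obtain ⟨t', ⟨a1, a2, a3, a4, a5, a6, a7⟩, hr⟩ := pickBody_spec (j := j) hd hW hct
        (by rwa [mt]) hx t14 t21 (by simpa only [hl t mt] using t22)
        (by simpa only [hl t mt] using selt)
      refine ⟨t', ⟨a1, a2.trans mt, ?_, a4, a5, by simpa only [hl t mt] using a6,
        by simpa only [hl t mt] using a7⟩, hr⟩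
      intro r h1 h2 h3
      rw [a3 r h1 h2 h3, ft r h1 h2 h3])
    (by
      rintro t ⟨hct, -, -, t14, -⟩
      rw [t14, hct.r2]
      exact lt_irrefl _)
    (by
      refine ⟨hc₁, m₁, fun r _ _ _ => hfix r (by omega) (by omega) (by omega) (by omega), ?_, ?_,
        ?_, ?_⟩
      · have : (14 : ℕ) ≠ d := by omega
        simp [hs₁, this]
      · have : (21 : ℕ) ≠ d := by omega
        simp [hs₁, this]
      · have : (22 : ℕ) ≠ d := by omega
        simp [hs₁, this]
      · simp)
  refine ⟨s₂, ⟨hc₂, m₂, f₂, sel₂⟩, (hr₁.seq_pure hr₂).mono ?_⟩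
  omega

/-! ## The head of the main loop -/

/-- What the memory contains at the head of the main loop. -/
structure Head (w : ℕ) {n : ℕ} (col : Coloring n) (s : State) (M : PM n) : Prop where
  consts : Consts n s
  mem_lt : ∀ a, s.mem a < 2 ^ w
  mem_eq : ∀ a < (2 * n) ^ 2, s.mem a = (input n col).mem a
  holds : Holds s M
  found : Found n s (2 * n) 0

variable {n w : ℕ} {col : Coloring n}

theorem Holds.list_eq {s : State} {M : PM n} (h : Holds s M) (u : Fin (2 * n)) :
    s.list n u = partner M u :=
  (h u (partner M u)).1 (adj_partner M u)

theorem holds_iff {s : State} {M : PM n} :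
    Holds s M ↔ ∀ u : Fin (2 * n), s.list n u = partner M u := by
  refine ⟨fun h => h.list_eq, fun h u v => ?_⟩
  rw [adj_iff, Fin.ext_iff, ← h u]
  rfl

theorem word_eq {s : State} (h : ∀ a < (2 * n) ^ 2, s.mem a = (input n col).mem a)
    (u v : Fin (2 * n)) : s.word n u v = clr col u v := by
  have hu := u.2
  have hv := v.2
  have h1 : ((u : ℕ) * (2 * n) + v) / (2 * n) = u := by
    rw [mul_comm, Nat.mul_add_div (by omega), Nat.div_eq_of_lt hv, add_zero]
  have h2 : ((u : ℕ) * (2 * n) + v) % (2 * n) = v := by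
    rw [mul_comm, Nat.mul_add_mod, Nat.mod_eq_of_lt hv]
  rw [State.word, h _ (by nlinarith)]
  simp only [input, clr, h1, h2]
  by_cases huv : u = v
  · simp [huv]
  · have : (u : ℕ) ≠ v := fun h => huv (Fin.ext h)
    rw [dif_pos ⟨hu, hv, this⟩, dif_pos huv]

theorem hit_iff {s : State} {M : PM n} (h : ∀ a < (2 * n) ^ 2, s.mem a = (input n col).mem a)
    (hM : Holds s M) {x y : ℕ} (hx : x < 2 * n) :
    Hit n s x y ↔ ∃ f : Flaw col, f.Present M ∧ f.v₁ = x ∧ f.v₃ = y := by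
  constructor
  · rintro ⟨h1, h2, h3, h4⟩
    obtain ⟨a, rfl⟩ : ∃ a : Fin (2 * n), (a : ℕ) = x := ⟨⟨x, hx⟩, rfl⟩
    obtain ⟨b, rfl⟩ : ∃ b : Fin (2 * n), (b : ℕ) = y := ⟨⟨y, by omega⟩, rfl⟩
    rw [hM.list_eq] at h2 h3 h4
    rw [hM.list_eq, word_eq h, word_eq h] at h4
    obtain ⟨f, hf, rfl, rfl⟩ := exists_flaw_of (col := col) (M := M) (a := a) (b := b) h2 h3 h1 h4
    exact ⟨f, hf, rfl, rfl⟩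
  · rintro ⟨f, hf, rfl, rfl⟩
    have hp := hf.partner_eq
    unfold Hit
    rw [hM.list_eq, hM.list_eq, word_eq h, word_eq h, hp.1, hp.2.2.1]
    exact ⟨f.lt₃₁, f.lt₂₁, f.lt₄₃, f.clr_same⟩

/-- The flag in register 4 decides the loop test. A flaw of higher rank than the one stored would
have the same (v₁, v₃), the scan having found the greatest pair, and would be the same flaw. -/
theorem Head.cases {s : State} {M : PM n} (h : Head w col s M) :
    (s.reg 4 = 0 ∧ Rainbow col M) ∨
      (s.reg 4 = 1 ∧ ∃ f : Flaw col, IsTop f M ∧ s.reg 6 = f.v₁ ∧ s.reg 7 = f.v₂ ∧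
        s.reg 8 = f.v₃ ∧ s.reg 9 = f.v₄) := by
  rcases h.found with ⟨h4, hF⟩ | ⟨h4, a, b, hab, hit, h6, h7, h8, h9, hF⟩
  · refine Or.inl ⟨h4, (rainbow_iff M).2 fun f hf => ?_⟩
    exact hF f.v₁ f.v₃ (Or.inl f.v₁.2) ((hit_iff h.mem_eq h.holds f.v₁.2).2 ⟨f, hf, rfl, rfl⟩)
  · have ha : a < 2 * n := by unfold Before at hab; omega
    obtain ⟨f, hf, rfl, rfl⟩ := (hit_iff h.mem_eq h.holds ha).1 hit
    have hp := hf.partner_eq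
    refine Or.inr ⟨h4, f, ⟨hf, ?_⟩, h6, ?_, h8, ?_⟩
    · intro g hg
      have h1 := hF g.v₁ g.v₃ (Or.inl g.v₁.2)
        ((hit_iff h.mem_eq h.holds g.v₁.2).2 ⟨g, hg, rfl, rfl⟩)
      by_contra hlt
      push Not at hlt
      have h2 := Flaw.key_le_of_rank_le hlt.le
      have h3 := g.v₃.2
      have h4 := f.v₃.2
      unfold Before at h1
      push Not at h1
      rcases lt_or_eq_of_le h1.1 with h5 | h5
      · nlinarith
      · have h6 := h1.2 h5.symm
        have e1 : f.v₁ = g.v₁ := Fin.ext h5.symm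
        have e3 : f.v₃ = g.v₃ := by
          rw [h5] at h2
          exact Fin.ext (by omega)
        have hq := hg.partner_eq
        have : f = g := Flaw.ext e1 (by rw [← hp.1, ← hq.1, e1]) e3
          (by rw [← hp.2.2.1, ← hq.2.2.1, e3])
        rw [this] at hlt
        exact lt_irrefl _ hlt
    · rw [h7, h.holds.list_eq, hp.1]
    · rw [h9, h.holds.list_eq, hp.2.2.1]

theorem scan_head (hW : (2 * n) ^ 2 + 2 * n < 2 ^ w) {s : State} {M : PM n} (hc : Consts n s)
    (hmem : ∀ a, s.mem a < 2 ^ w) (hinp : ∀ a < (2 * n) ^ 2, s.mem a = (input n col).mem a)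
    (hM : Holds s M) : ∃ s', Head w col s' M ∧ Runs w (scanTime n) scan s (PMF.pure s') := by
  obtain ⟨s', ⟨hc', hm', hF⟩, hr⟩ := scan_spec hW hc hmem (fun z hz => by
    have := hM.list_eq ⟨z, hz⟩
    simp only at this
    rw [this]
    exact (partner M ⟨z, hz⟩).2)
  refine ⟨s', ⟨hc', by rwa [hm'], by rwa [hm'], ?_, hF⟩, hr⟩
  unfold Holds at *
  rwa [hm']

/-! ## Initialisation -/

theorem input_lt (hcol : ∀ e, col e < 2 ^ w) (a : ℕ) : (input n col).mem a < 2 ^ w := by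
  simp only [input]
  split_ifs
  · exact hcol _
  · positivity

theorem fillBody_spec (hW : (2 * n) ^ 2 + 2 * n < 2 ^ w) {s : State} {i : ℕ} (hi : i < 2 * n)
    (hc : Consts n s) (hmem : ∀ a, s.mem a < 2 ^ w) (h14 : s.reg 14 = i) :
    ∃ s', (Consts n s' ∧ (∀ a, s'.mem a < 2 ^ w) ∧ s'.reg 14 = i + 1 ∧
      (∀ a, s'.mem a = if a = (2 * n) ^ 2 + i then 2 * n - 1 - i else s.mem a)) ∧
      Runs w 9 fillBody s (PMF.pure s') := by
  have hr : Runs w 9 fillBody s (PMF.pure (fillBody.eval w s)) :=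
    (Prog.Simple.runs (by simp [fillBody, Prog.Simple, Prog.block]) s).mono
      (by simp [fillBody, Prog.block, Prog.cost])
  refine ⟨_, ?_, hr⟩
  obtain ⟨r0, r1, r2, r3, r5⟩ := hc
  have b1 : (2 * n) ^ 2 + i < 2 ^ w := by omega
  have b2 : 2 * n - 1 < 2 ^ w := by omega
  have b3 : 2 * n - 1 - i < 2 ^ w := by omega
  have b4 : i + 1 < 2 ^ w := by omega
  obtain ⟨s', hs'⟩ : ∃ s', s' = fillBody.eval w s := ⟨_, rfl⟩
  rw [← hs']
  simp [fillBody, Prog.eval, Prog.block, Instr.eval, State.setReg, Nat.mod_eq_of_lt, r1, r2, r3,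
    h14, b1, b2, b3, b4] at hs'
  have hm : ∀ a, s'.mem a = if a = (2 * n) ^ 2 + i then 2 * n - 1 - i else s.mem a := by
    intro a
    simp [hs', Function.update_apply]
  refine ⟨⟨?_, ?_, ?_, ?_, ?_⟩, ?_, ?_, hm⟩
  any_goals (simp [hs', *]; done)
  intro a
  rw [hm]
  split_ifs
  · exact b3
  · exact hmem a

/-- A bound for the time of the initialisation. -/
def initTime (n : ℕ) : ℕ := 20 * n + scanTime n + 20

theorem init_spec (hn : 1 ≤ n) (hW : (2 * n) ^ 2 + 2 * n < 2 ^ w) (hcol : ∀ e, col e < 2 ^ w) :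
    ∃ s' M, Head w col s' M ∧ Runs w (initTime n) initProg (input n col) (PMF.pure s') := by
  set p₁ := Prog.block (.const 1 1) [.const 5 0, .add 2 0 0, .mul 3 2 2, .const 14 0] with hp₁
  have hr₁ : Runs w 9 p₁ (input n col) (PMF.pure (p₁.eval w (input n col))) :=
    (Prog.Simple.runs (by simp [p₁, Prog.Simple, Prog.block]) _).mono
      (by simp [p₁, Prog.block, Prog.cost])
  obtain ⟨s₁, hs₁⟩ : ∃ s₁, s₁ = p₁.eval w (input n col) := ⟨_, rfl⟩
  rw [← hs₁] at hr₁
  have b1 : 1 < 2 ^ w := by omega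
  have b2 : n + n < 2 ^ w := by omega
  have b3 : (n + n) * (n + n) < 2 ^ w := by nlinarith
  have r0 : (input n col).reg 0 = n := rfl
  simp [p₁, Prog.eval, Prog.block, Instr.eval, State.setReg, r0, Nat.mod_eq_of_lt, b1, b2,
    b3] at hs₁
  have hc₁ : Consts n s₁ := by
    refine ⟨?_, ?_, ?_, ?_, ?_⟩
    · simp [hs₁, r0]
    · simp [hs₁]
    · simp [hs₁]; omega
    · simp [hs₁]; ring
    · simp [hs₁]
  have m₁ : s₁.mem = (input n col).mem := by rw [hs₁]
  obtain ⟨s₂, ⟨hc₂, -, m₂, i₂, l₂⟩, hr₂⟩ := Runs.loop_count (w := w) (T := 9) (a := 14)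
    (b := 2) (p := fillBody) (N := 2 * n) (s := s₁)
    (fun i t => Consts n t ∧ t.reg 14 = i ∧ (∀ a, t.mem a < 2 ^ w) ∧
      (∀ a < (2 * n) ^ 2, t.mem a = (input n col).mem a) ∧
      (∀ z < i, t.list n z = 2 * n - 1 - z))
    (by
      rintro i hi t ⟨hct, t14, mt, it, lt⟩
      refine ⟨by rw [t14, hct.r2]; exact hi, ?_⟩
      obtain ⟨t', ⟨a1, a2, a3, a4⟩, hr⟩ := fillBody_spec hW hi hct mt t14
      refine ⟨t', ⟨a1, a3, a2, ?_, ?_⟩, hr⟩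
      · intro a ha
        rw [a4, if_neg (by omega), it a ha]
      · intro z hz
        rw [State.list, a4]
        split_ifs with h
        · congr 1; omega
        · exact lt z (by omega))
    (by
      rintro t ⟨hct, t14, -⟩
      rw [t14, hct.r2]
      exact lt_irrefl _)
    (by
      refine ⟨hc₁, by simp [hs₁], ?_, ?_, fun z hz => by omega⟩
      · rw [m₁]; exact input_lt hcol
      · rw [m₁]; exact fun _ _ => rfl)
  -- The entries 2n-1-i describe the reversal, which has no fixed point because 2n is even.
  let M : PM n := ofInvolution Fin.rev Fin.rev_rev (fun x h => by
    have := congrArg Fin.val h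
    rw [Fin.val_rev] at this
    omega)
  have hM : Holds s₂ M := by
    rw [holds_iff]
    intro u
    rw [partner_ofInvolution, l₂ _ u.2, Fin.val_rev]
    omega
  obtain ⟨s₃, hh, hr₃⟩ := scan_head hW hc₂ m₂ i₂ hM
  refine ⟨s₃, M, hh, (hr₁.seq_pure (hr₂.seq_pure hr₃)).mono ?_⟩
  unfold initTime
  omega

/-! ## The body of the main loop -/

variable {n w : ℕ} {col : Coloring n}

/-- The edges at the vertices of `S` have been removed from the matching `M`. -/
structure Stage (w : ℕ) {n : ℕ} (col : Coloring n) (s : State) (M : PM n)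
    (S : Finset (Fin (2 * n))) : Prop where
  consts : Consts n s
  mem_lt : ∀ a, s.mem a < 2 ^ w
  mem_eq : ∀ a < (2 * n) ^ 2, s.mem a = (input n col).mem a
  list_eq : ∀ u : Fin (2 * n), s.list n u = if u ∈ S then 2 * n else (partner M u : ℕ)

/-- The number of vertices outside of `S` that are less than `u`. -/
def countOff (S : Finset (Fin (2 * n))) (u : ℕ) : ℕ :=
  (Finset.univ.filter fun z : Fin (2 * n) => z ∉ S ∧ (z : ℕ) < u).card

theorem Stage.count_eq {s : State} {M : PM n} {S : Finset (Fin (2 * n))} (h : Stage w col s M S)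
    {u : ℕ} (hu : u ≤ 2 * n) : Nat.count (fun z => s.list n z < 2 * n) u = countOff S u := by
  rw [Nat.count_eq_card_filter_range, countOff]
  symm
  refine Finset.card_bij (fun z _ => (z : ℕ)) ?_ ?_ ?_
  · intro z hz
    simp only [Finset.mem_filter, Finset.mem_univ, true_and, Finset.mem_range] at hz ⊢
    refine ⟨hz.2, ?_⟩
    rw [h.list_eq, if_neg hz.1]
    exact (partner M z).2
  · intro a _ b _ hab
    exact Fin.ext hab
  · intro z hz
    simp only [Finset.mem_filter, Finset.mem_range] at hz
    have hz2 : z < 2 * n := by omega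
    refine ⟨⟨z, hz2⟩, ?_, rfl⟩
    simp only [Finset.mem_filter, Finset.mem_univ, true_and]
    refine ⟨fun hS => ?_, hz.1⟩
    have := h.list_eq ⟨z, hz2⟩
    rw [if_pos hS] at this
    simp only at this
    omega

theorem countOff_all (S : Finset (Fin (2 * n))) : countOff S (2 * n) = 2 * n - S.card := by
  have : (Finset.univ.filter fun z : Fin (2 * n) => z ∉ S ∧ (z : ℕ) < 2 * n) = Sᶜ := by
    ext z
    simp
  rw [countOff, this, Finset.card_compl, Fintype.card_fin]

/-- The number j is recorded as `countOff S u`; hence different draws give different vertices. -/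
theorem pick_stage {d j : ℕ} (hd : 6 ≤ d ∧ d ≤ 13) (hW : (2 * n) ^ 2 + 2 * n < 2 ^ w) {s : State}
    {M : PM n} {S : Finset (Fin (2 * n))} (h : Stage w col s M S) (h21 : s.reg 21 = j)
    (hj : j + S.card < 2 * n) :
    ∃ s' : State, ∃ u : Fin (2 * n), u ∉ S ∧ countOff S u = j ∧ s'.reg d = u ∧
      (∀ r, 6 ≤ r → r ≤ 13 → r ≠ d → s'.reg r = s.reg r) ∧ Stage w col s' M S ∧
      Runs w (42 * n + 10) (pick d) s (PMF.pure s') := by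
  obtain ⟨s', ⟨hc, hm, hf, hsel⟩, hr⟩ := pick_spec hd hW h.consts h.mem_lt h21 (by omega)
  rw [h.count_eq le_rfl, countOff_all] at hsel
  obtain ⟨h1, h2, h3⟩ := hsel (by omega)
  rw [h.count_eq h2.le] at h3
  refine ⟨s', ⟨s'.reg d, h2⟩, ?_, h3, rfl, hf, ⟨hc, by rw [hm]; exact h.mem_lt,
    by rw [hm]; exact h.mem_eq, ?_⟩, hr⟩
  · intro hS
    have := h.list_eq ⟨s'.reg d, h2⟩
    rw [if_pos hS] at this
    simp only at this
    omega
  · intro u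
    rw [State.list, hm]
    exact h.list_eq u

theorem cutFlaw_spec (hn : 4 ≤ n) (hW : (2 * n) ^ 2 + 2 * n < 2 ^ w) {s : State} {M : PM n}
    (h : Head w col s M) {f : Flaw col} (h6 : s.reg 6 = f.v₁) (h7 : s.reg 7 = f.v₂)
    (h8 : s.reg 8 = f.v₃) (h9 : s.reg 9 = f.v₄) :
    ∃ s', (Stage w col s' M {f.v₁, f.v₂, f.v₃, f.v₄} ∧ s'.reg 23 = 2 * n - 5 ∧
      ∀ r, 6 ≤ r → r ≤ 13 → s'.reg r = s.reg r) ∧ Runs w 19 cutFlaw s (PMF.pure s') := by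
  have hr : Runs w 19 cutFlaw s (PMF.pure (cutFlaw.eval w s)) :=
    (Prog.Simple.runs (by simp [cutFlaw, Prog.Simple, Prog.block]) s).mono
      (by simp [cutFlaw, Prog.block, Prog.cost])
  refine ⟨_, ?_, hr⟩
  obtain ⟨r0, r1, r2, r3, r5⟩ := h.consts
  have b1 : (2 * n) ^ 2 + f.v₁ < 2 ^ w := by have := f.v₁.2; omega
  have b2 : (2 * n) ^ 2 + f.v₂ < 2 ^ w := by have := f.v₂.2; omega
  have b3 : (2 * n) ^ 2 + f.v₃ < 2 ^ w := by have := f.v₃.2; omega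
  have b4 : (2 * n) ^ 2 + f.v₄ < 2 ^ w := by have := f.v₄.2; omega
  have b5 : 5 < 2 ^ w := by omega
  have b6 : 2 * n - 5 < 2 ^ w := by omega
  obtain ⟨s', hs'⟩ : ∃ s', s' = cutFlaw.eval w s := ⟨_, rfl⟩
  rw [← hs']
  simp [cutFlaw, Prog.eval, Prog.block, Instr.eval, State.setReg, Nat.mod_eq_of_lt, r2, r3,
    h6, h7, h8, h9, b1, b2, b3, b4, b5, b6] at hs'
  have hm : ∀ a, s'.mem a = if a = (2 * n) ^ 2 + f.v₁ ∨ a = (2 * n) ^ 2 + f.v₂ ∨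
      a = (2 * n) ^ 2 + f.v₃ ∨ a = (2 * n) ^ 2 + f.v₄ then 2 * n else s.mem a := by
    intro a
    simp only [hs', Function.update_apply]
    split_ifs <;> first | rfl | tauto
  refine ⟨⟨⟨?_, ?_, ?_, ?_, ?_⟩, ?_, ?_, ?_⟩, ?_, ?_⟩
  any_goals (simp [hs', *]; done)
  · intro a
    rw [hm]
    split_ifs
    · omega
    · exact h.mem_lt a
  · intro a ha
    rw [hm, if_neg (by omega), h.mem_eq a ha]
  · intro u
    rw [State.list, hm]
    simp only [Nat.add_left_cancel_iff, Finset.mem_insert, Finset.mem_singleton, Fin.val_inj]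
    split_ifs
    · rfl
    · exact h.holds.list_eq u
  · intro r h1 h2
    have e1 : r ≠ 16 := by omega
    have e2 : r ≠ 23 := by omega
    simp [hs', e1, e2]

theorem cutEdge_spec (hn : 4 ≤ n) (hW : (2 * n) ^ 2 + 2 * n < 2 ^ w) {s : State} {M : PM n}
    {S : Finset (Fin (2 * n))} (h : Stage w col s M S) {u : Fin (2 * n)} (hu : u ∉ S)
    (h10 : s.reg 10 = u) :
    ∃ s', (Stage w col s' M (insert u (insert (partner M u) S)) ∧ s'.reg 23 = 2 * n - 7 ∧
      s'.reg 11 = partner M u ∧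
      ∀ r, 6 ≤ r → r ≤ 13 → r ≠ 11 → s'.reg r = s.reg r) ∧
      Runs w 13 cutEdge s (PMF.pure s') := by
  have hr : Runs w 13 cutEdge s (PMF.pure (cutEdge.eval w s)) :=
    (Prog.Simple.runs (by simp [cutEdge, Prog.Simple, Prog.block]) s).mono
      (by simp [cutEdge, Prog.block, Prog.cost])
  refine ⟨_, ?_, hr⟩
  obtain ⟨r0, r1, r2, r3, r5⟩ := h.consts
  have hl : s.mem ((2 * n) ^ 2 + u) = partner M u := by
    have := h.list_eq u
    rwa [if_neg hu] at this
  have b0 := (partner M u).2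
  have b1 : (2 * n) ^ 2 + u < 2 ^ w := by have := u.2; omega
  have b2 : (2 * n) ^ 2 + partner M u < 2 ^ w := by omega
  have b3 : (partner M u : ℕ) < 2 ^ w := by omega
  have b5 : 7 < 2 ^ w := by omega
  have b6 : 2 * n - 7 < 2 ^ w := by omega
  obtain ⟨s', hs'⟩ : ∃ s', s' = cutEdge.eval w s := ⟨_, rfl⟩
  rw [← hs']
  simp [cutEdge, Prog.eval, Prog.block, Instr.eval, State.setReg, Nat.mod_eq_of_lt, r2, r3,
    h10, hl, b1, b2, b3, b5, b6] at hs'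
  have hm : ∀ a, s'.mem a = if a = (2 * n) ^ 2 + u ∨ a = (2 * n) ^ 2 + partner M u
      then 2 * n else s.mem a := by
    intro a
    simp only [hs', Function.update_apply]
    split_ifs <;> first | rfl | tauto
  refine ⟨⟨⟨?_, ?_, ?_, ?_, ?_⟩, ?_, ?_, ?_⟩, ?_, ?_, ?_⟩
  any_goals (simp [hs', *]; done)
  · intro a
    rw [hm]
    split_ifs
    · omega
    · exact h.mem_lt a
  · intro a ha
    rw [hm, if_neg (by omega), h.mem_eq a ha]
  · intro v
    rw [State.list, hm]
    simp only [Nat.add_left_cancel_iff, Finset.mem_insert, Fin.val_inj]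
    have := h.list_eq v
    rw [State.list] at this
    rw [this]
    split_ifs <;> first | rfl | tauto
  · intro r h1 h2 h3
    have e1 : r ≠ 16 := by omega
    have e2 : r ≠ 23 := by omega
    simp [hs', e1, e2, h3]

theorem join_spec (hW : (2 * n) ^ 2 + 2 * n < 2 ^ w) {s : State} {M : PM n}
    {f : Flaw col} {u₁ u₃ : Fin (2 * n)}
    (h : Stage w col s M (insert u₁ (insert (partner M u₁) {f.v₁, f.v₂, f.v₃, f.v₄})))
    (hu : u₃ ∉ (insert u₁ (insert (partner M u₁) {f.v₁, f.v₂, f.v₃, f.v₄}) : Finset _))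
    (h6 : s.reg 6 = f.v₁) (h7 : s.reg 7 = f.v₂) (h8 : s.reg 8 = f.v₃) (h9 : s.reg 9 = f.v₄)
    (h10 : s.reg 10 = u₁) (h11 : s.reg 11 = partner M u₁) (h12 : s.reg 12 = u₃) :
    ∃ s', (Consts n s' ∧ (∀ a, s'.mem a < 2 ^ w) ∧
      (∀ a < (2 * n) ^ 2, s'.mem a = (input n col).mem a) ∧
      ∀ z : Fin (2 * n), s'.list n z = switchFun (partner M) f.v₁ f.v₂ f.v₃ f.v₄ u₁ (partner M u₁)
        u₃ (partner M u₃) z) ∧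
      Runs w 35 join s (PMF.pure s') := by
  have hr : Runs w 35 join s (PMF.pure (join.eval w s)) :=
    (Prog.Simple.runs (by simp [join, Prog.Simple, Prog.block]) s).mono
      (by simp [join, Prog.block, Prog.cost])
  refine ⟨_, ?_, hr⟩
  obtain ⟨r0, r1, r2, r3, r5⟩ := h.consts
  have hl : s.mem ((2 * n) ^ 2 + u₃) = partner M u₃ := by
    have := h.list_eq u₃
    rwa [if_neg hu] at this
  have bound : ∀ u : Fin (2 * n), (2 * n) ^ 2 + u < 2 ^ w := fun u => by have := u.2; omega
  have bound' : ∀ u : Fin (2 * n), (u : ℕ) < 2 ^ w := fun u => by have := u.2; omega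
  obtain ⟨s', hs'⟩ : ∃ s', s' = join.eval w s := ⟨_, rfl⟩
  rw [← hs']
  simp [join, Prog.eval, Prog.block, Instr.eval, State.setReg, Nat.mod_eq_of_lt, r3,
    h6, h7, h8, h9, h10, h11, h12, hl, bound, bound'] at hs'
  have hc : Consts n s' := by
    refine ⟨?_, ?_, ?_, ?_, ?_⟩ <;> simp [hs', *]
  have hlow : ∀ a < (2 * n) ^ 2, s'.mem a = s.mem a := by
    intro a ha
    have : ∀ x, a ≠ (2 * n) ^ 2 + x := fun x => by omega
    simp [hs', Function.update_apply, this]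
  refine ⟨hc, ?_, fun a ha => (hlow a ha).trans (h.mem_eq a ha), ?_⟩
  · intro a
    simp only [hs', Function.update_apply]
    split_ifs <;> first | exact bound' _ | exact h.mem_lt a
  · intro z
    have hz := h.list_eq z
    rw [State.list] at hz ⊢
    simp only [hs', Function.update_apply, Nat.add_left_cancel_iff, Fin.val_inj, hz, switchFun,
      Finset.mem_insert, Finset.mem_singleton]
    by_cases c1 : z = f.v₁
    · rw [if_pos c1, if_pos c1]
    rw [if_neg c1, if_neg c1]
    by_cases c2 : z = u₁
    · rw [if_pos c2, if_pos c2]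
    rw [if_neg c2, if_neg c2]
    by_cases c3 : z = f.v₂
    · rw [if_pos c3, if_pos c3]
    rw [if_neg c3, if_neg c3]
    by_cases c4 : z = partner M u₁
    · rw [if_pos c4, if_pos c4]
    rw [if_neg c4, if_neg c4]
    by_cases c5 : z = f.v₃
    · rw [if_pos c5, if_pos c5]
    rw [if_neg c5, if_neg c5]
    by_cases c6 : z = u₃
    · rw [if_pos c6, if_pos c6]
    rw [if_neg c6, if_neg c6]
    by_cases c7 : z = f.v₄
    · rw [if_pos c7, if_pos c7]
    rw [if_neg c7, if_neg c7]
    by_cases c8 : z = partner M u₃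
    · rw [if_pos c8, if_pos c8]
    rw [if_neg c8, if_neg c8]
    -- The vertex is outside of the removed set, so its entry is still the old partner.
    rw [if_neg (by simp [c1, c2, c3, c4, c5, c7])]

theorem finish_spec (hW : (2 * n) ^ 2 + 2 * n < 2 ^ w) {s : State} {M : PM n}
    {f : Flaw col} (hf : f.Present M) {u₁ : Fin (2 * n)} (hu₁ : f.Off u₁)
    (h : Stage w col s M (insert u₁ (insert (partner M u₁) {f.v₁, f.v₂, f.v₃, f.v₄})))
    (h6 : s.reg 6 = f.v₁) (h7 : s.reg 7 = f.v₂) (h8 : s.reg 8 = f.v₃) (h9 : s.reg 9 = f.v₄)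
    (h10 : s.reg 10 = u₁) (h11 : s.reg 11 = partner M u₁) {j : ℕ} (h21 : s.reg 21 = j)
    (hj : j + 6 < 2 * n) :
    ∃ s' M' u₃, u₃ ∉ (insert u₁ (insert (partner M u₁) {f.v₁, f.v₂, f.v₃, f.v₄}) : Finset _) ∧
      countOff (insert u₁ (insert (partner M u₁) {f.v₁, f.v₂, f.v₃, f.v₄})) u₃ = j ∧
      f.SwitchesTo M u₁ u₃ M' ∧ M' ∈ f.actions M ∧ Head w col s' M' ∧
      Runs w (42 * n + scanTime n + 50) (.seq (pick 12) (.seq join scan)) s (PMF.pure s') := by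
  set S : Finset (Fin (2 * n)) := insert u₁ (insert (partner M u₁) {f.v₁, f.v₂, f.v₃, f.v₄})
    with hS
  have hcard : S.card ≤ 6 := Finset.card_le_six
  obtain ⟨s₁, u₃, hu, hcnt, k12, keep, hst, hr₁⟩ := pick_stage (d := 12) (by omega) hW h h21
    (by omega)
  obtain ⟨s₂, ⟨hc₂, m₂, i₂, l₂⟩, hr₂⟩ := join_spec hW hst hu
    (by rw [keep 6 (by omega) (by omega) (by omega), h6])
    (by rw [keep 7 (by omega) (by omega) (by omega), h7])
    (by rw [keep 8 (by omega) (by omega) (by omega), h8])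
    (by rw [keep 9 (by omega) (by omega) (by omega), h9])
    (by rw [keep 10 (by omega) (by omega) (by omega), h10])
    (by rw [keep 11 (by omega) (by omega) (by omega), h11]) k12
  have hu' := hu
  simp only [hS, Finset.mem_insert, Finset.mem_singleton, not_or] at hu'
  obtain ⟨c1, c2, c3, c4, c5, c6⟩ := hu'
  obtain ⟨M', hM', hp⟩ := Flaw.exists_switch hf hu₁ ⟨c3, c4, c5, c6⟩ c1 c2
  obtain ⟨s₃, hh, hr₃⟩ := scan_head hW hc₂ m₂ i₂ (M := M') (by
    rw [holds_iff]
    intro z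
    rw [l₂, hp])
  refine ⟨s₃, M', u₃, hu, hcnt, ?_, hM', hh, (hr₁.seq_pure (hr₂.seq_pure hr₃)).mono (by omega)⟩
  -- Membership in the actions only provides some choices; the partners of v₁ and v₃ show that they
  -- are u₁ and u₃.
  obtain ⟨t₁, t₃, -, -, -, -, hsw⟩ := Flaw.mem_actions_iff'.1 hM'
  have hpe := hsw.partner_eq
  have e1 : t₁ = u₁ := by rw [← hpe.1, hp]; simp [switchFun]
  have e3 : t₃ = u₃ := by
    have hd := Flaw.nodup hf hu₁ ⟨c3, c4, c5, c6⟩ c1 c2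
    simp only [List.nodup_cons, List.mem_cons, List.not_mem_nil, not_or, or_false] at hd
    rw [← hpe.2.2.1, hp]
    simp only [switchFun]
    grind
  rwa [e1, e3] at hsw

variable {n w : ℕ} {col : Coloring n}

/-! ## A round of the walk -/

theorem State.setReg_reg_of_ne (s : State) (k : ℕ) {d r : ℕ} (h : r ≠ d) :
    (s.setReg w d k).reg r = s.reg r :=
  Function.update_of_ne h _ _

theorem State.setReg_reg_self (s : State) (d k : ℕ) : (s.setReg w d k).reg d = k % 2 ^ w :=
  Function.update_self ..

theorem Stage.setReg {s : State} {M : PM n} {S : Finset (Fin (2 * n))} (h : Stage w col s M S)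
    (k : ℕ) : Stage w col (s.setReg w 21 k) M S := by
  obtain ⟨⟨r0, r1, r2, r3, r5⟩, h1, h2, h3⟩ := h
  refine ⟨⟨?_, ?_, ?_, ?_, ?_⟩, h1, h2, h3⟩ <;> simpa [State.setReg]

/-- The round after the first draw. The vertex u₁ depends on that draw only; the remaining
randomness is the index j. -/
theorem round_of_first (hn : 4 ≤ n) (hW : (2 * n) ^ 2 + 2 * n < 2 ^ w) {s : State} {M : PM n}
    {f : Flaw col} (hf : f.Present M) (h : Stage w col s M {f.v₁, f.v₂, f.v₃, f.v₄})
    (h6 : s.reg 6 = f.v₁) (h7 : s.reg 7 = f.v₂) (h8 : s.reg 8 = f.v₃) (h9 : s.reg 9 = f.v₄)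
    {i : ℕ} (h21 : s.reg 21 = i) (hi : i + 4 < 2 * n) :
    ∃ (u₁ : Fin (2 * n)) (u₃ : Fin (2 * n - 7 + 1) → Fin (2 * n))
      (post : Fin (2 * n - 7 + 1) → State) (mm : Fin (2 * n - 7 + 1) → PM n),
      u₁ ∉ ({f.v₁, f.v₂, f.v₃, f.v₄} : Finset _) ∧
      countOff {f.v₁, f.v₂, f.v₃, f.v₄} u₁ = i ∧
      (∀ j, u₃ j ∉ (insert u₁ (insert (partner M u₁) {f.v₁, f.v₂, f.v₃, f.v₄}) : Finset _) ∧
        countOff (insert u₁ (insert (partner M u₁) {f.v₁, f.v₂, f.v₃, f.v₄})) (u₃ j) = j ∧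
        f.SwitchesTo M u₁ (u₃ j) (mm j) ∧ mm j ∈ f.actions M ∧ Head w col (post j) (mm j)) ∧
      Runs w (84 * n + scanTime n + 90) (.seq (pick 10) (.seq cutEdge
        (.seq (.op (.rand 21 23)) (.seq (pick 12) (.seq join scan))))) s
        ((PMF.uniformOfFintype (Fin (2 * n - 7 + 1))).bind fun j => PMF.pure (post j)) := by
  have hcard : ({f.v₁, f.v₂, f.v₃, f.v₄} : Finset (Fin (2 * n))).card ≤ 4 := Finset.card_le_four
  obtain ⟨s₁, u₁, hu, hcnt, k10, keep, hst, hr₁⟩ := pick_stage (d := 10) (by omega) hW h h21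
    (by omega)
  have hoff : f.Off u₁ := by
    unfold Flaw.Off
    simpa only [Finset.mem_insert, Finset.mem_singleton, not_or] using hu
  obtain ⟨s₂, ⟨hst₂, k23, k11, keep₂⟩, hr₂⟩ := cutEdge_spec hn hW hst hu k10
  have fin : ∀ j : Fin (2 * n - 7 + 1), _ := fun j => finish_spec (j := j) hW hf hoff
    (hst₂.setReg (j : ℕ))
    (by rw [State.setReg_reg_of_ne _ _ (by omega), keep₂ 6 (by omega) (by omega) (by omega),
      keep 6 (by omega) (by omega) (by omega), h6])
    (by rw [State.setReg_reg_of_ne _ _ (by omega), keep₂ 7 (by omega) (by omega) (by omega),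
      keep 7 (by omega) (by omega) (by omega), h7])
    (by rw [State.setReg_reg_of_ne _ _ (by omega), keep₂ 8 (by omega) (by omega) (by omega),
      keep 8 (by omega) (by omega) (by omega), h8])
    (by rw [State.setReg_reg_of_ne _ _ (by omega), keep₂ 9 (by omega) (by omega) (by omega),
      keep 9 (by omega) (by omega) (by omega), h9])
    (by rw [State.setReg_reg_of_ne _ _ (by omega),
      keep₂ 10 (by omega) (by omega) (by omega), k10])
    (by rw [State.setReg_reg_of_ne _ _ (by omega), k11])
    (by
      have := j.2
      rw [State.setReg_reg_self, Nat.mod_eq_of_lt (by omega)])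
    (by have := j.2; omega)
  choose post mm u₃ q1 q2 q3 q4 q5 q6 using fin
  refine ⟨u₁, u₃, post, mm, hu, hcnt, fun j => ⟨q1 j, q2 j, q3 j, q4 j, q5 j⟩, ?_⟩
  exact (hr₁.seq_pure (hr₂.seq_pure (Runs.rand_seq k23 q6))).mono (by omega)

/-- A bound for the time of a round. -/
def bodyTime (n : ℕ) : ℕ := 84 * n + scanTime n + 120

theorem exists_eq_of_injective {S : Finset (Fin (2 * n))} {m : ℕ} {u : Fin m → Fin (2 * n)}
    (hu : ∀ i, u i ∉ S) (hinj : Function.Injective u) (hm : m + S.card = 2 * n) {z : Fin (2 * n)}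
    (hz : z ∉ S) : ∃ i, u i = z := by
  have h : Finset.univ.image u = Sᶜ := by
    refine Finset.eq_of_subset_of_card_le ?_ ?_
    · intro x hx
      obtain ⟨i, -, rfl⟩ := Finset.mem_image.1 hx
      exact Finset.mem_compl.2 (hu i)
    · rw [Finset.card_image_of_injective _ hinj, Finset.card_compl, Finset.card_univ,
        Fintype.card_fin, Fintype.card_fin]
      omega
  obtain ⟨i, -, hi⟩ := Finset.mem_image.1 (h.symm ▸ Finset.mem_compl.2 hz : z ∈ Finset.univ.image u)
  exact ⟨i, hi⟩

theorem Flaw.card_vertices (f : Flaw col) :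
    ({f.v₁, f.v₂, f.v₃, f.v₄} : Finset (Fin (2 * n))).card = 4 := by
  have h1 := f.lt₂₁.ne'
  have h2 := f.lt₄₃.ne'
  have h3 := f.lt₃₁.ne'
  have h4 := (f.lt₄₃.trans f.lt₃₁).ne'
  rw [Finset.card_insert_of_notMem, Finset.card_insert_of_notMem, Finset.card_pair h2]
  · simp [f.ne₂₃, f.ne₂₄]
  · simp [h1, h3, h4]

set_option maxHeartbeats 1000000 in
/-- The body of the loop performs a round of the walk. -/
theorem round_spec (hn : 4 ≤ n) (hW : (2 * n) ^ 2 + 2 * n < 2 ^ w) {s : State} {M : PM n}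
    (h : Head w col s M) {f : Flaw col} (hf : f.Present M) (h6 : s.reg 6 = f.v₁)
    (h7 : s.reg 7 = f.v₂) (h8 : s.reg 8 = f.v₃) (h9 : s.reg 9 = f.v₄) :
    ∃ (post : Fin (2 * n - 5 + 1) → Fin (2 * n - 7 + 1) → State)
      (mm : Fin (2 * n - 5 + 1) → Fin (2 * n - 7 + 1) → PM n),
      (∀ i j, Head w col (post i j) (mm i j)) ∧ (∀ i j, mm i j ∈ f.actions M) ∧
      (Function.Injective fun x : Fin (2 * n - 5 + 1) × Fin (2 * n - 7 + 1) => mm x.1 x.2) ∧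
      (∀ M' ∈ f.actions M, ∃ i j, mm i j = M') ∧
      Runs w (bodyTime n) bodyProg s ((PMF.uniformOfFintype (Fin (2 * n - 5 + 1))).bind fun i =>
        (PMF.uniformOfFintype (Fin (2 * n - 7 + 1))).bind fun j => PMF.pure (post i j)) := by
  have a₁ : 2 * n - 5 + 1 + 4 = 2 * n := by omega
  have a₃ : 2 * n - 7 + 1 + 6 = 2 * n := by omega
  obtain ⟨s₁, ⟨hst, k23, keep⟩, hr₁⟩ := cutFlaw_spec hn hW h h6 h7 h8 h9
  have first : ∀ i : Fin (2 * n - 5 + 1), _ := fun i => round_of_first (i := i) hn hW hf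
    (hst.setReg (i : ℕ))
    (by rw [State.setReg_reg_of_ne _ _ (by omega), keep 6 (by omega) (by omega), h6])
    (by rw [State.setReg_reg_of_ne _ _ (by omega), keep 7 (by omega) (by omega), h7])
    (by rw [State.setReg_reg_of_ne _ _ (by omega), keep 8 (by omega) (by omega), h8])
    (by rw [State.setReg_reg_of_ne _ _ (by omega), keep 9 (by omega) (by omega), h9])
    (by
      have := i.2
      rw [State.setReg_reg_self, Nat.mod_eq_of_lt (by omega)])
    (by have := i.2; omega)
  choose u₁ u₃ post mm q1 q2 q3 q4 using first
  -- The draw is recovered from the vertex by `countOff`.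
  have inj₁ : Function.Injective u₁ := fun i i' hi => Fin.ext (by rw [← q2 i, ← q2 i', hi])
  have inj₃ : ∀ i, Function.Injective (u₃ i) := fun i j j' hj =>
    Fin.ext (by rw [← (q3 i j).2.1, ← (q3 i j').2.1, hj])
  refine ⟨post, mm, fun i j => (q3 i j).2.2.2.2, fun i j => (q3 i j).2.2.2.1, ?_, ?_, ?_⟩
  · rintro ⟨i, j⟩ ⟨i', j'⟩ hij
    simp only at hij
    have e1 := (q3 i j).2.2.1.partner_eq
    have e2 := (q3 i' j').2.2.1.partner_eq
    rw [hij] at e1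
    obtain rfl : i = i' := inj₁ (e1.1.symm.trans e2.1)
    obtain rfl : j = j' := inj₃ i (e1.2.2.1.symm.trans e2.2.2.1)
    rfl
  · intro M' hM'
    obtain ⟨t₁, t₃, h₁, h₃, h31, h32, hsw⟩ := Flaw.mem_actions_iff'.1 hM'
    have hcard := f.card_vertices
    have hd := Flaw.nodup hf h₁ h₃ h31 h32
    simp only [List.nodup_cons, List.mem_cons, List.not_mem_nil, not_or, or_false] at hd
    have ht₁ : t₁ ∉ ({f.v₁, f.v₂, f.v₃, f.v₄} : Finset (Fin (2 * n))) := by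
      simp only [Finset.mem_insert, Finset.mem_singleton, not_or]
      exact h₁
    have hm₁ : 2 * n - 5 + 1 + ({f.v₁, f.v₂, f.v₃, f.v₄} : Finset (Fin (2 * n))).card = 2 * n := by
      rw [hcard, a₁]
    -- There are as many draws as admissible vertices, so each vertex is drawn; likewise for t₃
    -- below.
    obtain ⟨i, rfl⟩ := exists_eq_of_injective q1 inj₁ hm₁ ht₁
    have hcard₂ : (insert (u₁ i) (insert (partner M (u₁ i)) {f.v₁, f.v₂, f.v₃, f.v₄}) :
        Finset (Fin (2 * n))).card = 6 := by
      rw [Finset.card_insert_of_notMem, Finset.card_insert_of_notMem, hcard]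
      · simp only [Finset.mem_insert, Finset.mem_singleton]
        grind
      · simp only [Finset.mem_insert, Finset.mem_singleton]
        grind
    have ht₃ : t₃ ∉ (insert (u₁ i) (insert (partner M (u₁ i)) {f.v₁, f.v₂, f.v₃, f.v₄}) :
        Finset (Fin (2 * n))) := by
      simp only [Finset.mem_insert, Finset.mem_singleton, not_or]
      exact ⟨h31, h32, h₃⟩
    have hm₃ : 2 * n - 7 + 1 + (insert (u₁ i) (insert (partner M (u₁ i))
        {f.v₁, f.v₂, f.v₃, f.v₄}) : Finset (Fin (2 * n))).card = 2 * n := by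
      rw [hcard₂, a₃]
    obtain ⟨j, rfl⟩ := exists_eq_of_injective (fun j => (q3 i j).1) (inj₃ i) hm₃ ht₃
    exact ⟨i, j, (q3 i j).2.2.1.unique hsw⟩
  · refine (hr₁.seq_pure (Runs.rand_seq k23 q4)).mono ?_
    unfold bodyTime
    omega

/-! ## Probabilities -/

theorem PMF.toOuterMeasure_add_compl {α : Type*} (p : PMF α) (Z : Set α) :
    p.toOuterMeasure Z + p.toOuterMeasure Zᶜ = 1 := by
  rw [PMF.toOuterMeasure_apply, PMF.toOuterMeasure_apply, ← ENNReal.tsum_add, ← p.tsum_coe]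
  exact tsum_congr fun x => congrFun (Set.indicator_self_add_compl Z p) x

theorem absorbing_halted (w : ℕ) (Z : Set State) :
    Absorbing w {c | c.control = [] ∧ c.state ∈ Z} := by
  rintro ⟨k, s⟩ ⟨rfl, hs⟩ c' hc'
  simp only [step, PMF.support_pure, Set.mem_singleton_iff] at hc'
  subst hc'
  exact ⟨rfl, hs⟩

theorem run_nil (w t : ℕ) (s : State) : run w t ⟨[], s⟩ = PMF.pure ⟨[], s⟩ := by
  induction t with
  | zero => rfl
  | succ t ih => rw [run, step, PMF.pure_bind, ih]

theorem Runs.le_apply {T : ℕ} {p : Prog} {s : State} {ν : PMF State} (h : Runs w T p s ν)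
    (Z : Set State) : ν.toOuterMeasure Z ≤
      (run w T ⟨[p], s⟩).toOuterMeasure {c | c.control = [] ∧ c.state ∈ Z} := by
  refine le_trans (le_of_eq ?_) (h.lower [] _ (absorbing_halted w Z) 0)
  have : (fun s' => run w 0 ⟨[], s'⟩) = PMF.pure ∘ fun s' => (⟨[], s'⟩ : Config) := rfl
  rw [this, PMF.bind_pure_comp, PMF.toOuterMeasure_map_apply]
  congr 1
  ext s'
  simp

/-- The lower bounds for Z and for its complement already add up to 1, so both are equalities. -/
theorem Runs.apply_eq {T : ℕ} {p : Prog} {s : State} {ν : PMF State} (h : Runs w T p s ν)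
    (Z : Set State) : (run w T ⟨[p], s⟩).toOuterMeasure {c | c.control = [] ∧ c.state ∈ Z} =
      ν.toOuterMeasure Z := by
  refine le_antisymm ?_ (h.le_apply Z)
  set P := run w T ⟨[p], s⟩
  set X : Set Config := {c | c.control = [] ∧ c.state ∈ Z}
  have h1 : P.toOuterMeasure X + ν.toOuterMeasure Zᶜ ≤ ν.toOuterMeasure Z + ν.toOuterMeasure Zᶜ := by
    rw [PMF.toOuterMeasure_add_compl, ← PMF.toOuterMeasure_add_compl P X]
    gcongr
    refine (h.le_apply Zᶜ).trans (MeasureTheory.OuterMeasure.mono _ ?_)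
    rintro c ⟨-, hc⟩ ⟨-, hc'⟩
    exact hc hc'
  refine (ENNReal.add_le_add_iff_right ?_).1 h1
  refine ne_top_of_le_ne_top ENNReal.one_ne_top ?_
  rw [← PMF.toOuterMeasure_add_compl ν Z]
  exact le_add_self

/-- Probability of each of the results of a round. -/
noncomputable def roundProb (n : ℕ) : ℝ≥0∞ := ENNReal.ofReal ((2 * n - 4) * (2 * n - 6) : ℝ)⁻¹

theorem roundProb_eq (hn : 4 ≤ n) :
    roundProb n = ((2 * n - 5 + 1 : ℕ) : ℝ≥0∞)⁻¹ * ((2 * n - 7 + 1 : ℕ) : ℝ≥0∞)⁻¹ := by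
  have h1 : ((2 * n - 5 + 1 : ℕ) : ℝ) = 2 * n - 4 := by
    rw [show 2 * n - 5 + 1 = 2 * n - 4 by omega, Nat.cast_sub (by omega)]
    push_cast; ring
  have h2 : ((2 * n - 7 + 1 : ℕ) : ℝ) = 2 * n - 6 := by
    rw [show 2 * n - 7 + 1 = 2 * n - 6 by omega, Nat.cast_sub (by omega)]
    push_cast; ring
  rw [roundProb, ← h1, ← h2, mul_inv, ENNReal.ofReal_mul (by positivity),
    ENNReal.ofReal_inv_of_pos (by positivity), ENNReal.ofReal_inv_of_pos (by positivity),
    ENNReal.ofReal_natCast, ENNReal.ofReal_natCast]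

theorem toOuterMeasure_round {α : Type*} (hn : 4 ≤ n)
    (post : Fin (2 * n - 5 + 1) → Fin (2 * n - 7 + 1) → State) (g : State → PMF α) (X : Set α) :
    (((PMF.uniformOfFintype (Fin (2 * n - 5 + 1))).bind fun i =>
        (PMF.uniformOfFintype (Fin (2 * n - 7 + 1))).bind fun j => PMF.pure (post i j)).bind
      g).toOuterMeasure X =
    roundProb n * ∑ i, ∑ j, (g (post i j)).toOuterMeasure X := by
  simp only [PMF.bind_bind, PMF.pure_bind, PMF.toOuterMeasure_bind_apply, tsum_fintype,
    PMF.uniformOfFintype_apply, Fintype.card_fin]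
  rw [roundProb_eq hn, Finset.mul_sum]
  refine Finset.sum_congr rfl fun i _ => ?_
  simp only [Finset.mul_sum, mul_assoc]

/-- Pairs of draws correspond bijectively to actions. -/
theorem sum_round {f : Flaw col} {M : PM n}
    {mm : Fin (2 * n - 5 + 1) → Fin (2 * n - 7 + 1) → PM n} (h₁ : ∀ i j, mm i j ∈ f.actions M)
    (h₂ : Function.Injective fun x : Fin (2 * n - 5 + 1) × Fin (2 * n - 7 + 1) => mm x.1 x.2)
    (h₃ : ∀ M' ∈ f.actions M, ∃ i j, mm i j = M') {R : Type*} [AddCommMonoid R] (F : PM n → R) :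
    ∑ i, ∑ j, F (mm i j) = ∑ M' ∈ f.act M, F M' := by
  classical
  have : f.act M = Finset.univ.image fun x : Fin (2 * n - 5 + 1) × Fin (2 * n - 7 + 1) =>
      mm x.1 x.2 := by
    ext M'
    simp only [Flaw.mem_act, Finset.mem_image, Finset.mem_univ, true_and, Prod.exists]
    refine ⟨h₃ M', ?_⟩
    rintro ⟨i, j, rfl⟩
    exact h₁ i j
  rw [this, Finset.sum_image h₂.injOn, Fintype.sum_prod_type]

theorem roundProb_mul_sum_one (hn : 4 ≤ n) :
    roundProb n * ∑ _i : Fin (2 * n - 5 + 1), ∑ _j : Fin (2 * n - 7 + 1), (1 : ℝ≥0∞) = 1 := by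
  simp only [Finset.sum_const, Finset.card_univ, Fintype.card_fin, nsmul_eq_mul, mul_one]
  rw [roundProb_eq hn, ← ENNReal.mul_inv (by simp) (by simp), ENNReal.inv_mul_cancel]
  · simp
  · simp [ENNReal.mul_eq_top]

theorem ncard_actions_eq (hn : 4 ≤ n) {f : Flaw col} {M : PM n}
    {mm : Fin (2 * n - 5 + 1) → Fin (2 * n - 7 + 1) → PM n} (h₁ : ∀ i j, mm i j ∈ f.actions M)
    (h₂ : Function.Injective fun x : Fin (2 * n - 5 + 1) × Fin (2 * n - 7 + 1) => mm x.1 x.2)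
    (h₃ : ∀ M' ∈ f.actions M, ∃ i j, mm i j = M') :
    ((f.actions M).ncard : ℝ≥0∞)⁻¹ = roundProb n := by
  have h4 : f.actions M = (f.act M : Set (PM n)) := by
    ext M'
    rw [Finset.mem_coe, Flaw.mem_act]
  have h5 : (f.act M).card = (2 * n - 5 + 1) * (2 * n - 7 + 1) := by
    rw [Finset.card_eq_sum_ones, ← sum_round h₁ h₂ h₃]
    simp
  rw [h4, Set.ncard_coe_finset, h5, roundProb_eq hn, Nat.cast_mul, ENNReal.mul_inv (by simp) (by simp)]

/-! ## The main loop -/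

/-- The main loop. -/
def mainLoop : Prog := .loop 5 4 bodyProg

theorem Holds.unique {s : State} {M M' : PM n} (h : Holds s M) (h' : Holds s M') : M = M' :=
  partner_injective (funext fun u => Fin.ext ((h.list_eq u).symm.trans (h'.list_eq u)))

/-- By `Runs.safe`, a configuration inside the body has further programs above the loop on its
stack. So control at the loop head means that a whole round is over, and induction on time applies.
-/
theorem Head.of_mem_support (hn : 4 ≤ n) (hW : (2 * n) ^ 2 + 2 * n < 2 ^ w) (t : ℕ) :
    ∀ {s : State} {M : PM n}, Head w col s M → ∀ c ∈ (run w t ⟨[mainLoop], s⟩).support,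
      c.control = [mainLoop] → ∃ M', Head w col c.state M' := by
  induction t using Nat.strong_induction_on with
  | _ t ih =>
    intro s M h c hc hctl
    cases t with
    | zero =>
      simp only [run, PMF.support_pure, Set.mem_singleton_iff] at hc
      subst hc
      exact ⟨M, h⟩
    | succ t =>
      rw [run, mainLoop, step, PMF.pure_bind, h.consts.r5] at hc
      rcases h.cases with ⟨h4, -⟩ | ⟨h4, f, hf, h6, h7, h8, h9⟩
      · rw [if_neg (by omega), run_nil] at hc
        simp only [PMF.support_pure, Set.mem_singleton_iff] at hc
        subst hc
        simp at hctl
      · rw [if_pos (by omega)] at hc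
        obtain ⟨post, mm, hh, -, -, -, hr⟩ := round_spec hn hW h hf.1 h6 h7 h8 h9
        rcases hr.safe _ _ _ hc with ⟨l, hl, hc⟩ | ⟨t', ht', s', hs', hc⟩
        · rw [hc] at hctl
          have := congrArg List.length hctl
          simp at this
          exact absurd this hl
        · simp only [PMF.mem_support_bind_iff, PMF.support_pure, Set.mem_singleton_iff] at hs'
          obtain ⟨i, -, j, -, rfl⟩ := hs'
          exact ih t' (by omega) (hh i j) c hc hctl

/-- Either the walk lasts m rounds or the machine has succeeded in the time of m rounds and one last
test. The induction follows the recursion of `h`. -/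
theorem one_le_survival_add (hn : 4 ≤ n) (hW : (2 * n) ^ 2 + 2 * n < 2 ^ w)
    {h : ℕ → PM n → ℝ≥0∞} (h₀ : ∀ M, h 0 M = 1)
    (h₁ : ∀ m M (f : Flaw col), IsTop f M → h (m + 1) M =
      ENNReal.ofReal ((2 * n - 4) * (2 * n - 6) : ℝ)⁻¹ * ∑ M' ∈ f.act M, h m M') (m : ℕ) :
    ∀ {s : State} {M : PM n}, Head w col s M →
      1 ≤ h m M + (run w (m * (bodyTime n + 1) + 1) ⟨[mainLoop], s⟩).toOuterMeasure
        {c | Success col c} := by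
  have habs : Absorbing w {c | Success col c} :=
    absorbing_halted w {s | ∃ M : PM n, Rainbow col M ∧ Holds s M}
  induction m with
  | zero =>
    intro s M _
    rw [h₀]
    exact le_self_add
  | succ m ih =>
    intro s M hs
    rcases hs.cases with ⟨h4, hrain⟩ | ⟨h4, f, hf, h6, h7, h8, h9⟩
    · refine le_trans (le_of_eq ?_) le_add_self
      rw [run, mainLoop, step, if_neg (by rw [hs.consts.r5]; omega), PMF.pure_bind, run_nil,
        PMF.toOuterMeasure_pure_apply, if_pos]
      exact ⟨rfl, M, hrain, hs.holds⟩
    · obtain ⟨post, mm, hh, q1, q2, q3, hr⟩ := round_spec hn hW hs hf.1 h6 h7 h8 h9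
      have hlow := hr.lower [mainLoop] _ habs (m * (bodyTime n + 1) + 1)
      rw [toOuterMeasure_round hn] at hlow
      rw [h₁ m M f hf, show (m + 1) * (bodyTime n + 1) + 1 =
        (bodyTime n + (m * (bodyTime n + 1) + 1)) + 1 by ring, run, mainLoop, step,
        if_pos (by rw [hs.consts.r5]; omega), PMF.pure_bind, ← mainLoop]
      refine le_trans ?_ (add_le_add_right hlow _)
      rw [← sum_round q1 q2 q3, ← roundProb, ← mul_add, ← Finset.sum_add_distrib]
      calc (1 : ℝ≥0∞) = roundProb n * ∑ _i : Fin (2 * n - 5 + 1), ∑ _j : Fin (2 * n - 7 + 1), 1 :=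
            (roundProb_mul_sum_one hn).symm
        _ ≤ _ := by
            gcongr with i _
            rw [← Finset.sum_add_distrib]
            gcongr with j _
            exact ih (hh i j)

theorem performsSwitchWalk (hn : 4 ≤ n) (hW : (2 * n) ^ 2 + 2 * n < 2 ^ w)
    (hcol : ∀ e, col e < 2 ^ w) : PerformsSwitchWalk w col initProg 5 4 bodyProg := by
  obtain ⟨s₀, M₀, hh₀, hr₀⟩ := init_spec (by omega) hW hcol
  refine ⟨Flaw.rank, Flaw.rank_injective, ⟨initTime n, ?_⟩, ?_⟩
  · have h1 := hr₀.apply_eq Set.univ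
    rw [show (PMF.pure s₀).toOuterMeasure Set.univ = 1 by simp [PMF.toOuterMeasure_pure_apply],
      PMF.toOuterMeasure_apply_eq_one_iff] at h1
    exact fun c hc => (h1 hc).1
  · intro t c hc hctl
    obtain ⟨M, hM⟩ : ∃ M, Head w col c.state M := by
      cases t with
      | zero =>
        simp only [run, PMF.support_pure, Set.mem_singleton_iff] at hc
        subst hc
        simp at hctl
      | succ t =>
        rw [run, step, PMF.pure_bind] at hc
        rcases hr₀.safe _ _ _ hc with ⟨l, hl, hc⟩ | ⟨t', -, s', hs', hc⟩
        · rw [hc] at hctl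
          have := congrArg List.length hctl
          simp at this
          exact absurd this hl
        · simp only [PMF.support_pure, Set.mem_singleton_iff] at hs'
          subst hs'
          exact hh₀.of_mem_support hn hW t' c hc hctl
    refine ⟨M, hM.holds, ?_, ?_⟩
    · intro hrain
      rcases hM.cases with ⟨h4, -⟩ | ⟨-, f, hf, -⟩
      · rw [hM.consts.r5]; omega
      · exact absurd hf.1 ((rainbow_iff M).1 hrain f)
    · intro f hf hmax
      rcases hM.cases with ⟨-, hrain⟩ | ⟨h4, g, hg, h6, h7, h8, h9⟩
      · exact absurd hf ((rainbow_iff M).1 hrain f)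
      obtain rfl : f = g := IsTop.unique ⟨hf, hmax⟩ hg
      obtain ⟨post, mm, hh, q1, q2, q3, hr⟩ := round_spec hn hW hM hf h6 h7 h8 h9
      refine ⟨by rw [hM.consts.r5]; omega, ⟨_, q1 0 0⟩, bodyTime n, fun M' hM' => ?_⟩
      refine (hr.apply_eq {s | Holds s M'}).trans ?_
      rw [ncard_actions_eq hn q1 q2 q3, ← PMF.bind_pure (PMF.bind _ _), toOuterMeasure_round hn]
      classical
      have : ∀ i j, (PMF.pure (post i j)).toOuterMeasure {s | Holds s M'} =
          if mm i j = M' then 1 else 0 := by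
        intro i j
        rw [PMF.toOuterMeasure_pure_apply]
        congr 1
        refine propext ⟨fun h => (hh i j).holds.unique h, ?_⟩
        rintro rfl
        exact (hh i j).holds
      simp only [this]
      rw [sum_round q1 q2 q3 (fun M'' => if M'' = M' then (1 : ℝ≥0∞) else 0),
        Finset.sum_ite_eq', if_pos (Flaw.mem_act.2 hM'), mul_one]

/-! ### Counting steps -/

theorem scanTime_le (hn : 1 ≤ n) : scanTime n ≤ 176 * n ^ 2 := by
  unfold scanTime
  nlinarith

/-- The constant 599 = 218 + 381 pays for the initialisation with the extra steps and for the round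
gained by rounding up m; each further round costs at most 381 n². -/
theorem time_bound {κ : ℝ} (hκ : 0 ≤ κ) (hn : 3 ≤ n) {s t m : ℕ} (hs : 1 ≤ s)
    (hm : (m : ℝ) ≤ κ * (s * (n * Real.log n)) + 1)
    (ht : (599 + 381 * κ) * s * ((n : ℝ) ^ 4 * Real.log n) ≤ t) :
    initTime n + (m * (bodyTime n + 1) + 1) + 1 ≤ t := by
  have h1 := scanTime_le (n := n) (by omega)
  have hi : initTime n ≤ 216 * n ^ 2 := by
    unfold initTime
    nlinarith
  have hb : bodyTime n + 1 ≤ 381 * n ^ 2 := by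
    unfold bodyTime
    nlinarith
  have hn' : (3 : ℝ) ≤ n := by exact_mod_cast hn
  have hs' : (1 : ℝ) ≤ s := by exact_mod_cast hs
  have hlog : 1 ≤ Real.log n := by
    rw [Real.le_log_iff_exp_le (by linarith)]
    linarith [Real.exp_one_lt_d9]
  set l := Real.log n
  have hT : initTime n + (m * (bodyTime n + 1) + 1) + 1 ≤ 218 * n ^ 2 + m * (381 * n ^ 2) := by
    have : m * (bodyTime n + 1) ≤ m * (381 * n ^ 2) := Nat.mul_le_mul_left _ hb
    nlinarith
  have hT' : ((initTime n + (m * (bodyTime n + 1) + 1) + 1 : ℕ) : ℝ) ≤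
      218 * n ^ 2 + m * (381 * n ^ 2) := by exact_mod_cast hT
  suffices H : (218 : ℝ) * n ^ 2 + m * (381 * n ^ 2) ≤ t by exact_mod_cast hT'.trans H
  refine le_trans ?_ ht
  have hsl : 1 ≤ s * l := by nlinarith
  have e1 : (n : ℝ) ^ 2 ≤ s * (n ^ 4 * l) := by
    have : (n : ℝ) ^ 2 * 1 ≤ n ^ 4 * (s * l) := by
      gcongr
      · linarith
      · norm_num
    linarith
  have e2 : (n : ℝ) ^ 3 * (s * l) ≤ s * (n ^ 4 * l) := by
    have : (n : ℝ) ^ 3 * (s * l) ≤ n ^ 4 * (s * l) := by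
      gcongr
      · linarith
      · norm_num
    linarith
  calc (218 : ℝ) * n ^ 2 + m * (381 * n ^ 2)
      ≤ 218 * n ^ 2 + (κ * (s * (n * l)) + 1) * (381 * n ^ 2) := by gcongr
    _ = 599 * n ^ 2 + 381 * κ * (n ^ 3 * (s * l)) := by ring
    _ ≤ 599 * (s * (n ^ 4 * l)) + 381 * κ * (s * (n ^ 4 * l)) := by gcongr
    _ = _ := by ring

end RainbowMatching

open scoped ENNReal

open RainbowMatching in
theorem mainTheorem7 :
    ∃ (init body : Prog) (a b : ℕ) (B : ℕ), ∀ C : ℝ, 2 * Real.exp 1 < C →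
      ∃ K : ℝ, ∀ n : ℕ, 1 ≤ n → ∀ w : ℕ, B * n ^ 2 ≤ 2 ^ w →
        ∀ col : Coloring n, (∀ e, col e < 2 ^ w) →
          (∀ k : ℕ, ({e | col e = k}.ncard : ℝ) ≤ n / C) →
          PerformsSwitchWalk w col init a b body ∧
          ∀ s : ℕ, 1 ≤ s → ∀ t : ℕ, K * s * ((n : ℝ) ^ 4 * Real.log n) ≤ t →
            1 - (2⁻¹ : ℝ≥0∞) ^ (s * n) ≤
              (run w t ⟨[.seq init (.loop a b body)], input n col⟩).toOuterMeasure
                {c | Success col c} := by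
  -- The test is 0 < flag. The constant 7 works because 4n² + 2n < 7n².
  refine ⟨initProg, bodyProg, 5, 4, 7, fun C hC => ?_⟩
  set κ := (5 + 3 / 2 * C) / Real.log (C / (2 * Real.exp 1)) with hκdef
  have hC0 : 0 < C := by linarith [two_exp_one_gt]
  have hκ : 0 ≤ κ := div_nonneg (by positivity)
    (Real.log_pos (by rwa [one_lt_div (by positivity)])).le
  refine ⟨599 + 381 * κ, fun n hn w hw col hcol hR => ?_⟩
  have h6 : 6 ≤ n := six_le hC (le_of_ncard_le hC0 hn hR)
  have hW : (2 * n) ^ 2 + 2 * n < 2 ^ w := by nlinarith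
  refine ⟨performsSwitchWalk (by omega) hW hcol, fun s hs t ht => ?_⟩
  obtain ⟨h, h₀, h₁, h₂⟩ := exists_survival hC hn hR
  obtain ⟨s₀, M₀, hh₀, hr₀⟩ := init_spec hn hW hcol
  have hlog : 0 ≤ Real.log n := Real.log_natCast_nonneg n
  set m := ⌈κ * (s * (n * Real.log n))⌉₊ with hm
  have hm₁ := Nat.le_ceil (κ * (s * (n * Real.log n)))
  have hm₂ := (Nat.ceil_lt_add_one (show 0 ≤ κ * (s * (n * Real.log n)) by positivity)).le
  have htime := time_bound hκ (by omega) hs hm₂ ht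
  have habs : Absorbing w {c | Success col c} :=
    absorbing_halted w {s | ∃ M : PM n, Rainbow col M ∧ Holds s M}
  rw [tsub_le_iff_left]
  -- The survival term is at most 2^(-sn) by the choice of m; the success term is carried over the
  -- initialisation and then to time t, success being absorbing.
  refine (one_le_survival_add (by omega) hW h₀ h₁ m hh₀).trans ?_
  refine add_le_add (h₂ M₀ s m hs hm₁) ?_
  have hlow := hr₀.lower [mainLoop] _ habs (m * (bodyTime n + 1) + 1)
  rw [PMF.pure_bind] at hlow
  refine hlow.trans (le_trans (le_of_eq ?_) (habs.run_mono htime _))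
  rw [run, step, PMF.pure_bind]
  rfl
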